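/- **Setting.** Let $\varphi_0=e^{123}+e^{145}+e^{167}+e^{246}-e^{257}-e^{347}-e^{356}$ on $\mathbb R^7$ (wedge products in the determinant convention, so $e^{123}(e_1,e_2,e_3)=1$). Let $M$ be a smooth $7$-manifold and $\varphi$ a $G_2$-structure on $M$: a smooth $3$-form such that at each $p\in M$ there is a linear isomorphism $f:\mathbb R^7\to T_pM$ with $f^*\varphi=\varphi_0$. The associated metric $g=\langle\cdot,\cdot\rangle$ and volume form are those which any such $f$ carries over from the Euclidean metric and the standard volume form of $\mathbb R^7$; $\nabla$ is the Levi-Civita connection of $g$, $\star$ the Hodge star, and $\psi=\star\varphi$. The torsion of $\varphi$ is the $TM$-valued $1$-form $T$ determined by $\nabla_X\varphi=2\,T(X)\lrcorner\psi$ for all $X$. The octonion bundle is $\mathbb OM=(M\times\mathbb R)\oplus TM$, with real part $\operatorname{Re}(a,\alpha)=a$, imaginary part $\operatorname{Im}(a,\alpha)=\alpha$, product $$(a,\alpha)(b,\beta)=\bigl(ab-\langle\alpha,\beta\rangle,\ a\beta+b\alpha+\alpha\times\beta\bigr),\qquad \langle\alpha\times\beta,\gamma\rangle=\varphi(\alpha,\beta,\gamma),$$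 norm $\|(a,\alpha)\|^2=a^2+\langle\alpha,\alpha\rangle$, inverse $(a,\alpha)^{-1}=\|(a,\alpha)\|^{-2}(a,-\alpha)$ of a nonzero element, and connection $\nabla_X(a,\alpha)=(X(a),\nabla_X\alpha)$. Identify $TM$ with $\operatorname{Im}\mathbb OM$ by $\alpha\mapsto(0,\alpha)$; thus $T$ is an $\operatorname{Im}(\mathbb OM)$-valued $1$-form. The octonion covariant derivative is $D_XA=\nabla_XA-A\,T(X)$. For a nowhere-vanishing section $V$ put $\operatorname{Ad}_V(A)=VAV^{-1}$ and, writing $V=(v_0,v)$, $$\sigma_V(\varphi)=\frac1{\|V\|^2}\Bigl((v_0^2-\|v\|^2)\,\varphi-2v_0\,v\lrcorner\psi+2\,v^\flat\wedge(v\lrcorner\varphi)\Bigr).$$ **Theorem.** Let $(M,\varphi)$ be a $G_2$-structure with torsion $T$, and let $V$ be a nowhere-vanishing smooth section of $\mathbb OM$. Then $\sigma_V(\varphi)$ is a $G_2$-structure, and its torsion $T_V$ (formed with the metric, the Levi-Civita connection and the Hodge star associated with $\sigma_V(\varphi)$) is given, for every tangent vector $X$, by $$T_V(X)=\operatorname{Im}\bigl(\operatorname{Ad}_V(T(X))+V(\nabla_XV^{-1})\bigr).$$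 If moreover $\|V\|$ is constant, then for every tangent vector $X$ $$T_V(X)=-(D_XV)\,V^{-1}$$ as sections of $\mathbb OM$. In all these formulas products, inverses, norms, $\nabla$ and $D$ are those of $\varphi$. The existence of the torsions $T$ and $T_V$ is part of the assertion. -/

import Mathlib

open scoped Manifold ContDiff

noncomputable section

namespace G2

/-- The model space `ℝ⁷` with its Euclidean inner product and standard orientation. -/
abbrev E7 : Type := EuclideanSpace ℝ (Fin 7)

/-- The linear map `u ↦ (uᵢ, uⱼ, uₖ)` on `ℝ⁷`. -/
def coord3 (i j k : Fin 7) : E7 →ₗ[ℝ] (Fin 3 → ℝ) where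
  toFun u := ![u i, u j, u k]
  map_add' u w := by ext a; fin_cases a <;> rfl
  map_smul' c u := by ext a; fin_cases a <;> rfl

/-- The elementary 3-form `eⁱ ∧ eʲ ∧ eᵏ` on `ℝ⁷`: its value on `(u, v, w)` is the determinant of
the `3 × 3` matrix of the coordinates `i, j, k` of `u, v, w`. -/
def elem3 (i j k : Fin 7) : E7 [⋀^Fin 3]→ₗ[ℝ] ℝ :=
  (Matrix.detRowAlternating : (Fin 3 → ℝ) [⋀^Fin 3]→ₗ[ℝ] ℝ).compLinearMap (coord3 i j k)

/-- The model form `φ₀ = e¹²³ + e¹⁴⁵ + e¹⁶⁷ + e²⁴⁶ - e²⁵⁷ - e³⁴⁷ - e³⁵⁶`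
(coordinates are numbered from `0` in the code). -/
def phi0 : E7 [⋀^Fin 3]→ₗ[ℝ] ℝ :=
  elem3 0 1 2 + elem3 0 3 4 + elem3 0 5 6 + elem3 1 3 5
    - elem3 1 4 6 - elem3 2 3 6 - elem3 2 4 5

/-! ### Linear algebra of a positive 3-form on one 7-dimensional vector space -/

/-- A linear isomorphism from `ℝ⁷` which pulls `φ` back to the model form. -/
def IsAdaptedFrame {W : Type*} [AddCommGroup W] [Module ℝ W]
    (φ : W [⋀^Fin 3]→ₗ[ℝ] ℝ) (f : E7 ≃ₗ[ℝ] W) : Prop :=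
  φ.compLinearMap f.toLinearMap = phi0

/-- `φ` is a positive 3-form. -/
def IsPositive {W : Type*} [AddCommGroup W] [Module ℝ W]
    (φ : W [⋀^Fin 3]→ₗ[ℝ] ℝ) : Prop :=
  ∃ f : E7 ≃ₗ[ℝ] W, IsAdaptedFrame φ f

/-- A chosen adapted frame of a positive 3-form (an arbitrary frame if `φ` is not positive).
Two adapted frames differ by an element of `G₂ ⊂ SO(7)`, so the metric, the orientation and all
other objects built from the chosen frame below depend only on `φ`. -/
def frame {W : Type*} [AddCommGroup W] [Module ℝ W] [Nonempty (E7 ≃ₗ[ℝ] W)]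
    (φ : W [⋀^Fin 3]→ₗ[ℝ] ℝ) : E7 ≃ₗ[ℝ] W :=
  Classical.epsilon fun f => IsAdaptedFrame φ f

/-- The basis of `W` given by the chosen adapted frame. It is orthonormal for `metric φ` and
positively oriented for `vol φ`. -/
def frameBasis {W : Type*} [AddCommGroup W] [Module ℝ W] [Nonempty (E7 ≃ₗ[ℝ] W)]
    (φ : W [⋀^Fin 3]→ₗ[ℝ] ℝ) : Module.Basis (Fin 7) ℝ W :=
  (EuclideanSpace.basisFun (Fin 7) ℝ).toBasis.map (frame φ)

/-- The inner product `g` associated with `φ`: the Euclidean one, read in an adapted frame. -/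
def metric {W : Type*} [AddCommGroup W] [Module ℝ W] [Nonempty (E7 ≃ₗ[ℝ] W)]
    (φ : W [⋀^Fin 3]→ₗ[ℝ] ℝ) : W →ₗ[ℝ] W →ₗ[ℝ] ℝ :=
  (innerₗ E7).compl₁₂ (frame φ).symm.toLinearMap (frame φ).symm.toLinearMap

/-- The volume form associated with `φ`: `e¹ ∧ ⋯ ∧ e⁷` in an adapted frame. -/
def vol {W : Type*} [AddCommGroup W] [Module ℝ W] [Nonempty (E7 ≃ₗ[ℝ] W)]
    (φ : W [⋀^Fin 3]→ₗ[ℝ] ℝ) : W [⋀^Fin 7]→ₗ[ℝ] ℝ :=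
  (frameBasis φ).det

/-- The Hodge star of a 3-form `η` for the metric and volume form of `φ`: with an oriented
orthonormal basis `e`, the 4-form `(1/3!) ∑ η(eᵢ, eⱼ, eₖ) vol(eᵢ, eⱼ, eₖ, ·, ·, ·, ·)`. -/
def hodgeStar {W : Type*} [AddCommGroup W] [Module ℝ W] [Nonempty (E7 ≃ₗ[ℝ] W)]
    (φ η : W [⋀^Fin 3]→ₗ[ℝ] ℝ) : W [⋀^Fin 4]→ₗ[ℝ] ℝ :=
  (1 / 6 : ℝ) • ∑ i : Fin 7, ∑ j : Fin 7, ∑ k : Fin 7,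
    η ![frameBasis φ i, frameBasis φ j, frameBasis φ k] •
      (((vol φ).curryLeft (frameBasis φ i)).curryLeft (frameBasis φ j)).curryLeft (frameBasis φ k)

/-- The 4-form `ψ = ⋆φ`. -/
def psi {W : Type*} [AddCommGroup W] [Module ℝ W] [Nonempty (E7 ≃ₗ[ℝ] W)]
    (φ : W [⋀^Fin 3]→ₗ[ℝ] ℝ) : W [⋀^Fin 4]→ₗ[ℝ] ℝ :=
  hodgeStar φ φ

/-- The vector `α♯` with `g(α♯, w) = α(w)`, for a linear functional `α`; it is written out
in an orthonormal basis as `∑ α(eᵢ) eᵢ`. -/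
def sharp {W : Type*} [AddCommGroup W] [Module ℝ W] [Nonempty (E7 ≃ₗ[ℝ] W)]
    (φ : W [⋀^Fin 3]→ₗ[ℝ] ℝ) (α : W → ℝ) : W :=
  ∑ i : Fin 7, α (frameBasis φ i) • frameBasis φ i

/-- The cross product: `g(u × w, z) = φ(u, w, z)`. -/
def cross {W : Type*} [AddCommGroup W] [Module ℝ W] [Nonempty (E7 ≃ₗ[ℝ] W)]
    (φ : W [⋀^Fin 3]→ₗ[ℝ] ℝ) (u w : W) : W :=
  sharp φ fun z => φ ![u, w, z]

/-- The fibre `ℝ ⊕ W` of the octonion bundle; first component real part, second imaginary part. -/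
abbrev Oct (W : Type*) : Type _ := ℝ × W

/-- The octonion product
`(a, α)(b, β) = (ab - g(α, β), aβ + bα + α × β)`. -/
def octMul {W : Type*} [AddCommGroup W] [Module ℝ W] [Nonempty (E7 ≃ₗ[ℝ] W)]
    (φ : W [⋀^Fin 3]→ₗ[ℝ] ℝ) (A B : Oct W) : Oct W :=
  (A.1 * B.1 - metric φ A.2 B.2, A.1 • B.2 + B.1 • A.2 + cross φ A.2 B.2)

/-- `‖A‖² = a² + g(α, α)` for `A = (a, α)`. -/
def octNormSq {W : Type*} [AddCommGroup W] [Module ℝ W] [Nonempty (E7 ≃ₗ[ℝ] W)]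
    (φ : W [⋀^Fin 3]→ₗ[ℝ] ℝ) (A : Oct W) : ℝ :=
  A.1 ^ 2 + metric φ A.2 A.2

/-- The octonion norm `‖A‖`. -/
def octNorm {W : Type*} [AddCommGroup W] [Module ℝ W] [Nonempty (E7 ≃ₗ[ℝ] W)]
    (φ : W [⋀^Fin 3]→ₗ[ℝ] ℝ) (A : Oct W) : ℝ :=
  Real.sqrt (octNormSq φ A)

/-- The inverse `A⁻¹ = ‖A‖⁻² (a, -α)` of `A = (a, α) ≠ 0`. -/
def octInv {W : Type*} [AddCommGroup W] [Module ℝ W] [Nonempty (E7 ≃ₗ[ℝ] W)]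
    (φ : W [⋀^Fin 3]→ₗ[ℝ] ℝ) (A : Oct W) : Oct W :=
  (octNormSq φ A)⁻¹ • (A.1, -A.2)

/-- The adjoint map `Ad_V A = V A V⁻¹`. -/
def octAd {W : Type*} [AddCommGroup W] [Module ℝ W] [Nonempty (E7 ≃ₗ[ℝ] W)]
    (φ : W [⋀^Fin 3]→ₗ[ℝ] ℝ) (V A : Oct W) : Oct W :=
  octMul φ (octMul φ V A) (octInv φ V)

/-- The wedge product of a 1-form and a 2-form (determinant convention):
`(α ∧ β)(x, y, z) = α(x) β(y, z) + α(y) β(z, x) + α(z) β(x, y)`. -/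
def wedge12 {W : Type*} [AddCommGroup W] [Module ℝ W]
    (α : W →ₗ[ℝ] ℝ) (β : W [⋀^Fin 2]→ₗ[ℝ] ℝ) : W [⋀^Fin 3]→ₗ[ℝ] ℝ :=
  (1 / 2 : ℝ) • MultilinearMap.alternatization
    (LinearMap.uncurryLeft (M := fun _ : Fin 3 => W) (α.smulRight β.toMultilinearMap))

/-- The deformed 3-form, for `V = (v₀, v)`:
`σ_V(φ) = ‖V‖⁻² ((v₀² - ‖v‖²) φ - 2 v₀ (v ⌟ ψ) + 2 v♭ ∧ (v ⌟ φ))`. -/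
def sigma {W : Type*} [AddCommGroup W] [Module ℝ W] [Nonempty (E7 ≃ₗ[ℝ] W)]
    (φ : W [⋀^Fin 3]→ₗ[ℝ] ℝ) (V : Oct W) : W [⋀^Fin 3]→ₗ[ℝ] ℝ :=
  (octNormSq φ V)⁻¹ • ((V.1 ^ 2 - metric φ V.2 V.2) • φ - (2 * V.1) • (psi φ).curryLeft V.2
    + (2 : ℝ) • wedge12 (metric φ V.2) (φ.curryLeft V.2))

/-! ### G₂-structures on a 7-manifold -/

instance nonempty_frame {M : Type*} [TopologicalSpace M] [ChartedSpace E7 M] (x : M) :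
    Nonempty (E7 ≃ₗ[ℝ] TangentSpace (𝓡 7) x) :=
  ⟨LinearEquiv.refl ℝ E7⟩

/-- A (not necessarily continuous) vector field. -/
abbrev VField (M : Type*) [TopologicalSpace M] [ChartedSpace E7 M] : Type _ :=
  (x : M) → TangentSpace (𝓡 7) x

/-- A (not necessarily continuous) field of alternating 3-linear forms. -/
abbrev Form3 (M : Type*) [TopologicalSpace M] [ChartedSpace E7 M] : Type _ :=
  (x : M) → TangentSpace (𝓡 7) x [⋀^Fin 3]→ₗ[ℝ] ℝ

/-- A (not necessarily continuous) section of the octonion bundle `𝕆M = Λ⁰(M) ⊕ TM`. -/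
abbrev OctField (M : Type*) [TopologicalSpace M] [ChartedSpace E7 M] : Type _ :=
  (x : M) → Oct (TangentSpace (𝓡 7) x)

/-- Smoothness of a vector field at a point. -/
def SmoothFieldAt {M : Type*} [TopologicalSpace M] [ChartedSpace E7 M] [IsManifold (𝓡 7) ∞ M]
    (X : VField M) (x : M) : Prop :=
  ContMDiffAt (𝓡 7) ((𝓡 7).prod 𝓘(ℝ, E7)) ∞
    (fun y : M => Bundle.TotalSpace.mk' E7 (E := fun z : M => TangentSpace (𝓡 7) z) y (X y)) x

/-- A G₂-structure: a smooth 3-form which is, at every point, the model form in some basis.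
A field of alternating forms is smooth if its values on locally defined smooth vector fields
are smooth. -/
structure IsG2Structure {M : Type*} [TopologicalSpace M] [ChartedSpace E7 M]
    [IsManifold (𝓡 7) ∞ M] (φ : Form3 M) : Prop where
  smooth : ∀ (x : M) (X Y Z : VField M), SmoothFieldAt X x → SmoothFieldAt Y x →
    SmoothFieldAt Z x → ContMDiffAt (𝓡 7) 𝓘(ℝ, ℝ) ∞ (fun y => φ y ![X y, Y y, Z y]) x
  positive : ∀ x : M, IsPositive (φ x)

/-- Smoothness of a section of the octonion bundle. -/
structure IsSmoothOct {M : Type*} [TopologicalSpace M] [ChartedSpace E7 M]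
    [IsManifold (𝓡 7) ∞ M] (A : OctField M) : Prop where
  re : ContMDiff (𝓡 7) 𝓘(ℝ, ℝ) ∞ fun x => (A x).1
  im : ∀ x : M, SmoothFieldAt (fun y => (A y).2) x

/-- The function `g(X, Y)` for the metric `g` associated with `φ`. -/
def metricFn {M : Type*} [TopologicalSpace M] [ChartedSpace E7 M]
    (φ : Form3 M) (X Y : VField M) (x : M) : ℝ :=
  metric (φ x) (X x) (Y x)

/-- The derivative `X(f)` at `x` of a function in the direction of `v ∈ TₓM`. -/
def dirDeriv {M : Type*} [TopologicalSpace M] [ChartedSpace E7 M]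
    (f : M → ℝ) (x : M) (v : TangentSpace (𝓡 7) x) : ℝ :=
  mvfderiv (𝓡 7) f x v

/-- The right-hand side of the Koszul formula, i.e. `g(∇_X Y, Z)` at `x`. -/
def koszul {M : Type*} [TopologicalSpace M] [ChartedSpace E7 M]
    (φ : Form3 M) (X Y Z : VField M) (x : M) : ℝ :=
  (1 / 2 : ℝ) * (dirDeriv (metricFn φ Y Z) x (X x) + dirDeriv (metricFn φ Z X) x (Y x)
    - dirDeriv (metricFn φ X Y) x (Z x)
    - metricFn φ Y (VectorField.mlieBracket (𝓡 7) X Z) x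
    - metricFn φ Z (VectorField.mlieBracket (𝓡 7) Y X) x
    + metricFn φ X (VectorField.mlieBracket (𝓡 7) Z Y) x)

/-- A vector field, smooth near `x`, with the value `v` at `x`. -/
def ext {M : Type*} [TopologicalSpace M] [ChartedSpace E7 M] [IsManifold (𝓡 7) ∞ M]
    {x : M} (v : TangentSpace (𝓡 7) x) : VField M :=
  FiberBundle.extend E7 (E := fun z : M => TangentSpace (𝓡 7) z) v

/-- The Levi-Civita derivative `∇_v Y ∈ TₓM` of the metric associated with `φ`: the vector with
`g(∇_v Y, w) = koszul(X, Y, Z)`, where `X` and `Z` are vector fields with values `v` and `w`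
at `x`. -/
def nabla {M : Type*} [TopologicalSpace M] [ChartedSpace E7 M] [IsManifold (𝓡 7) ∞ M]
    (φ : Form3 M) (Y : VField M) (x : M) (v : TangentSpace (𝓡 7) x) : TangentSpace (𝓡 7) x :=
  sharp (φ x) fun w => koszul φ (ext v) Y (ext w) x

/-- `(∇_v φ)(a, b, c) = v(φ(A, B, C)) - φ(∇_v A, b, c) - φ(a, ∇_v B, c) - φ(a, b, ∇_v C)`, where
`A`, `B`, `C` are vector fields with values `a`, `b`, `c` at `x` and `∇` is the Levi-Civita
connection of the metric associated with `φ`. -/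
def nablaForm {M : Type*} [TopologicalSpace M] [ChartedSpace E7 M] [IsManifold (𝓡 7) ∞ M]
    (φ : Form3 M) (x : M) (v a b c : TangentSpace (𝓡 7) x) : ℝ :=
  dirDeriv (fun y => φ y ![ext a y, ext b y, ext c y]) x v
    - φ x ![nabla φ (ext a) x v, b, c] - φ x ![a, nabla φ (ext b) x v, c]
    - φ x ![a, b, nabla φ (ext c) x v]

/-- A field of endomorphisms `v ↦ T(v)` of `TM`, i.e. a 1-form with values in
`Im 𝕆M = TM`. -/
abbrev EndField (M : Type*) [TopologicalSpace M] [ChartedSpace E7 M] : Type _ :=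
  (x : M) → TangentSpace (𝓡 7) x →ₗ[ℝ] TangentSpace (𝓡 7) x

/-- `T` is the torsion of `φ`: `∇_v φ = 2 T(v) ⌟ ψ`. -/
def IsTorsion {M : Type*} [TopologicalSpace M] [ChartedSpace E7 M] [IsManifold (𝓡 7) ∞ M]
    (φ : Form3 M) (T : EndField M) : Prop :=
  ∀ (x : M) (v a b c : TangentSpace (𝓡 7) x),
    nablaForm φ x v a b c = 2 * psi (φ x) ![T x v, a, b, c]

/-- The torsion of `φ`. -/
def torsion {M : Type*} [TopologicalSpace M] [ChartedSpace E7 M] [IsManifold (𝓡 7) ∞ M]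
    (φ : Form3 M) : EndField M :=
  Classical.epsilon fun T => IsTorsion φ T

/-- The Levi-Civita connection on the octonion bundle: `∇_v (a, α) = (v(a), ∇_v α)`. -/
def nablaOct {M : Type*} [TopologicalSpace M] [ChartedSpace E7 M] [IsManifold (𝓡 7) ∞ M]
    (φ : Form3 M) (A : OctField M) (x : M) (v : TangentSpace (𝓡 7) x) :
    Oct (TangentSpace (𝓡 7) x) :=
  (dirDeriv (fun y => (A y).1) x v, nabla φ (fun y => (A y).2) x v)

/-- The octonion covariant derivative `D_v A = ∇_v A - A T(v)`, where `T(v)` is regarded as the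
imaginary octonion `(0, T(v))`. -/
def octD {M : Type*} [TopologicalSpace M] [ChartedSpace E7 M] [IsManifold (𝓡 7) ∞ M]
    (φ : Form3 M) (A : OctField M) (x : M) (v : TangentSpace (𝓡 7) x) :
    Oct (TangentSpace (𝓡 7) x) :=
  nablaOct φ A x v - octMul (φ x) (A x) (0, torsion φ x v)

/-- The field of 3-forms `σ_V(φ)`. -/
def sigmaField {M : Type*} [TopologicalSpace M] [ChartedSpace E7 M]
    (φ : Form3 M) (V : OctField M) : Form3 M :=
  fun x => sigma (φ x) (V x)

end G2

end

/-! The deformed form $\sigma_V(\varphi)$ has the metric of $\varphi$, and its octonion product is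
$A\circ_V B=(A(BV))V^{-1}$ (`IsPositive.metric_sigma`, `IsPositive.octMul_sigma`). Since the
Levi-Civita connection depends only on the metric, both torsions can be compared through the failure
of one $\nabla$ to respect two products.

The associator is $[A,B,C]=2\psi(A,B,C,\cdot)^\sharp$, so $\nabla_X\varphi=2T(X)\lrcorner\psi$ says
that $\nabla_X(AB)=(\nabla_XA)B+A(\nabla_XB)+[T(X),A,B]$. Cyclic symmetry of the associator turns
this into $D_X(AB)=(\nabla_XA)B+A(D_XB)$. Put $U=(D_XV)V^{-1}$ and apply $D_X$ to
$(A\circ_VB)V=A(BV)$. Division by $V$ on the right gives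
$\nabla_X(A\circ_VB)=(\nabla_XA)\circ_VB+A\circ_V(\nabla_XB)-[A,B,U]_V$. The product rule for
$\sigma_V(\varphi)$ has $[T_V(X),A,B]_V$ as its last term, and nondegeneracy of $\psi$ yields
$T_V(X)=-\operatorname{Im}U$. Differentiating $VV^{-1}=1$ rewrites $-U$ as
$\operatorname{Ad}_V(T(X))+V(\nabla_XV^{-1})$. For constant norm, $U$ is imaginary.

Three facts support this argument. (1) The metric is an explicit smooth function of the coefficients
of $\varphi$ (`metricCoeff_eq`, `contDiffAt_metricCoeff`). Hence it does not depend on the chosen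
adapted frame, and it is smooth although the frames need not be. (2) $\sigma_V(\varphi)$ is the
pullback of $\varphi$ by a rotation fixing $v$ (`IsPositive.form3_axialMap`), hence positive with
the same metric. (3) Torsion exists: differentiating $|a\times b|^2=|a|^2|b|^2-\langle a,b\rangle^2$
gives $(\nabla_X\varphi)(a,b,a\times b)=0$, and 3-forms with this property are contractions of
$\psi$ (`IsPositive.exists_eq_psi`). -/

noncomputable section
namespace G2

/-! ### The model form and its cross product in coordinates. -/

theorem phi0_apply (u v w : E7) : phi0 ![u, v, w] =
    (u 0 * (v 1 * w 2 - v 2 * w 1) - u 1 * (v 0 * w 2 - v 2 * w 0) + u 2 * (v 0 * w 1 - v 1 * w 0))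
    + (u 0 * (v 3 * w 4 - v 4 * w 3) - u 3 * (v 0 * w 4 - v 4 * w 0) + u 4 * (v 0 * w 3 - v 3 * w 0))
    + (u 0 * (v 5 * w 6 - v 6 * w 5) - u 5 * (v 0 * w 6 - v 6 * w 0) + u 6 * (v 0 * w 5 - v 5 * w 0))
    + (u 1 * (v 3 * w 5 - v 5 * w 3) - u 3 * (v 1 * w 5 - v 5 * w 1) + u 5 * (v 1 * w 3 - v 3 * w 1))
    - (u 1 * (v 4 * w 6 - v 6 * w 4) - u 4 * (v 1 * w 6 - v 6 * w 1) + u 6 * (v 1 * w 4 - v 4 * w 1))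
    - (u 2 * (v 3 * w 6 - v 6 * w 3) - u 3 * (v 2 * w 6 - v 6 * w 2) + u 6 * (v 2 * w 3 - v 3 * w 2))
    - (u 2 * (v 4 * w 5 - v 5 * w 4) - u 4 * (v 2 * w 5 - v 5 * w 2) + u 5 * (v 2 * w 4 - v 4 * w 2)) := by
  have h : ∀ i j k, elem3 i j k ![u, v, w] = u i * (v j * w k - v k * w j)
      - u j * (v i * w k - v k * w i) + u k * (v i * w j - v j * w i) := by
    intro i j k
    change Matrix.det (Matrix.of fun r => coord3 i j k (![u, v, w] r)) = _
    rw [Matrix.det_fin_three]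
    simp [coord3]
    ring
  simp only [phi0, AlternatingMap.add_apply, AlternatingMap.sub_apply, h]

/-- The standard basis vectors of `ℝ⁷`. -/
def stdVec (i : Fin 7) : E7 := EuclideanSpace.single i 1

theorem stdVec_apply (i j : Fin 7) : stdVec i j = if j = i then 1 else 0 := by
  simp [stdVec]

/-- The cross product of `ℝ⁷`. -/
def cross0 (u w : E7) : E7 := ∑ k, phi0 ![u, w, stdVec k] • stdVec k

theorem cross0_coord (u w : E7) (k : Fin 7) : cross0 u w k = phi0 ![u, w, stdVec k] := by
  simp [cross0, stdVec_apply]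

theorem cross0_apply (u v : E7) : cross0 u v = !₂[
    (u 1 * v 2 - u 2 * v 1) + (u 3 * v 4 - u 4 * v 3) + (u 5 * v 6 - u 6 * v 5),
    -(u 0 * v 2 - u 2 * v 0) + (u 3 * v 5 - u 5 * v 3) - (u 4 * v 6 - u 6 * v 4),
    (u 0 * v 1 - u 1 * v 0) - (u 3 * v 6 - u 6 * v 3) - (u 4 * v 5 - u 5 * v 4),
    -(u 0 * v 4 - u 4 * v 0) - (u 1 * v 5 - u 5 * v 1) + (u 2 * v 6 - u 6 * v 2),
    (u 0 * v 3 - u 3 * v 0) + (u 1 * v 6 - u 6 * v 1) + (u 2 * v 5 - u 5 * v 2),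
    -(u 0 * v 6 - u 6 * v 0) + (u 1 * v 3 - u 3 * v 1) - (u 2 * v 4 - u 4 * v 2),
    (u 0 * v 5 - u 5 * v 0) - (u 1 * v 4 - u 4 * v 1) - (u 2 * v 3 - u 3 * v 2)] := by
  ext k
  rw [cross0_coord, phi0_apply]
  fin_cases k <;> simp [stdVec_apply] <;> ring

theorem inner_apply7 (u v : E7) : inner ℝ u v =
    u 0 * v 0 + u 1 * v 1 + u 2 * v 2 + u 3 * v 3 + u 4 * v 4 + u 5 * v 5 + u 6 * v 6 := by
  simp [PiLp.inner_apply, Fin.sum_univ_seven, mul_comm]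

theorem inner_cross0 (u v w : E7) : inner ℝ (cross0 u v) w = phi0 ![u, v, w] := by
  rw [inner_apply7, phi0_apply, cross0_apply]
  simp
  ring

/-- The octonion algebra and the study of `sigma` below rest on this identity and on the formula for
$\psi$ in `psi0_eq_cross0`, instead of on coordinates. -/
theorem cross0_cross0 (a b : E7) :
    cross0 a (cross0 a b) = (inner ℝ a b : ℝ) • a - (inner ℝ a a : ℝ) • b := by
  rw [inner_apply7, inner_apply7, cross0_apply, cross0_apply]
  ext k
  fin_cases k <;> simp <;> ring

end G2
end

/-! ### The Hodge dual of the model form. -/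

noncomputable section
namespace G2

/-- The determinant of the matrix with rows `eᵢ, eⱼ, eₖ, a, b, c, d`. -/
def volStd (a b c d : E7) (i j k : Fin 7) : ℝ :=
  Matrix.det (Matrix.of fun r s => (![stdVec i, stdVec j, stdVec k, a, b, c, d] r : E7) s)

theorem volStd_swap_left (a b c d : E7) (i j k : Fin 7) :
    volStd a b c d j i k = -volStd a b c d i j k := by
  have h := Matrix.det_permute (Equiv.swap (0 : Fin 7) 1)
    (Matrix.of fun r s => (![stdVec i, stdVec j, stdVec k, a, b, c, d] r : E7) s)
  rw [Equiv.Perm.sign_swap (by decide)] at h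
  unfold volStd
  simp only [Units.val_neg, Units.val_one, Int.cast_neg, Int.cast_one, neg_one_mul] at h
  rw [← h]
  congr 1
  ext r s
  fin_cases r <;> rfl

theorem volStd_swap_right (a b c d : E7) (i j k : Fin 7) :
    volStd a b c d i k j = -volStd a b c d i j k := by
  have h := Matrix.det_permute (Equiv.swap (1 : Fin 7) 2)
    (Matrix.of fun r s => (![stdVec i, stdVec j, stdVec k, a, b, c, d] r : E7) s)
  rw [Equiv.Perm.sign_swap (by decide)] at h
  unfold volStd
  simp only [Units.val_neg, Units.val_one, Int.cast_neg, Int.cast_one, neg_one_mul] at h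
  rw [← h]
  congr 1
  ext r s
  fin_cases r <;> rfl

/-- Three applications strip the unit rows off the $7\times7$ determinant `volStd` and leave a
$4\times4$ minor. -/
theorem det_row_single {n : ℕ} {A : Matrix (Fin (n + 1)) (Fin (n + 1)) ℝ} (p : Fin (n + 1))
    (h : ∀ j, A 0 j = if j = p then 1 else 0) :
    A.det = (-1) ^ (p : ℕ) * (A.submatrix Fin.succ p.succAbove).det := by
  rw [Matrix.det_succ_row_zero, Finset.sum_eq_single p]
  · simp [h]
  · intro j _ hj; simp [h, hj]
  · simp

/-- The minor of the `4 × 7` matrix with rows `a, b, c, d` in the columns `p, q, r, s`. -/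
def minor4 (a b c d : E7) (p q r s : Fin 7) : ℝ :=
  Matrix.det !![a p, a q, a r, a s; b p, b q, b r, b s; c p, c q, c r, c s; d p, d q, d r, d s]

theorem volStd_012 (a b c d : E7) :
    volStd a b c d 0 1 2 = minor4 a b c d 3 4 5 6 := by
  unfold volStd minor4
  rw [det_row_single 0 (by intro j; fin_cases j <;> simp [stdVec_apply]),
    det_row_single 0 (by intro j; fin_cases j <;> simp [stdVec_apply]),
    det_row_single 0 (by intro j; fin_cases j <;> simp [stdVec_apply])]
  simp [Matrix.det_succ_row_zero, Fin.sum_univ_succ, Fin.succAbove, pow_succ]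

theorem volStd_034 (a b c d : E7) :
    volStd a b c d 0 3 4 = minor4 a b c d 1 2 5 6 := by
  unfold volStd minor4
  rw [det_row_single 0 (by intro j; fin_cases j <;> simp [stdVec_apply]),
    det_row_single 2 (by intro j; fin_cases j <;> simp [stdVec_apply]),
    det_row_single 2 (by intro j; fin_cases j <;> simp [stdVec_apply, Fin.succAbove])]
  simp [Matrix.det_succ_row_zero, Fin.sum_univ_succ, Fin.succAbove, pow_succ]

theorem volStd_056 (a b c d : E7) :
    volStd a b c d 0 5 6 = minor4 a b c d 1 2 3 4 := by
  unfold volStd minor4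
  rw [det_row_single 0 (by intro j; fin_cases j <;> simp [stdVec_apply]),
    det_row_single 4 (by intro j; fin_cases j <;> simp [stdVec_apply]),
    det_row_single 4 (by intro j; fin_cases j <;> simp [stdVec_apply, Fin.succAbove])]
  simp [Matrix.det_succ_row_zero, Fin.sum_univ_succ, Fin.succAbove, pow_succ]

theorem volStd_135 (a b c d : E7) :
    volStd a b c d 1 3 5 = minor4 a b c d 0 2 4 6 := by
  unfold volStd minor4
  rw [det_row_single 1 (by intro j; fin_cases j <;> simp [stdVec_apply]),
    det_row_single 2 (by intro j; fin_cases j <;> simp [stdVec_apply, Fin.succAbove]),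
    det_row_single 3 (by intro j; fin_cases j <;> simp [stdVec_apply, Fin.succAbove])]
  simp [Matrix.det_succ_row_zero, Fin.sum_univ_succ, Fin.succAbove, pow_succ]

theorem volStd_146 (a b c d : E7) :
    volStd a b c d 1 4 6 = minor4 a b c d 0 2 3 5 := by
  unfold volStd minor4
  rw [det_row_single 1 (by intro j; fin_cases j <;> simp [stdVec_apply]),
    det_row_single 3 (by intro j; fin_cases j <;> simp [stdVec_apply, Fin.succAbove]),
    det_row_single 4 (by intro j; fin_cases j <;> simp [stdVec_apply, Fin.succAbove])]
  simp [Matrix.det_succ_row_zero, Fin.sum_univ_succ, Fin.succAbove, pow_succ]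

theorem volStd_236 (a b c d : E7) :
    volStd a b c d 2 3 6 = minor4 a b c d 0 1 4 5 := by
  unfold volStd minor4
  rw [det_row_single 2 (by intro j; fin_cases j <;> simp [stdVec_apply]),
    det_row_single 2 (by intro j; fin_cases j <;> simp [stdVec_apply, Fin.succAbove]),
    det_row_single 4 (by intro j; fin_cases j <;> simp [stdVec_apply, Fin.succAbove])]
  simp [Matrix.det_succ_row_zero, Fin.sum_univ_succ, Fin.succAbove, pow_succ]

theorem volStd_245 (a b c d : E7) :
    volStd a b c d 2 4 5 = minor4 a b c d 0 1 3 6 := by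
  unfold volStd minor4
  rw [det_row_single 2 (by intro j; fin_cases j <;> simp [stdVec_apply]),
    det_row_single 3 (by intro j; fin_cases j <;> simp [stdVec_apply, Fin.succAbove]),
    det_row_single 3 (by intro j; fin_cases j <;> simp [stdVec_apply, Fin.succAbove])]
  simp [Matrix.det_succ_row_zero, Fin.sum_univ_succ, Fin.succAbove, pow_succ]

/-- Each of the seven monomials of $\varphi_0$ is met in $3!$ orderings, which contribute equally
because `D` is antisymmetric. The factor 6 cancels the one in `psi0`, so only seven minors are ever
needed. -/
theorem sum_phi0_mul (D : Fin 7 → Fin 7 → Fin 7 → ℝ) (h1 : ∀ i j k, D j i k = -D i j k)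
    (h2 : ∀ i j k, D i k j = -D i j k) :
    ∑ i, ∑ j, ∑ k, phi0 ![stdVec i, stdVec j, stdVec k] * D i j k =
      6 * (D 0 1 2 + D 0 3 4 + D 0 5 6 + D 1 3 5 - D 1 4 6 - D 2 3 6 - D 2 4 5) := by
  have h : ∀ i j k, D i j k - D i k j - (D j i k - D j k i) + (D k i j - D k j i)
      = 6 * D i j k := by
    intro i j k
    linarith [h1 i j k, h2 i j k, h1 i k j, h2 j i k, h2 k i j, h1 j k i]
  simp only [phi0_apply, stdVec_apply, add_mul, sub_mul, mul_add, mul_sub, Finset.sum_add_distrib,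
    Finset.sum_sub_distrib, ite_mul, mul_ite, zero_mul, mul_zero, one_mul, mul_one,
    Finset.sum_ite_eq, Finset.mem_univ, if_true, h]

/-- The 4-form `⋆φ₀`. -/
def psi0 (a b c d : E7) : ℝ :=
  (1 / 6) * ∑ i, ∑ j, ∑ k, phi0 ![stdVec i, stdVec j, stdVec k] * volStd a b c d i j k

/-- Expresses $\psi$ through the inner product and the cross product, so that later computations
need neither the volume form nor the Hodge star. -/
theorem psi0_eq_cross0 (a b c d : E7) : psi0 a b c d =
    -inner ℝ (cross0 a (cross0 b c)) d - inner ℝ a b * inner ℝ c d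
      + inner ℝ a c * inner ℝ b d := by
  rw [psi0, sum_phi0_mul _ (volStd_swap_left a b c d) (volStd_swap_right a b c d), volStd_012,
    volStd_034, volStd_056, volStd_135, volStd_146, volStd_236, volStd_245]
  simp only [inner_apply7, cross0_apply]
  simp [minor4, Matrix.det_succ_row_zero, Fin.sum_univ_succ, Fin.succAbove]
  ring
end G2
end

/-! ### The determinant of $u\lrcorner\varphi_0$ bordered by a rank-one matrix. -/

noncomputable section
namespace G2

section rankTwoUpdate

open Matrix

/-- If `A` is skew with `A² = u uᵀ - |u|²`, then `A + l lᵀ` has determinant `± |u|⁴ (l ⬝ u)²`. -/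
theorem det_skew_add_vecMulVec_sq {A : Matrix (Fin 7) (Fin 7) ℝ} {u : Fin 7 → ℝ} (hu : u ≠ 0)
    (hA : Aᵀ = -A) (hAu : A *ᵥ u = 0)
    (hAA : A * A = vecMulVec u u - (u ⬝ᵥ u) • (1 : Matrix (Fin 7) (Fin 7) ℝ)) (l : Fin 7 → ℝ) :
    (A + vecMulVec l l).det ^ 2 = ((u ⬝ᵥ u) ^ 2 * (l ⬝ᵥ u) ^ 2) ^ 2 := by
  obtain ⟨n, hn⟩ : ∃ n : ℝ, n = u ⬝ᵥ u := ⟨_, rfl⟩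
  have hn0 : 0 < n := by
    rw [hn]
    exact lt_of_le_of_ne (by simpa using dotProduct_star_self_nonneg u)
      fun h => hu (dotProduct_self_eq_zero.1 h.symm)
  -- Here $s=1/|u|$. Adding $s\,uu^{\mathsf T}$ repairs the kernel direction of `A`: the matrix `N`
  -- is $|u|$ times an orthogonal matrix, so its inverse is explicit.
  obtain ⟨s, hs0, hs⟩ : ∃ s : ℝ, 0 < s ∧ s ^ 2 * n = 1 :=
    ⟨(Real.sqrt n)⁻¹, by positivity, by rw [inv_pow, Real.sq_sqrt hn0.le]; field_simp⟩
  have huA : u ᵥ* A = 0 := by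
    rw [← mulVec_transpose, hA, neg_mulVec, hAu, neg_zero]
  set N : Matrix (Fin 7) (Fin 7) ℝ := A + s • vecMulVec u u with hN
  have hNT : Nᵀ = -A + s • vecMulVec u u := by
    rw [hN, transpose_add, transpose_smul, transpose_vecMulVec, hA]
  have hNN : N * Nᵀ = n • 1 := by
    rw [hNT, hN, add_mul, mul_add, mul_add, mul_neg, hAA, Matrix.mul_smul, mul_vecMulVec, hAu,
      mul_neg, Matrix.smul_mul, vecMulVec_mul, huA, Matrix.smul_mul, Matrix.mul_smul,
      vecMulVec_mul_vecMulVec, ← hn, smul_smul, vecMulVec_smul, smul_smul]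
    simp only [zero_vecMulVec, vecMulVec_zero, smul_zero, neg_zero, add_zero, zero_add]
    rw [show s * s * n = 1 by linarith, one_smul]
    abel
  have hdet : N.det ^ 2 = n ^ 7 := by
    have h := congrArg det hNN
    rw [det_mul, det_transpose, det_smul, det_one] at h
    simp at h
    linarith
  have hunit : IsUnit N.det := by
    refine isUnit_iff_ne_zero.2 fun h => ?_
    rw [h] at hdet
    have := pow_pos hn0 7
    norm_num at hdet
    linarith
  have hinv : N⁻¹ = n⁻¹ • Nᵀ := by
    refine inv_eq_right_inv ?_
    rw [Matrix.mul_smul, hNN, smul_smul, inv_mul_cancel₀ hn0.ne', one_smul]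
  -- What remains is $ll^{\mathsf T}-s\,uu^{\mathsf T}$, of rank at most two. The matrix determinant
  -- lemma reduces the problem to a $2\times2$ determinant.
  let U : Matrix (Fin 7) (Fin 2) ℝ := of fun i k => ![u i, l i] k
  let W : Matrix (Fin 2) (Fin 7) ℝ := of fun k j => ![-s * u j, l j] k
  have hUW : A + vecMulVec l l = N + U * W := by
    ext i j
    simp [hN, U, W, Matrix.mul_apply, vecMulVec_apply]
    ring
  have hentry : ∀ (a b : Fin 7 → ℝ), a ⬝ᵥ (Nᵀ *ᵥ b) = s * (a ⬝ᵥ u) * (u ⬝ᵥ b) - a ⬝ᵥ (A *ᵥ b) := by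
    intro a b
    rw [hNT, add_mulVec, neg_mulVec, smul_mulVec, vecMulVec_mulVec, dotProduct_add,
      dotProduct_neg, dotProduct_smul]
    simp
    ring
  have hskew : ∀ a, a ⬝ᵥ (A *ᵥ a) = 0 := by
    intro a
    have h : a ⬝ᵥ (A *ᵥ a) = -(a ⬝ᵥ (A *ᵥ a)) := by
      conv_lhs => rw [dotProduct_mulVec, ← mulVec_transpose, hA, neg_mulVec, neg_dotProduct,
        dotProduct_comm]
    linarith
  have huAl : u ⬝ᵥ (A *ᵥ l) = 0 := by rw [dotProduct_mulVec, huA, zero_dotProduct]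
  have hW : W * N⁻¹ * U = of fun i j => n⁻¹ *
      (![-s • u, l] i ⬝ᵥ (Nᵀ *ᵥ (![u, l] j))) := by
    rw [hinv, Matrix.mul_smul, Matrix.smul_mul, Matrix.mul_assoc]
    ext i j
    simp only [Matrix.smul_apply, of_apply, smul_eq_mul]
    congr 1
    fin_cases i <;> fin_cases j <;> simp [Matrix.mul_apply, dotProduct, mulVec, U, W]
  rw [hUW, det_add_mul _ _ hunit, hW, det_fin_two, mul_pow, hdet]
  simp only [Matrix.add_apply, of_apply, hentry]
  simp [hskew, huAl, hAu, ← hn]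
  rw [dotProduct_comm u l]
  generalize l ⬝ᵥ u = p
  have h1 : n = (s ^ 2)⁻¹ := by field_simp; linarith
  rw [h1]
  field_simp
  ring

end rankTwoUpdate

theorem phi0_swap_right (u v w : E7) : phi0 ![u, w, v] = -phi0 ![u, v, w] := by
  rw [phi0_apply, phi0_apply]; ring

theorem inner_cross0_cross0 (u a b : E7) : inner ℝ (cross0 u a) (cross0 u b) =
    (inner ℝ u u * inner ℝ a b - inner ℝ u a * inner ℝ u b : ℝ) := by
  rw [inner_cross0, phi0_swap_right, ← inner_cross0, cross0_cross0, inner_sub_left,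
    real_inner_smul_left, real_inner_smul_left, real_inner_comm a b]
  ring

/-- The matrix of the 2-form `u ⌟ φ₀`. -/
def skew0 (u : E7) : Matrix (Fin 7) (Fin 7) ℝ :=
  Matrix.of fun i j => phi0 ![u, stdVec i, stdVec j]

theorem inner_stdVec (u : E7) (i : Fin 7) : inner ℝ u (stdVec i) = u i := by
  simp [PiLp.inner_apply, stdVec_apply]

open Matrix in
-- Up to sign, `skew0 u` is the matrix of $u\times\cdot$. The double cross product gives its square,
-- and $\varphi_0(u,\cdot,u)=0$ gives its kernel vector $u$.
theorem det_skew0_add_sq {u : E7} (hu : u ≠ 0) (l : Fin 7 → ℝ) :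
    (skew0 u + vecMulVec l l).det ^ 2 = (inner ℝ u u ^ 2 * (l ⬝ᵥ u.ofLp) ^ 2) ^ 2 := by
  have huu : (inner ℝ u u : ℝ) = u.ofLp ⬝ᵥ u.ofLp := by
    simp only [PiLp.inner_apply, dotProduct, RCLike.inner_apply, conj_trivial]
  rw [huu]
  refine det_skew_add_vecMulVec_sq (fun h => hu (by ext i; simp [h])) ?_ ?_ ?_ l
  · ext i j
    simp [skew0, phi0_swap_right u (stdVec i) (stdVec j)]
  · ext i
    have : ∀ j, skew0 u i j = cross0 u (stdVec i) j := fun j => by rw [cross0_coord]; rfl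
    simp only [mulVec, dotProduct, this, Pi.zero_apply]
    have h2 := inner_cross0 u (stdVec i) u
    rw [show phi0 ![u, stdVec i, u] = 0 by rw [phi0_apply]; ring] at h2
    rw [← h2]
    simp [PiLp.inner_apply, mul_comm]
  · ext i j
    have h1 : ∀ j, skew0 u i j = cross0 u (stdVec i) j := fun j => by rw [cross0_coord]; rfl
    have h2 : ∀ i, skew0 u i j = -cross0 u (stdVec j) i := fun i => by
      rw [cross0_coord, phi0_swap_right, neg_neg]; rfl
    have h3 := inner_cross0_cross0 u (stdVec i) (stdVec j)
    rw [inner_stdVec, inner_stdVec, inner_stdVec, stdVec_apply, huu] at h3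
    rw [Matrix.mul_apply]
    simp only [h1, h2]
    have h4 : ∑ k, cross0 u (stdVec i) k * -cross0 u (stdVec j) k
        = -inner ℝ (cross0 u (stdVec i)) (cross0 u (stdVec j)) := by
      simp [PiLp.inner_apply, mul_comm]
    rw [h4, h3]
    simp [vecMulVec_apply, Matrix.one_apply, eq_comm]

end G2
end

/-! ### Recovering the metric from the coefficients of a positive 3-form. -/

noncomputable section
namespace G2

/-- A 3-form as a trilinear map. -/
def tri {W : Type*} [AddCommGroup W] [Module ℝ W] (φ : W [⋀^Fin 3]→ₗ[ℝ] ℝ) :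
    W →ₗ[ℝ] W →ₗ[ℝ] W →ₗ[ℝ] ℝ where
  toFun a := LinearMap.mk₂ ℝ (fun b c => φ ![a, b, c])
    (fun b b' c => congrArg (fun η => η ![c]) ((φ.curryLeft a).curryLeft.map_add b b'))
    (fun r b c => congrArg (fun η => η ![c]) ((φ.curryLeft a).curryLeft.map_smul r b))
    (fun b c c' => congrArg (fun η => η ![])
      (((φ.curryLeft a).curryLeft b).curryLeft.map_add c c'))
    (fun r b c => congrArg (fun η => η ![])
      (((φ.curryLeft a).curryLeft b).curryLeft.map_smul r c))
  map_add' a a' := by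
    ext b c; exact congrArg (fun η => η ![b, c]) (φ.curryLeft.map_add a a')
  map_smul' r a := by
    ext b c; exact congrArg (fun η => η ![b, c]) (φ.curryLeft.map_smul r a)

@[simp]
theorem tri_apply {W : Type*} [AddCommGroup W] [Module ℝ W] (φ : W [⋀^Fin 3]→ₗ[ℝ] ℝ) (a b c : W) :
    tri φ a b c = φ ![a, b, c] := rfl

section metricFormula

open Matrix

theorem phi0_eq_skew0 (u v w : E7) : phi0 ![u, v, w] = ∑ j, (∑ i, v i * skew0 u i j) * w j := by
  have h : ∀ j, cross0 u v j = ∑ i, v i * skew0 u i j := by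
    intro j
    rw [cross0_coord, phi0_swap_right, ← inner_cross0, PiLp.inner_apply, ← Finset.sum_neg_distrib]
    refine Finset.sum_congr rfl fun i _ => ?_
    rw [cross0_coord, phi0_swap_right]
    simp [skew0]
  rw [← inner_cross0, PiLp.inner_apply]
  refine Finset.sum_congr rfl fun j _ => ?_
  rw [h]
  simp [mul_comm]

/-- For coefficients `Φ` of a 3-form: the determinant of `(∑ cₖ Φₖᵢⱼ + lᵢ lⱼ)ᵢⱼ`. -/
def bordered (Φ : Fin 7 → Fin 7 → Fin 7 → ℝ) (c l : Fin 7 → ℝ) : ℝ :=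
  (Matrix.of fun i j => ∑ k, c k * Φ k i j + l i * l j).det

/-- The quadratic form which is, up to a factor, the metric of the 3-form with coefficients `Φ`. -/
def quadCoeff (Φ : Fin 7 → Fin 7 → Fin 7 → ℝ) (c l : Fin 7 → ℝ) : ℝ :=
  Real.sqrt (Real.sqrt (bordered Φ c l ^ 2))

/-- The polarization of `quadCoeff`. -/
def polarCoeff (Φ : Fin 7 → Fin 7 → Fin 7 → ℝ) (i j : Fin 7) : ℝ :=
  if i = j then quadCoeff Φ (Pi.single i 1) (Pi.single i 1) else
    -- The covector only has to take the value 1 on the vector being squared; for $i\neq j$, $e_i$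
    -- does so on $e_i+e_j$ as well.
    (quadCoeff Φ (Pi.single i 1 + Pi.single j 1) (Pi.single i 1)
      - quadCoeff Φ (Pi.single i 1) (Pi.single i 1)
      - quadCoeff Φ (Pi.single j 1) (Pi.single j 1)) / 2

/-- The Gram matrix of the metric of a positive 3-form, in terms of the coefficients of the form. -/
def metricCoeff (Φ : Fin 7 → Fin 7 → Fin 7 → ℝ) (i j : Fin 7) : ℝ :=
  polarCoeff Φ i j / ((Matrix.of (polarCoeff Φ)).det) ^ ((9 : ℕ) : ℝ)⁻¹

variable {W : Type*} [AddCommGroup W] [Module ℝ W]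

/-- The matrix of the basis `e` in the frame `f`. -/
def frameMatrix (f : E7 ≃ₗ[ℝ] W) (e : Fin 7 → W) : Matrix (Fin 7) (Fin 7) ℝ :=
  Matrix.of fun a i => f.symm (e i) a

theorem frameMatrix_mulVec (f : E7 ≃ₗ[ℝ] W) (e : Fin 7 → W) (c : Fin 7 → ℝ) :
    frameMatrix f e *ᵥ c = (f.symm (∑ k, c k • e k)).ofLp := by
  ext a
  simp [frameMatrix, mulVec, dotProduct, mul_comm]

theorem isUnit_det_frameMatrix (f : E7 ≃ₗ[ℝ] W) {e : Fin 7 → W} (he : LinearIndependent ℝ e) :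
    IsUnit (frameMatrix f e).det := by
  rw [← Matrix.isUnit_iff_isUnit_det, ← Matrix.mulVec_injective_iff_isUnit]
  intro c d h
  rw [frameMatrix_mulVec, frameMatrix_mulVec] at h
  have h2 : ∑ k, c k • e k = ∑ k, d k • e k := f.symm.injective (by ext i; rw [h])
  have h3 : ∑ k, (c k - d k) • e k = 0 := by
    simp only [sub_smul, Finset.sum_sub_distrib, h2, sub_self]
  ext k
  exact sub_eq_zero.1 (Fintype.linearIndependent_iff.1 he _ h3 k)

theorem IsAdaptedFrame.apply {φ : W [⋀^Fin 3]→ₗ[ℝ] ℝ} {f : E7 ≃ₗ[ℝ] W} (hf : IsAdaptedFrame φ f)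
    (a b c : W) : φ ![a, b, c] = phi0 ![f.symm a, f.symm b, f.symm c] := by
  rw [← hf, AlternatingMap.compLinearMap_apply]
  congr 1
  ext i
  fin_cases i <;> simp

/-- With $P$ the frame matrix, the bordered matrix is $P^{\mathsf T}(u\lrcorner\varphi_0+mm^{\mathsf
T})P$, of determinant $\pm(\det P)^2|u|^4(l\cdot c)^2$. The border is indispensable: a skew matrix
of odd size is singular. Squaring disposes of the sign, and a fourth root then gives $|\det
P|\,|u|^2$ when $l\cdot c=1$. -/
theorem bordered_sq {φ : W [⋀^Fin 3]→ₗ[ℝ] ℝ} {f : E7 ≃ₗ[ℝ] W} (hf : IsAdaptedFrame φ f)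
    {e : Fin 7 → W} (he : LinearIndependent ℝ e) {c : Fin 7 → ℝ} (hc : c ≠ 0) (l : Fin 7 → ℝ) :
    bordered (fun i j k => φ ![e i, e j, e k]) c l ^ 2 =
      (|(frameMatrix f e).det| * inner ℝ (f.symm (∑ k, c k • e k)) (f.symm (∑ k, c k • e k))) ^ 4
        * (l ⬝ᵥ c) ^ 4 := by
  have hP := isUnit_det_frameMatrix f he
  set P := frameMatrix f e with hPdef
  set u : E7 := f.symm (∑ k, c k • e k) with hu
  have hPc : P *ᵥ c = u.ofLp := frameMatrix_mulVec f e c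
  have hu0 : u ≠ 0 := by
    intro h
    have h1 := (LinearEquiv.map_eq_zero_iff f.symm).1 h
    exact hc (funext fun k => Fintype.linearIndependent_iff.1 he c h1 k)
  let m : Fin 7 → ℝ := P⁻¹ᵀ *ᵥ l
  have hm : Pᵀ *ᵥ m = l := by
    rw [mulVec_mulVec, ← transpose_mul, nonsing_inv_mul _ hP, transpose_one, one_mulVec]
  have hmu : m ⬝ᵥ u.ofLp = l ⬝ᵥ c := by
    rw [← hPc, dotProduct_mulVec, ← mulVec_transpose, hm]
  have hmat : (Matrix.of fun i j => ∑ k, c k * φ ![e k, e i, e j] + l i * l j) =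
      Pᵀ * (skew0 u + vecMulVec m m) * P := by
    rw [mul_add, add_mul, mul_vecMulVec, vecMulVec_mul, hm, ← mulVec_transpose, hm]
    ext i j
    simp only [of_apply, Matrix.add_apply, vecMulVec_apply]
    congr 1
    have h1 : ∑ k, c k * φ ![e k, e i, e j] = φ ![∑ k, c k • e k, e i, e j] := by
      simp only [← tri_apply, map_sum, LinearMap.sum_apply, map_smul, LinearMap.smul_apply,
        smul_eq_mul]
    rw [h1, hf.apply, phi0_eq_skew0, Matrix.mul_apply]
    refine Finset.sum_congr rfl fun b _ => ?_
    rw [Matrix.mul_apply]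
    rfl
  rw [bordered, hmat, det_mul, det_mul, det_transpose, mul_pow, mul_pow, det_skew0_add_sq hu0, hmu,
    mul_pow, mul_pow |P.det|, show |P.det| ^ 4 = (|P.det| ^ 2) ^ 2 by ring, sq_abs]
  ring

theorem quadCoeff_eq {φ : W [⋀^Fin 3]→ₗ[ℝ] ℝ} {f : E7 ≃ₗ[ℝ] W} (hf : IsAdaptedFrame φ f)
    {e : Fin 7 → W} (he : LinearIndependent ℝ e) {c l : Fin 7 → ℝ} (hlc : l ⬝ᵥ c = 1) :
    quadCoeff (fun i j k => φ ![e i, e j, e k]) c l =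
      |(frameMatrix f e).det| * inner ℝ (f.symm (∑ k, c k • e k)) (f.symm (∑ k, c k • e k)) := by
  have hc : c ≠ 0 := by rintro rfl; simp at hlc
  have h0 : 0 ≤ |(frameMatrix f e).det| *
      inner ℝ (f.symm (∑ k, c k • e k)) (f.symm (∑ k, c k • e k)) :=
    mul_nonneg (abs_nonneg _) real_inner_self_nonneg
  rw [quadCoeff, bordered_sq hf he hc, hlc, one_pow, mul_one]
  generalize |(frameMatrix f e).det| *
      inner ℝ (f.symm (∑ k, c k • e k)) (f.symm (∑ k, c k • e k)) = t at h0
  rw [show t ^ 4 = (t ^ 2) ^ 2 by ring, Real.sqrt_sq (by positivity), Real.sqrt_sq h0]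

theorem polarCoeff_eq {φ : W [⋀^Fin 3]→ₗ[ℝ] ℝ} {f : E7 ≃ₗ[ℝ] W} (hf : IsAdaptedFrame φ f)
    {e : Fin 7 → W} (he : LinearIndependent ℝ e) (i j : Fin 7) :
    polarCoeff (fun i j k => φ ![e i, e j, e k]) i j =
      |(frameMatrix f e).det| * inner ℝ (f.symm (e i)) (f.symm (e j)) := by
  have h1 : ∀ i, ∑ k, (Pi.single i 1 : Fin 7 → ℝ) k • e k = e i := by
    intro i
    rw [Finset.sum_eq_single i] <;> simp +contextual
  unfold polarCoeff
  split_ifs with hij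
  · rw [quadCoeff_eq hf he (by simp), h1, hij]
  · rw [quadCoeff_eq hf he (by simp [hij]), quadCoeff_eq hf he (by simp),
      quadCoeff_eq hf he (by simp)]
    simp only [Pi.add_apply, add_smul, Finset.sum_add_distrib, h1, map_add, inner_add_left,
      inner_add_right]
    rw [real_inner_comm (f.symm (e i)) (f.symm (e j))]
    ring

/-- The polar matrix is $|\det P|\,P^{\mathsf T}P$, whose determinant has exponent $7+2$. This is
the origin of the ninth root in `metricCoeff`, which removes the unwanted factor $|\det P|$. -/
theorem det_polarCoeff {φ : W [⋀^Fin 3]→ₗ[ℝ] ℝ} {f : E7 ≃ₗ[ℝ] W} (hf : IsAdaptedFrame φ f)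
    {e : Fin 7 → W} (he : LinearIndependent ℝ e) :
    (Matrix.of (polarCoeff fun i j k => φ ![e i, e j, e k])).det = |(frameMatrix f e).det| ^ 9 := by
  have h : Matrix.of (polarCoeff fun i j k => φ ![e i, e j, e k]) =
      |(frameMatrix f e).det| • ((frameMatrix f e)ᵀ * frameMatrix f e) := by
    ext i j
    rw [of_apply, polarCoeff_eq hf he, Matrix.smul_apply, Matrix.mul_apply, PiLp.inner_apply]
    simp [frameMatrix, mul_comm]
  rw [h, det_smul, det_mul, det_transpose]
  simp only [Fintype.card_fin]
  rw [← abs_mul_abs_self]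
  ring

/-- The metric of a positive 3-form is determined by its coefficients in any basis. -/
theorem metricCoeff_eq {φ : W [⋀^Fin 3]→ₗ[ℝ] ℝ} {f : E7 ≃ₗ[ℝ] W} (hf : IsAdaptedFrame φ f)
    {e : Fin 7 → W} (he : LinearIndependent ℝ e) (i j : Fin 7) :
    metricCoeff (fun i j k => φ ![e i, e j, e k]) i j = inner ℝ (f.symm (e i)) (f.symm (e j)) := by
  have h0 : |(frameMatrix f e).det| ≠ 0 := abs_ne_zero.2 (isUnit_det_frameMatrix f he).ne_zero
  rw [metricCoeff, polarCoeff_eq hf he, det_polarCoeff hf he,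
    Real.pow_rpow_inv_natCast (abs_nonneg _) (by norm_num)]
  field_simp

theorem contDiffAt_det {X : Type*} [NormedAddCommGroup X] [NormedSpace ℝ X] {n : WithTop ℕ∞}
    {A : X → Matrix (Fin 7) (Fin 7) ℝ} {x : X} (h : ∀ i j, ContDiffAt ℝ n (fun y => A y i j) x) :
    ContDiffAt ℝ n (fun y => (A y).det) x := by
  simp only [det_apply]
  exact ContDiffAt.sum fun σ _ => (contDiffAt_prod fun i _ => h _ _).const_smul _

/-- At a positive form all roots are taken at positive arguments and the denominator is nonzero.
Smoothness of the metric can come only from such a formula, since `frame` is chosen with no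
continuity in the base point. -/
theorem contDiffAt_metricCoeff {φ : W [⋀^Fin 3]→ₗ[ℝ] ℝ} {f : E7 ≃ₗ[ℝ] W}
    (hf : IsAdaptedFrame φ f) {e : Fin 7 → W} (he : LinearIndependent ℝ e) (i j : Fin 7) :
    ContDiffAt ℝ ∞ (fun Φ => metricCoeff Φ i j) (fun i j k => φ ![e i, e j, e k]) := by
  have h0 : 0 < |(frameMatrix f e).det| := abs_pos.2 (isUnit_det_frameMatrix f he).ne_zero
  have hq : ∀ c l : Fin 7 → ℝ, l ⬝ᵥ c = 1 →
      ContDiffAt ℝ ∞ (fun Φ => quadCoeff Φ c l) (fun i j k => φ ![e i, e j, e k]) := by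
    intro c l hlc
    have hc : c ≠ 0 := by rintro rfl; simp at hlc
    have hb : 0 < bordered (fun i j k => φ ![e i, e j, e k]) c l ^ 2 := by
      rw [bordered_sq hf he hc, hlc, one_pow, mul_one]
      refine pow_pos (mul_pos h0 (lt_of_le_of_ne real_inner_self_nonneg fun h => hc ?_)) 4
      have h1 := (LinearEquiv.map_eq_zero_iff f.symm).1 (inner_self_eq_zero.1 h.symm)
      exact funext fun k => Fintype.linearIndependent_iff.1 he c h1 k
    have hs : ContDiffAt ℝ ∞ (fun Φ => bordered Φ c l ^ 2) (fun i j k => φ ![e i, e j, e k]) := by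
      refine (contDiffAt_det fun i j => ?_).pow 2
      simp only [of_apply]
      refine (ContDiffAt.sum fun k _ => contDiffAt_const.mul ?_).add contDiffAt_const
      fun_prop
    exact (hs.sqrt hb.ne').sqrt (Real.sqrt_pos.2 hb).ne'
  have hp : ∀ i j, ContDiffAt ℝ ∞ (fun Φ => polarCoeff Φ i j)
      (fun i j k => φ ![e i, e j, e k]) := by
    intro i j
    unfold polarCoeff
    split_ifs with hij
    · exact hq _ _ (by simp)
    · exact (((hq _ _ (by simp [hij])).sub (hq _ _ (by simp))).sub (hq _ _ (by simp))).div_const 2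
  have hd : 0 < (Matrix.of (polarCoeff fun i j k => φ ![e i, e j, e k])).det := by
    rw [det_polarCoeff hf he]
    positivity
  refine (hp i j).div ((contDiffAt_det fun i j => hp i j).rpow_const_of_ne hd.ne') ?_
  exact (Real.rpow_pos_of_pos hd _).ne'

end metricFormula

end G2
end

/-! ### Metric, cross product and $\psi$ of a positive 3-form on one vector space. -/

noncomputable section
namespace G2

section alternating

variable {W : Type*} [AddCommGroup W] [Module ℝ W]

theorem form3_swap_left (φ : W [⋀^Fin 3]→ₗ[ℝ] ℝ) (a b c : W) :
    φ ![b, a, c] = -φ ![a, b, c] := by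
  rw [← φ.map_swap ![a, b, c] (by decide : (0 : Fin 3) ≠ 1)]
  congr 1
  ext i
  fin_cases i <;> rfl

theorem form3_swap_right (φ : W [⋀^Fin 3]→ₗ[ℝ] ℝ) (a b c : W) :
    φ ![a, c, b] = -φ ![a, b, c] := by
  rw [← φ.map_swap ![a, b, c] (by decide : (1 : Fin 3) ≠ 2)]
  congr 1
  ext i
  fin_cases i <;> rfl

theorem form3_rotate (φ : W [⋀^Fin 3]→ₗ[ℝ] ℝ) (a b c : W) :
    φ ![b, c, a] = φ ![a, b, c] := by
  rw [form3_swap_right, form3_swap_left, neg_neg]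

theorem form3_self_left (φ : W [⋀^Fin 3]→ₗ[ℝ] ℝ) (a b : W) : φ ![a, a, b] = 0 := by
  linarith [form3_swap_left φ a a b]

theorem form3_self_right (φ : W [⋀^Fin 3]→ₗ[ℝ] ℝ) (a b : W) : φ ![a, b, b] = 0 := by
  linarith [form3_swap_right φ a b b]

theorem form3_self_outer (φ : W [⋀^Fin 3]→ₗ[ℝ] ℝ) (a b : W) : φ ![a, b, a] = 0 := by
  linarith [form3_swap_right φ a b a, form3_self_left φ a b]

theorem form4_swap_left (η : W [⋀^Fin 4]→ₗ[ℝ] ℝ) (a b c d : W) :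
    η ![b, a, c, d] = -η ![a, b, c, d] := by
  rw [← η.map_swap ![a, b, c, d] (by decide : (0 : Fin 4) ≠ 1)]
  congr 1
  ext i
  fin_cases i <;> rfl

theorem form4_swap_mid (η : W [⋀^Fin 4]→ₗ[ℝ] ℝ) (a b c d : W) :
    η ![a, c, b, d] = -η ![a, b, c, d] := by
  rw [← η.map_swap ![a, b, c, d] (by decide : (1 : Fin 4) ≠ 2)]
  congr 1
  ext i
  fin_cases i <;> rfl

theorem form4_swap_last (η : W [⋀^Fin 4]→ₗ[ℝ] ℝ) (a b c d : W) :
    η ![a, b, d, c] = -η ![a, b, c, d] := by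
  rw [← η.map_swap ![a, b, c, d] (by decide : (2 : Fin 4) ≠ 3)]
  congr 1
  ext i
  fin_cases i <;> rfl

theorem form4_self_left (η : W [⋀^Fin 4]→ₗ[ℝ] ℝ) (a b c : W) : η ![a, a, b, c] = 0 := by
  linarith [form4_swap_left η a a b c]

theorem form4_rotate (η : W [⋀^Fin 4]→ₗ[ℝ] ℝ) (a b c d : W) :
    η ![b, c, a, d] = η ![a, b, c, d] := by
  rw [form4_swap_mid, form4_swap_left, neg_neg]

/-- Evaluation of 4-forms, as a linear map. -/
def evalForm4 (v : Fin 4 → W) : (W [⋀^Fin 4]→ₗ[ℝ] ℝ) →ₗ[ℝ] ℝ where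
  toFun η := η v
  map_add' _ _ := rfl
  map_smul' _ _ := rfl

theorem curryLeft_curryLeft_curryLeft_apply (η : W [⋀^Fin 7]→ₗ[ℝ] ℝ) (x y z : W)
    (v : Fin 4 → W) : ((η.curryLeft x).curryLeft y).curryLeft z v =
      η (Matrix.vecCons x (Matrix.vecCons y (Matrix.vecCons z v))) := rfl

end alternating

section pointwise

variable {W : Type*} [AddCommGroup W] [Module ℝ W] [Nonempty (E7 ≃ₗ[ℝ] W)]
  {φ : W [⋀^Fin 3]→ₗ[ℝ] ℝ}

theorem IsPositive.isAdaptedFrame (h : IsPositive φ) : IsAdaptedFrame φ (frame φ) :=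
  Classical.epsilon_spec h

theorem metric_apply (φ : W [⋀^Fin 3]→ₗ[ℝ] ℝ) (a b : W) :
    metric φ a b = inner ℝ ((frame φ).symm a) ((frame φ).symm b) := rfl

theorem frameBasis_apply (φ : W [⋀^Fin 3]→ₗ[ℝ] ℝ) (i : Fin 7) :
    frameBasis φ i = frame φ (stdVec i) := by
  simp [frameBasis, stdVec]

/-- The metric of `φ` can be computed in any adapted frame. -/
theorem IsAdaptedFrame.metric_eq {f : E7 ≃ₗ[ℝ] W} (hf : IsAdaptedFrame φ f) (a b : W) :
    metric φ a b = inner ℝ (f.symm a) (f.symm b) := by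
  have h : metric φ = (innerₗ E7).compl₁₂ f.symm.toLinearMap f.symm.toLinearMap := by
    refine LinearMap.ext_basis (frameBasis φ) (frameBasis φ) fun i j => ?_
    -- `metricCoeff` sees only the values of $\varphi$ on a basis, so evaluating it with either
    -- adapted frame gives the same number. No knowledge of the stabilizer of $\varphi_0$ is
    -- required.
    have h1 := metricCoeff_eq (IsPositive.isAdaptedFrame ⟨f, hf⟩)
      (frameBasis φ).linearIndependent i j
    rw [metricCoeff_eq hf (frameBasis φ).linearIndependent] at h1
    exact h1.symm
  rw [h]
  rfl

theorem metric_symm (φ : W [⋀^Fin 3]→ₗ[ℝ] ℝ) (a b : W) : metric φ a b = metric φ b a := by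
  rw [metric_apply, metric_apply, real_inner_comm]

theorem metric_self_nonneg (φ : W [⋀^Fin 3]→ₗ[ℝ] ℝ) (a : W) : 0 ≤ metric φ a a := by
  rw [metric_apply]
  exact real_inner_self_nonneg

theorem metric_self_eq_zero {a : W} : metric φ a a = 0 ↔ a = 0 := by
  rw [metric_apply, inner_self_eq_zero, LinearEquiv.map_eq_zero_iff]

theorem metric_ext {a b : W} (h : ∀ c, metric φ a c = metric φ b c) : a = b := by
  rw [← sub_eq_zero, ← metric_self_eq_zero (φ := φ)]
  have h1 : metric φ (a - b) (a - b) = metric φ a (a - b) - metric φ b (a - b) := by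
    rw [map_sub (metric φ) a b, LinearMap.sub_apply]
  rw [h1, h, sub_self]

theorem metric_sharp (φ : W [⋀^Fin 3]→ₗ[ℝ] ℝ) {α : W → ℝ} (hα : IsLinearMap ℝ α) (w : W) :
    metric φ (sharp φ α) w = α w := by
  have hw : w = ∑ i, (frame φ).symm w i • frameBasis φ i := by
    apply (frame φ).symm.injective
    rw [map_sum]
    ext k
    simp [frameBasis_apply, stdVec_apply]
  have h1 : α w = ∑ i, (frame φ).symm w i * α (frameBasis φ i) := by
    conv_lhs => rw [hw]
    exact (map_sum (hα.mk' α) _ _).trans (Finset.sum_congr rfl fun i _ => hα.map_smul _ _)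
  rw [h1, sharp, map_sum, LinearMap.sum_apply]
  refine Finset.sum_congr rfl fun i _ => ?_
  rw [map_smul, LinearMap.smul_apply, metric_apply, frameBasis_apply, LinearEquiv.symm_apply_apply,
    real_inner_comm, inner_stdVec, smul_eq_mul, mul_comm]

theorem metric_cross (φ : W [⋀^Fin 3]→ₗ[ℝ] ℝ) (a b c : W) :
    metric φ (cross φ a b) c = φ ![a, b, c] :=
  metric_sharp φ (tri φ a b).isLinear c

theorem cross_add_left (φ : W [⋀^Fin 3]→ₗ[ℝ] ℝ) (a a' b : W) :
    cross φ (a + a') b = cross φ a b + cross φ a' b := by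
  refine metric_ext (φ := φ) fun c => ?_
  simp only [map_add, LinearMap.add_apply, metric_cross, ← tri_apply]

theorem cross_add_right (φ : W [⋀^Fin 3]→ₗ[ℝ] ℝ) (a b b' : W) :
    cross φ a (b + b') = cross φ a b + cross φ a b' := by
  refine metric_ext (φ := φ) fun c => ?_
  simp only [map_add, LinearMap.add_apply, metric_cross, ← tri_apply]

theorem cross_smul_left (φ : W [⋀^Fin 3]→ₗ[ℝ] ℝ) (r : ℝ) (a b : W) :
    cross φ (r • a) b = r • cross φ a b := by
  refine metric_ext (φ := φ) fun c => ?_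
  simp only [map_smul, LinearMap.smul_apply, metric_cross, ← tri_apply]

theorem cross_smul_right (φ : W [⋀^Fin 3]→ₗ[ℝ] ℝ) (r : ℝ) (a b : W) :
    cross φ a (r • b) = r • cross φ a b := by
  refine metric_ext (φ := φ) fun c => ?_
  simp only [map_smul, LinearMap.smul_apply, metric_cross, ← tri_apply]

theorem cross_neg_right (φ : W [⋀^Fin 3]→ₗ[ℝ] ℝ) (a b : W) :
    cross φ a (-b) = -cross φ a b := by
  simpa using cross_smul_right φ (-1) a b

theorem cross_zero_left (φ : W [⋀^Fin 3]→ₗ[ℝ] ℝ) (b : W) : cross φ 0 b = 0 := by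
  simpa using cross_smul_left φ 0 0 b

theorem cross_zero_right (φ : W [⋀^Fin 3]→ₗ[ℝ] ℝ) (a : W) : cross φ a 0 = 0 := by
  simpa using cross_smul_right φ 0 a 0

theorem cross_anticomm (φ : W [⋀^Fin 3]→ₗ[ℝ] ℝ) (a b : W) : cross φ b a = -cross φ a b := by
  refine metric_ext (φ := φ) fun c => ?_
  simp only [map_neg, LinearMap.neg_apply, metric_cross, form3_swap_left φ a b]

theorem cross_self (φ : W [⋀^Fin 3]→ₗ[ℝ] ℝ) (a : W) : cross φ a a = 0 := by
  refine metric_ext (φ := φ) fun c => ?_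
  simp only [map_zero, LinearMap.zero_apply, metric_cross, form3_self_left]

theorem IsPositive.frame_symm_cross (h : IsPositive φ) (a b : W) :
    (frame φ).symm (cross φ a b) = cross0 ((frame φ).symm a) ((frame φ).symm b) := by
  refine ext_inner_right ℝ fun z => ?_
  have h1 := metric_cross φ a b (frame φ z)
  rwa [metric_apply, LinearEquiv.symm_apply_apply, h.isAdaptedFrame.apply,
    LinearEquiv.symm_apply_apply, ← inner_cross0] at h1

theorem IsPositive.cross_cross (h : IsPositive φ) (a b : W) :
    cross φ a (cross φ a b) = metric φ a b • a - metric φ a a • b := by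
  apply (frame φ).symm.injective
  rw [h.frame_symm_cross, h.frame_symm_cross, cross0_cross0]
  simp [metric_apply]

theorem IsPositive.cross_cross_polar (h : IsPositive φ) (a c b : W) :
    cross φ a (cross φ c b) = -cross φ c (cross φ a b) + metric φ a b • c + metric φ c b • a
      - (2 * metric φ a c) • b := by
  have h1 := h.cross_cross (a + c) b
  simp only [cross_add_left, cross_add_right, map_add, LinearMap.add_apply, h.cross_cross,
    add_smul, smul_add, metric_symm φ c a] at h1
  rw [← sub_eq_zero] at h1 ⊢
  rw [← h1]
  module

theorem vol_apply (φ : W [⋀^Fin 3]→ₗ[ℝ] ℝ) (v : Fin 7 → W) :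
    vol φ v = Matrix.det (Matrix.of fun r s => (frame φ).symm (v r) s) := by
  rw [vol, Module.Basis.det_apply, ← Matrix.det_transpose]
  congr 1

theorem IsPositive.psi_apply (h : IsPositive φ) (a b c d : W) :
    psi φ ![a, b, c, d] = psi0 ((frame φ).symm a) ((frame φ).symm b) ((frame φ).symm c)
      ((frame φ).symm d) := by
  change evalForm4 ![a, b, c, d] (psi φ) = _
  simp only [psi, hodgeStar, psi0, map_smul, map_sum, smul_eq_mul]
  congr 1
  refine Finset.sum_congr rfl fun i _ => Finset.sum_congr rfl fun j _ =>
    Finset.sum_congr rfl fun k _ => ?_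
  rw [h.isAdaptedFrame.apply]
  simp only [frameBasis_apply, LinearEquiv.symm_apply_apply]
  congr 1
  rw [evalForm4, LinearMap.coe_mk, AddHom.coe_mk, curryLeft_curryLeft_curryLeft_apply, vol_apply,
    volStd]
  congr 1
  ext r s
  fin_cases r <;> simp

theorem IsPositive.psi_eq (h : IsPositive φ) (a b c d : W) :
    psi φ ![a, b, c, d] = -metric φ (cross φ a (cross φ b c)) d - metric φ a b * metric φ c d
      + metric φ a c * metric φ b d := by
  rw [h.psi_apply, psi0_eq_cross0, metric_apply, h.frame_symm_cross, h.frame_symm_cross]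
  rfl

end pointwise

end G2
end

/-! ### Octonion identities and the wedge product in `sigma`. -/

noncomputable section
namespace G2

section octonions

variable {W : Type*} [AddCommGroup W] [Module ℝ W] [Nonempty (E7 ≃ₗ[ℝ] W)]
  {φ : W [⋀^Fin 3]→ₗ[ℝ] ℝ}

theorem octMul_add_left (φ : W [⋀^Fin 3]→ₗ[ℝ] ℝ) (A A' B : Oct W) :
    octMul φ (A + A') B = octMul φ A B + octMul φ A' B := by
  ext
  · simp [octMul]; ring
  · simp [octMul, cross_add_left]; module

theorem octMul_add_right (φ : W [⋀^Fin 3]→ₗ[ℝ] ℝ) (A B B' : Oct W) :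
    octMul φ A (B + B') = octMul φ A B + octMul φ A B' := by
  ext
  · simp [octMul]; ring
  · simp [octMul, cross_add_right]; module

theorem octMul_smul_left (φ : W [⋀^Fin 3]→ₗ[ℝ] ℝ) (r : ℝ) (A B : Oct W) :
    octMul φ (r • A) B = r • octMul φ A B := by
  ext
  · simp [octMul]; ring
  · simp [octMul, cross_smul_left]; module

theorem octMul_smul_right (φ : W [⋀^Fin 3]→ₗ[ℝ] ℝ) (r : ℝ) (A B : Oct W) :
    octMul φ A (r • B) = r • octMul φ A B := by
  ext
  · simp [octMul]; ring
  · simp [octMul, cross_smul_right]; module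

theorem octMul_neg_left (φ : W [⋀^Fin 3]→ₗ[ℝ] ℝ) (A B : Oct W) :
    octMul φ (-A) B = -octMul φ A B := by
  simpa using octMul_smul_left φ (-1) A B

theorem octMul_neg_right (φ : W [⋀^Fin 3]→ₗ[ℝ] ℝ) (A B : Oct W) :
    octMul φ A (-B) = -octMul φ A B := by
  simpa using octMul_smul_right φ (-1) A B

theorem octMul_sub_left (φ : W [⋀^Fin 3]→ₗ[ℝ] ℝ) (A A' B : Oct W) :
    octMul φ (A - A') B = octMul φ A B - octMul φ A' B := by
  rw [sub_eq_add_neg, octMul_add_left, octMul_neg_left, sub_eq_add_neg]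

theorem octMul_sub_right (φ : W [⋀^Fin 3]→ₗ[ℝ] ℝ) (A B B' : Oct W) :
    octMul φ A (B - B') = octMul φ A B - octMul φ A B' := by
  rw [sub_eq_add_neg, octMul_add_right, octMul_neg_right, sub_eq_add_neg]

theorem octMul_real_left (φ : W [⋀^Fin 3]→ₗ[ℝ] ℝ) (r : ℝ) (B : Oct W) :
    octMul φ (r, 0) B = r • B := by
  ext <;> simp [octMul, cross_zero_left]

theorem octMul_real_right (φ : W [⋀^Fin 3]→ₗ[ℝ] ℝ) (r : ℝ) (A : Oct W) :
    octMul φ A (r, 0) = r • A := by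
  ext <;> simp [octMul, cross_zero_right, mul_comm]

theorem octNormSq_pos (φ : W [⋀^Fin 3]→ₗ[ℝ] ℝ) {A : Oct W} (hA : A ≠ 0) : 0 < octNormSq φ A := by
  have h1 := metric_self_nonneg φ A.2
  refine lt_of_le_of_ne (by unfold octNormSq; positivity) fun h => hA ?_
  have h2 : A.1 ^ 2 + metric φ A.2 A.2 = 0 := h.symm
  have h3 : A.1 = 0 := by nlinarith [sq_nonneg A.1]
  have h4 : A.2 = 0 := metric_self_eq_zero.1 (by nlinarith [sq_nonneg A.1])
  ext <;> simp [h3, h4]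

/-- A consequence of the double cross product identity. It is what permits division by $V$ on the
right although the product is not associative. -/
theorem IsPositive.octMul_octMul_conj (h : IsPositive φ) (A B : Oct W) :
    octMul φ (octMul φ A B) (B.1, -B.2) = octNormSq φ B • A := by
  have h1 : cross φ (cross φ A.2 B.2) B.2 =
      metric φ A.2 B.2 • B.2 - metric φ B.2 B.2 • A.2 := by
    rw [cross_anticomm, cross_anticomm φ B.2 A.2, cross_neg_right, neg_neg, h.cross_cross,
      metric_symm]
  ext
  · simp only [octMul, octNormSq, map_neg, map_add, map_smul, LinearMap.add_apply,
      LinearMap.smul_apply, metric_cross, form3_self_right, smul_eq_mul, Prod.smul_fst]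
    ring
  · simp only [octMul, octNormSq, cross_add_left, cross_smul_left, cross_neg_right, h1, cross_self,
      Prod.smul_snd]
    module

theorem octInv_eq (φ : W [⋀^Fin 3]→ₗ[ℝ] ℝ) (A : Oct W) :
    octInv φ A = (octNormSq φ A)⁻¹ • (A.1, -A.2) := rfl

theorem IsPositive.octMul_octMul_octInv (h : IsPositive φ) (A : Oct W) {B : Oct W} (hB : B ≠ 0) :
    octMul φ (octMul φ A B) (octInv φ B) = A := by
  rw [octInv_eq, octMul_smul_right, h.octMul_octMul_conj, smul_smul,
    inv_mul_cancel₀ (octNormSq_pos φ hB).ne', one_smul]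

theorem IsPositive.octMul_octInv_self (h : IsPositive φ) {B : Oct W} (hB : B ≠ 0) :
    octMul φ B (octInv φ B) = (1, 0) := by
  have h1 := h.octMul_octMul_octInv (1, 0) hB
  rwa [octMul_real_left, one_smul] at h1

theorem IsPositive.octMul_octInv_octMul (h : IsPositive φ) (A : Oct W) {B : Oct W} (hB : B ≠ 0) :
    octMul φ (octMul φ A (octInv φ B)) B = A := by
  have h1 := h.octMul_octMul_conj A ((B.1, -B.2) : Oct W)
  have h2 : octNormSq φ ((B.1, -B.2) : Oct W) = octNormSq φ B := by simp [octNormSq]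
  simp only [neg_neg, h2] at h1
  rw [octInv_eq, octMul_smul_right, octMul_smul_left, h1, smul_smul,
    inv_mul_cancel₀ (octNormSq_pos φ hB).ne', one_smul]

/-- The associator of three octonions. -/
def octAssoc (φ : W [⋀^Fin 3]→ₗ[ℝ] ℝ) (A B C : Oct W) : Oct W :=
  octMul φ (octMul φ A B) C - octMul φ A (octMul φ B C)

theorem octAssoc_fst (φ : W [⋀^Fin 3]→ₗ[ℝ] ℝ) (A B C : Oct W) : (octAssoc φ A B C).1 = 0 := by
  simp only [octAssoc, octMul, Prod.fst_sub, map_add, map_smul, LinearMap.add_apply,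
    LinearMap.smul_apply, metric_cross, smul_eq_mul, metric_symm φ A.2 (cross φ B.2 C.2),
    form3_rotate φ A.2 B.2 C.2]
  ring

/-- The link between torsion and algebra: with $T(X)$ in the first slot, the right-hand side is
$\nabla_X\varphi$. -/
theorem IsPositive.metric_octAssoc_snd (h : IsPositive φ) (A B C : Oct W) (d : W) :
    metric φ (octAssoc φ A B C).2 d = 2 * psi φ ![A.2, B.2, C.2, d] := by
  have h1 : cross φ (cross φ A.2 B.2) C.2 = -cross φ A.2 (cross φ B.2 C.2)
      - metric φ A.2 B.2 • C.2 - metric φ B.2 C.2 • A.2 + (2 * metric φ A.2 C.2) • B.2 := by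
    rw [cross_anticomm φ C.2, h.cross_cross_polar, cross_anticomm φ B.2 C.2, cross_neg_right,
      metric_symm φ C.2 B.2, metric_symm φ C.2 A.2]
    module
  have h2 : (octAssoc φ A B C).2 = -(2 : ℝ) • cross φ A.2 (cross φ B.2 C.2)
      - (2 * metric φ A.2 B.2) • C.2 + (2 * metric φ A.2 C.2) • B.2 := by
    simp only [octAssoc, octMul, Prod.snd_sub, cross_add_left, cross_add_right, cross_smul_left,
      cross_smul_right, h1]
    module
  rw [h2, h.psi_eq]
  simp only [map_add, map_sub, map_smul, LinearMap.add_apply, LinearMap.sub_apply,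
    LinearMap.smul_apply, smul_eq_mul]
  ring

theorem IsPositive.octAssoc_rotate (h : IsPositive φ) (A B C : Oct W) :
    octAssoc φ A B C = octAssoc φ B C A := by
  ext
  · rw [octAssoc_fst, octAssoc_fst]
  · refine metric_ext (φ := φ) fun d => ?_
    rw [h.metric_octAssoc_snd, h.metric_octAssoc_snd, form4_rotate _ A.2 B.2 C.2]

theorem IsPositive.octAssoc_octInv (h : IsPositive φ) (A B : Oct W) :
    octAssoc φ A B (octInv φ B) = 0 := by
  ext
  · rw [octAssoc_fst]; rfl
  · refine metric_ext (φ := φ) fun d => ?_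
    have h1 : (octInv φ B).2 = (-(octNormSq φ B)⁻¹) • B.2 := by simp [octInv_eq]
    rw [h.metric_octAssoc_snd, h1, h.psi_eq, cross_smul_right, cross_self, smul_zero,
      cross_zero_right]
    simp
    ring

end octonions

section sigmaForm

variable {W : Type*} [AddCommGroup W] [Module ℝ W]

/-- The six permutations agree in pairs by antisymmetry of `β`, which absorbs the factor $1/2$. -/
theorem wedge12_apply (α : W →ₗ[ℝ] ℝ) (β : W [⋀^Fin 2]→ₗ[ℝ] ℝ) (x y z : W) :
    wedge12 α β ![x, y, z] = α x * β ![y, z] + α y * β ![z, x] + α z * β ![x, y] := by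
  have hs : ∀ a b, β ![b, a] = -β ![a, b] := by
    intro a b
    rw [← β.map_swap ![a, b] (by decide : (0 : Fin 2) ≠ 1)]
    congr 1
    ext i
    fin_cases i <;> rfl
  have hu : (Finset.univ : Finset (Equiv.Perm (Fin 3))) =
      {1, Equiv.swap 0 1, Equiv.swap 0 2, Equiv.swap 1 2, Equiv.swap 0 1 * Equiv.swap 1 2,
        Equiv.swap 1 2 * Equiv.swap 0 1} := by decide
  have h : ∀ (σ : Equiv.Perm (Fin 3)) (i j k : Fin 3), σ 0 = i → σ 1 = j → σ 2 = k →
      (LinearMap.uncurryLeft (M := fun _ : Fin 3 => W) (α.smulRight β.toMultilinearMap)).domDomCongr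
        σ ![x, y, z] = α (![x, y, z] i) * β ![![x, y, z] j, ![x, y, z] k] := by
    rintro σ i j k rfl rfl rfl
    simp only [MultilinearMap.domDomCongr_apply, LinearMap.uncurryLeft_apply,
      LinearMap.smulRight_apply, smul_apply, smul_eq_mul]
    refine congrArg₂ (· * ·) rfl (congrArg β (funext fun i => ?_))
    fin_cases i <;> rfl
  rw [wedge12, AlternatingMap.smul_apply, MultilinearMap.alternatization_apply, hu]
  rw [Finset.sum_insert (by decide), Finset.sum_insert (by decide), Finset.sum_insert (by decide),
    Finset.sum_insert (by decide), Finset.sum_insert (by decide), Finset.sum_singleton]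
  rw [h 1 0 1 2 rfl rfl rfl, h (Equiv.swap 0 1) 1 0 2 (by decide) (by decide) (by decide),
    h (Equiv.swap 0 2) 2 1 0 (by decide) (by decide) (by decide),
    h (Equiv.swap 1 2) 0 2 1 (by decide) (by decide) (by decide),
    h (Equiv.swap 0 1 * Equiv.swap 1 2) 1 2 0 (by decide) (by decide) (by decide),
    h (Equiv.swap 1 2 * Equiv.swap 0 1) 2 0 1 (by decide) (by decide) (by decide)]
  simp [Equiv.Perm.sign_mul, hs x y, hs x z, hs y z]
  ring

end sigmaForm
end G2
end

/-! ### The deformed form on one vector space: positivity, metric and octonion product. -/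

noncomputable section
namespace G2

section sigmaPointwise

variable {W : Type*} [AddCommGroup W] [Module ℝ W] [Nonempty (E7 ≃ₗ[ℝ] W)]
  {φ : W [⋀^Fin 3]→ₗ[ℝ] ℝ}

theorem sigma_apply (φ : W [⋀^Fin 3]→ₗ[ℝ] ℝ) (V : Oct W) (a b c : W) :
    sigma φ V ![a, b, c] = (octNormSq φ V)⁻¹ * ((V.1 ^ 2 - metric φ V.2 V.2) * φ ![a, b, c]
      - 2 * V.1 * psi φ ![V.2, a, b, c]
      + 2 * (metric φ V.2 a * φ ![V.2, b, c] + metric φ V.2 b * φ ![V.2, c, a]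
        + metric φ V.2 c * φ ![V.2, a, b])) := by
  have h := wedge12_apply (metric φ V.2) (φ.curryLeft V.2) a b c
  simp only [AlternatingMap.curryLeft_apply_apply] at h
  rw [← h]
  rfl

theorem psi_curry (φ : W [⋀^Fin 3]→ₗ[ℝ] ℝ) (v a b c : W) :
    (psi φ).curryLeft v ![a, b, c] = psi φ ![v, a, b, c] := rfl

/-- Moving `v ×` to another slot of `φ` costs only terms in `g(v, ·)`. -/
theorem IsPositive.form3_cross_right (h : IsPositive φ) {v a b : W} (c : W)
    (ha : metric φ v a = 0) (hb : metric φ v b = 0) :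
    φ ![a, b, cross φ v c] = psi φ ![v, a, b, c] := by
  rw [h.psi_eq, ha, hb, ← metric_cross, metric_symm φ (cross φ a b), metric_cross,
    form3_swap_right, ← metric_cross]
  ring

theorem IsPositive.form3_cross_mid (h : IsPositive φ) {v a c : W} (b : W)
    (ha : metric φ v a = 0) (hc : metric φ v c = 0) :
    φ ![a, cross φ v b, c] = psi φ ![v, a, b, c] := by
  rw [form3_swap_right, h.form3_cross_right b ha hc]
  have := form4_swap_mid (psi φ)
  rw [form4_swap_last, neg_neg]

theorem IsPositive.form3_cross_left (h : IsPositive φ) {v b c : W} (a : W)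
    (hb : metric φ v b = 0) (hc : metric φ v c = 0) :
    φ ![cross φ v a, b, c] = psi φ ![v, a, b, c] := by
  rw [form3_swap_left, h.form3_cross_mid a hb hc, form4_swap_mid, neg_neg]

theorem metric_cross_self_left (φ : W [⋀^Fin 3]→ₗ[ℝ] ℝ) (v a : W) :
    metric φ v (cross φ v a) = 0 := by
  rw [metric_symm, metric_cross, form3_self_outer]

/-- The linear map `a ↦ α a + β v × a + γ g(v, a) v`. -/
def axialMap (φ : W [⋀^Fin 3]→ₗ[ℝ] ℝ) (v : W) (α β γ : ℝ) : W →ₗ[ℝ] W where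
  toFun a := α • a + β • cross φ v a + (γ * metric φ v a) • v
  map_add' a b := by simp only [cross_add_right, map_add]; module
  map_smul' r a := by
    simp only [cross_smul_right, map_smul, smul_eq_mul, RingHom.id_apply]; module

theorem axialMap_apply (φ : W [⋀^Fin 3]→ₗ[ℝ] ℝ) (v : W) (α β γ : ℝ) (a : W) :
    axialMap φ v α β γ a = α • a + β • cross φ v a + (γ * metric φ v a) • v := rfl

/-- On $v^\perp$ the map is $\alpha+\beta\,v\times$, where $v\times$ is skew with square $-|v|^2$;
`h1` makes it an isometry there. Given `h1`, and for $v\neq0$, `h2` says that the eigenvalue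
$\alpha+\gamma|v|^2$ on $v$ has square 1. -/
theorem IsPositive.metric_axialMap (h : IsPositive φ) {v : W} {α β γ : ℝ}
    (h1 : α ^ 2 + β ^ 2 * metric φ v v = 1)
    (h2 : 2 * α * γ + γ ^ 2 * metric φ v v = β ^ 2) (a b : W) :
    metric φ (axialMap φ v α β γ a) (axialMap φ v α β γ b) = metric φ a b := by
  have h3 : metric φ (cross φ v a) (cross φ v b) =
      metric φ v v * metric φ a b - metric φ v a * metric φ v b := by
    rw [metric_cross, form3_swap_right, ← metric_cross, h.cross_cross]
    simp only [map_sub, map_smul, LinearMap.sub_apply, LinearMap.smul_apply, smul_eq_mul,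
      metric_symm φ b a]
    ring
  have h4 : metric φ a (cross φ v b) = -metric φ (cross φ v a) b := by
    rw [metric_symm, metric_cross, metric_cross, form3_swap_right]
  have h5 : ∀ c, metric φ (cross φ v c) v = 0 := fun c => by
    rw [metric_symm, metric_cross_self_left]
  simp only [axialMap_apply, map_add, map_smul, LinearMap.add_apply, LinearMap.smul_apply,
    smul_eq_mul, h3, h4, h5, metric_cross_self_left, metric_symm φ a v]
  linear_combination metric φ a b * h1 + metric φ v a * metric φ v b * h2

theorem form3_ext_of_perp {v : W} (hv : v ≠ 0) {η θ : W [⋀^Fin 3]→ₗ[ℝ] ℝ}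
    (h1 : ∀ b c, metric φ v b = 0 → metric φ v c = 0 → η ![v, b, c] = θ ![v, b, c])
    (h2 : ∀ a b c, metric φ v a = 0 → metric φ v b = 0 → metric φ v c = 0 →
      η ![a, b, c] = θ ![a, b, c]) : η = θ := by
  have hs : metric φ v v ≠ 0 := fun h => hv (metric_self_eq_zero.1 h)
  have hd : ∀ a, ∃ t : ℝ, ∃ a', metric φ v a' = 0 ∧ a = a' + t • v := by
    intro a
    refine ⟨metric φ v a / metric φ v v, a - (metric φ v a / metric φ v v) • v, ?_, by simp⟩
    simp only [map_sub, map_smul, smul_eq_mul]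
    field_simp
    ring
  have key : ∀ a b c, η ![a, b, c] = θ ![a, b, c] := by
    intro a b c
    obtain ⟨r, a, ha, rfl⟩ := hd a
    obtain ⟨s, b, hb, rfl⟩ := hd b
    obtain ⟨t, c, hc, rfl⟩ := hd c
    simp only [← tri_apply, map_add, map_smul, LinearMap.add_apply, LinearMap.smul_apply]
    simp only [tri_apply, form3_self_left, form3_self_right, form3_self_outer, h2 a b c ha hb hc,
      h1 b c hb hc, form3_swap_left _ v a c, form3_rotate _ v a b, h1 a c ha hc, h1 a b ha hb]
  ext x
  have hx : x = ![x 0, x 1, x 2] := by ext i; fin_cases i <;> rfl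
  rw [hx, key]

/-- Regard $v^\perp$ as $\mathbb C^3$ with complex structure $v\times/|v|$. The map fixes $v$ and
multiplies $v^\perp$ by the unit $\zeta=\alpha+i\beta|v|$. It preserves $v\lrcorner\varphi$, a
multiple of the Kähler form. On $v^\perp$, $\varphi$ and $v\lrcorner\psi/|v|$ are components of a
complex volume form, so $\varphi$ acquires the factors $\operatorname{Re}\zeta^3$ and
$\operatorname{Im}\zeta^3$. Conditions `h3` and `h4` prescribe $\zeta^3$. -/
theorem IsPositive.form3_axialMap (h : IsPositive φ) {V : Oct W} {α β γ : ℝ}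
    (hv : V.2 ≠ 0) (h1 : α ^ 2 + β ^ 2 * metric φ V.2 V.2 = 1) (h2 : α + γ * metric φ V.2 V.2 = 1)
    (h3 : α ^ 3 - 3 * α * β ^ 2 * metric φ V.2 V.2 =
      (octNormSq φ V)⁻¹ * (V.1 ^ 2 - metric φ V.2 V.2))
    (h4 : 3 * α ^ 2 * β - β ^ 3 * metric φ V.2 V.2 = (octNormSq φ V)⁻¹ * (-2 * V.1)) :
    φ.compLinearMap (axialMap φ V.2 α β γ) = sigma φ V := by
  have hn : octNormSq φ V ≠ 0 := (octNormSq_pos φ (by rintro rfl; exact hv rfl)).ne'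
  have hc : ∀ a b c, φ.compLinearMap (axialMap φ V.2 α β γ) ![a, b, c] =
      φ ![axialMap φ V.2 α β γ a, axialMap φ V.2 α β γ b, axialMap φ V.2 α β γ c] := by
    intro a b c
    rw [AlternatingMap.compLinearMap_apply]
    congr 1
    ext i
    fin_cases i <;> rfl
  have hperp : ∀ a, metric φ V.2 a = 0 →
      axialMap φ V.2 α β γ a = α • a + β • cross φ V.2 a := by
    intro a ha
    rw [axialMap_apply, ha, mul_zero, zero_smul, add_zero]
  have hJ : ∀ a, metric φ V.2 a = 0 →
      cross φ V.2 (cross φ V.2 a) = -(metric φ V.2 V.2) • a := by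
    intro a ha
    rw [h.cross_cross, ha]
    module
  refine form3_ext_of_perp (φ := φ) hv ?_ ?_
  · intro b c hb hc'
    have hV : axialMap φ V.2 α β γ V.2 = V.2 := by
      rw [axialMap_apply, cross_self, smul_zero, add_zero, ← add_smul, h2, one_smul]
    have e1 : φ ![V.2, b, cross φ V.2 c] = - φ ![V.2, cross φ V.2 b, c] := by
      rw [← metric_cross, metric_symm, metric_cross, form3_swap_right]
    have e2 : φ ![V.2, cross φ V.2 b, cross φ V.2 c] = metric φ V.2 V.2 * φ ![V.2, b, c] := by
      have : φ ![V.2, cross φ V.2 b, cross φ V.2 c]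
          = - φ ![V.2, cross φ V.2 (cross φ V.2 b), c] := by
        rw [← metric_cross, metric_symm, metric_cross, form3_swap_right]
      rw [this, hJ b hb]
      simp only [← tri_apply, map_smul, LinearMap.smul_apply, smul_eq_mul]
      ring
    rw [hc, hV, hperp b hb, hperp c hc', sigma_apply, hb, hc']
    simp only [← tri_apply, map_add, map_smul, LinearMap.add_apply, LinearMap.smul_apply,
      smul_eq_mul]
    simp only [tri_apply, e1, e2, form4_self_left]
    rw [show (V.1 ^ 2 - metric φ V.2 V.2) = octNormSq φ V - 2 * metric φ V.2 V.2 by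
      unfold octNormSq; ring]
    field_simp
    linear_combination octNormSq φ V * φ ![V.2, b, c] * h1
  · intro a b c ha hb hc'
    have p := metric_cross_self_left φ V.2
    rw [hc, hperp a ha, hperp b hb, hperp c hc', sigma_apply, ha, hb, hc']
    simp only [← tri_apply, map_add, map_smul, LinearMap.add_apply, LinearMap.smul_apply,
      smul_eq_mul]
    have s1 := h.form3_cross_left a hb hc'
    have s2 := h.form3_cross_mid b ha hc'
    have s3 := h.form3_cross_right c ha hb
    have d1 : φ ![cross φ V.2 a, cross φ V.2 b, c] = -metric φ V.2 V.2 * φ ![a, b, c] := by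
      rw [h.form3_cross_left a (p b) hc', ← h.form3_cross_mid _ ha hc', hJ b hb]
      simp only [← tri_apply, map_smul, LinearMap.smul_apply, smul_eq_mul]
    have d2 : φ ![cross φ V.2 a, b, cross φ V.2 c] = -metric φ V.2 V.2 * φ ![a, b, c] := by
      rw [h.form3_cross_left a hb (p c), ← h.form3_cross_right _ ha hb, hJ c hc']
      simp only [← tri_apply, map_smul, smul_eq_mul]
    have d3 : φ ![a, cross φ V.2 b, cross φ V.2 c] = -metric φ V.2 V.2 * φ ![a, b, c] := by
      rw [h.form3_cross_mid b ha (p c), ← h.form3_cross_right _ ha hb, hJ c hc']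
      simp only [← tri_apply, map_smul, smul_eq_mul]
    have t1 : φ ![cross φ V.2 a, cross φ V.2 b, cross φ V.2 c] =
        -metric φ V.2 V.2 * psi φ ![V.2, a, b, c] := by
      rw [h.form3_cross_left a (p b) (p c), ← h.form3_cross_mid _ ha (p c), hJ b hb, ← s3]
      simp only [← tri_apply, map_smul, LinearMap.smul_apply, smul_eq_mul]
    simp only [tri_apply, s1, s2, s3, d1, d2, d3, t1]
    linear_combination φ ![a, b, c] * h3 + psi φ ![V.2, a, b, c] * h4

/-- `σ_V(φ)` has an adapted frame which is orthonormal for the metric of `φ`. -/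
theorem IsPositive.exists_frame_sigma (h : IsPositive φ) {V : Oct W} (hV : V ≠ 0) :
    ∃ f : E7 ≃ₗ[ℝ] W, IsAdaptedFrame (sigma φ V) f ∧
      ∀ a b, inner ℝ (f.symm a) (f.symm b) = metric φ a b := by
  have hn := octNormSq_pos φ hV
  by_cases hv : V.2 = 0
  · have h1 : sigma φ V = φ := by
      have hn' : octNormSq φ V = V.1 ^ 2 := by simp [octNormSq, hv]
      have key : ∀ a b c, sigma φ V ![a, b, c] = φ ![a, b, c] := by
        intro a b c
        rw [sigma_apply, h.psi_eq, hv, hn', cross_zero_left]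
        have hV1 : V.1 ≠ 0 := by
          intro h0
          simp [hn', h0] at hn
        simp
        field_simp
      ext x
      have hx : x = ![x 0, x 1, x 2] := by ext i; fin_cases i <;> rfl
      rw [hx, key]
    rw [h1]
    exact ⟨frame φ, h.isAdaptedFrame, fun a b => rfl⟩
  have hs : 0 < metric φ V.2 V.2 :=
    lt_of_le_of_ne (metric_self_nonneg φ _) fun h0 => hv (metric_self_eq_zero.1 h0.symm)
  obtain ⟨r, hr, hrs⟩ : ∃ r : ℝ, 0 < r ∧ r ^ 2 = metric φ V.2 V.2 :=
    ⟨Real.sqrt _, Real.sqrt_pos.2 hs, Real.sq_sqrt hs.le⟩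
  -- With $r=|v|$ the prescribed cube is $(v_0-ir)^2/\|V\|^2$, which has modulus 1; any complex cube
  -- root serves.
  obtain ⟨ζ, hζ⟩ := IsAlgClosed.exists_pow_nat_eq
    (⟨(octNormSq φ V)⁻¹ * (V.1 ^ 2 - r ^ 2), (octNormSq φ V)⁻¹ * (-2 * V.1 * r)⟩ : ℂ)
    (by norm_num : 0 < 3)
  have hnr : octNormSq φ V = V.1 ^ 2 + r ^ 2 := by rw [octNormSq, hrs]
  have hζn : ζ.re ^ 2 + ζ.im ^ 2 = 1 := by
    have h1 := congrArg Complex.normSq hζ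
    rw [map_pow, Complex.normSq_apply, Complex.normSq_apply, hnr] at h1
    rw [hnr] at hn
    have h2 : (ζ.re * ζ.re + ζ.im * ζ.im) ^ 3 = 1 := by
      rw [h1]
      field_simp
      ring
    have h3 := (pow_eq_one_iff_of_nonneg
      (by nlinarith [sq_nonneg ζ.re, sq_nonneg ζ.im]) (by norm_num)).1 h2
    linarith
  have hre := congrArg Complex.re hζ
  have him := congrArg Complex.im hζ
  simp only [pow_succ, pow_zero, one_mul, Complex.mul_re, Complex.mul_im] at hre him
  have h1 : ζ.re ^ 2 + (ζ.im / r) ^ 2 * metric φ V.2 V.2 = 1 := by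
    rw [← hrs]; field_simp; linarith
  -- This value of $\gamma$ makes the eigenvalue on $v$ equal to 1.
  have h2 : ζ.re + ((1 - ζ.re) / metric φ V.2 V.2) * metric φ V.2 V.2 = 1 := by
    field_simp; ring
  have hR := h.form3_axialMap hv h1 h2
    (by rw [← hrs]; field_simp; field_simp at hre; linarith)
    (by rw [← hrs]; field_simp; field_simp at him; linarith)
  have hO := h.metric_axialMap h1 (γ := (1 - ζ.re) / metric φ V.2 V.2)
    (by rw [← hrs]; field_simp; linear_combination -hζn)
  set R := axialMap φ V.2 ζ.re (ζ.im / r) ((1 - ζ.re) / metric φ V.2 V.2)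
  have hinj : Function.Injective R := by
    rw [injective_iff_map_eq_zero]
    intro a ha
    rw [← metric_self_eq_zero (φ := φ), ← hO, ha, map_zero]
  have : FiniteDimensional ℝ W := LinearEquiv.finiteDimensional (frame φ)
  let Re := LinearEquiv.ofInjectiveEndo R hinj
  -- Because $R^*\varphi=\sigma_V(\varphi)$, composing an adapted frame of $\varphi$ with $R^{-1}$
  -- gives one of $\sigma_V(\varphi)$.
  refine ⟨(frame φ).trans Re.symm, ?_, fun a b => ?_⟩
  · rw [IsAdaptedFrame, ← hR, ← h.isAdaptedFrame]
    ext x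
    simp only [AlternatingMap.compLinearMap_apply]
    congr 1
    ext i
    exact Re.apply_symm_apply _
  · exact hO a b

theorem IsPositive.sigma (h : IsPositive φ) {V : Oct W} (hV : V ≠ 0) : IsPositive (sigma φ V) :=
  let ⟨f, hf, _⟩ := h.exists_frame_sigma hV
  ⟨f, hf⟩

theorem IsPositive.metric_sigma (h : IsPositive φ) {V : Oct W} (hV : V ≠ 0) :
    metric (G2.sigma φ V) = metric φ := by
  obtain ⟨f, hf, hm⟩ := h.exists_frame_sigma hV
  ext a b
  rw [hf.metric_eq, hm]

theorem sharp_congr {φ φ' : W [⋀^Fin 3]→ₗ[ℝ] ℝ} (hm : metric φ = metric φ') {α : W → ℝ}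
    (hα : IsLinearMap ℝ α) : sharp φ α = sharp φ' α := by
  refine metric_ext (φ := φ) fun c => ?_
  rw [metric_sharp φ hα, hm, metric_sharp φ' hα]

/-- For real parts it suffices that the metric is unchanged. For imaginary parts, pairing with $c$
and removing nested cross products reduces the right side to the terms $\varphi$, $\psi$ and
$v^\flat\wedge(v\lrcorner\varphi)$ of `sigma`. -/
theorem IsPositive.octMul_sigma_im (h : IsPositive φ) {V : Oct W} (hV : V ≠ 0) (a b : W) :
    octMul (G2.sigma φ V) (0, a) (0, b) =
      octMul φ (octMul φ (0, a) (octMul φ (0, b) V)) (octInv φ V) := by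
  have hn := (octNormSq_pos φ hV).ne'
  rw [octInv_eq, octMul_smul_right]
  obtain ⟨v0, v⟩ := V
  ext
  · have e1 : φ ![a, cross φ b v, v] = metric φ b v * metric φ a v
        - metric φ v v * metric φ a b := by
      rw [← form3_rotate, ← metric_cross, cross_anticomm, cross_anticomm φ v b, cross_neg_right,
        neg_neg, h.cross_cross]
      simp only [map_sub, map_smul, LinearMap.sub_apply, LinearMap.smul_apply, smul_eq_mul,
        metric_symm φ v a, metric_symm φ v b, metric_symm φ b a]
    simp only [octMul, h.metric_sigma hV, Prod.smul_fst, smul_eq_mul, map_add, map_neg, map_smul,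
      LinearMap.add_apply, LinearMap.smul_apply, metric_cross, zero_mul, zero_smul, zero_add,
      metric_symm φ a (cross φ b v)]
    simp only [← tri_apply, map_add, map_smul, LinearMap.add_apply, LinearMap.smul_apply]
    simp only [tri_apply, e1, form3_rotate, smul_eq_mul]
    field_simp
    simp only [octNormSq]
    ring
  · refine metric_ext (φ := φ) fun c => ?_
    have hc := metric_cross (G2.sigma φ (v0, v)) a b c
    rw [h.metric_sigma hV, sigma_apply] at hc
    have e1 : φ ![a, cross φ b v, c] = -psi φ ![v, a, b, c] - metric φ a b * metric φ v c
        + metric φ v a * metric φ b c := by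
      rw [← form4_rotate, h.psi_eq a b v c, metric_cross, metric_symm φ a v]
      ring
    have e2 : φ ![cross φ a b, v, c] = psi φ ![v, a, b, c] - metric φ v b * metric φ a c
        + metric φ b c * metric φ v a := by
      rw [← form3_rotate, ← metric_cross, metric_symm, metric_cross, ← form3_rotate,
        ← metric_cross]
      have e3 : psi φ ![b, v, c, a] = -psi φ ![v, a, b, c] := by
        rw [form4_swap_last, form4_swap_mid, neg_neg, form4_swap_left, form4_rotate]
      have e4 := h.psi_eq b v c a
      rw [e3, metric_symm φ b v, metric_symm φ c a] at e4
      linarith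
    have e3 : φ ![cross φ a (cross φ b v), v, c] = metric φ v v * φ ![a, b, c]
        + metric φ v b * φ ![v, a, c] - metric φ v c * φ ![v, a, b]
        - 2 * metric φ v a * φ ![v, b, c] := by
      have e4 : metric φ (cross φ b v) (cross φ v (cross φ a c)) =
          metric φ v b * φ ![v, a, c] + metric φ v v * φ ![a, b, c] := by
        rw [metric_symm, metric_cross, form3_swap_right, ← metric_cross, cross_anticomm φ v b,
          cross_neg_right, h.cross_cross]
        simp only [map_sub, map_neg, map_smul, LinearMap.sub_apply, LinearMap.neg_apply,
          LinearMap.smul_apply, smul_eq_mul, metric_symm φ _ (cross φ a c), metric_cross]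
        rw [form3_swap_right φ a b c, form3_rotate φ v a c]
        ring
      rw [← form3_rotate, ← metric_cross, metric_symm, metric_cross, form3_swap_right,
        ← metric_cross, h.cross_cross_polar, metric_symm]
      simp only [map_add, map_sub, map_neg, map_smul, smul_eq_mul, e4, metric_cross,
        metric_symm φ a v, form3_self_right]
      rw [form3_rotate φ a b v, form3_rotate φ v a b, form3_swap_left φ v b c]
      ring
    simp only [octMul, zero_mul, zero_smul, zero_add, hc, map_add, map_smul, LinearMap.add_apply,
      LinearMap.smul_apply, Prod.smul_snd, smul_eq_mul, cross_neg_right, map_neg,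
      LinearMap.neg_apply, metric_cross, smul_neg, cross_add_right, cross_smul_right,
      metric_symm φ a (cross φ b v)]
    simp only [← tri_apply, map_add, map_smul, LinearMap.add_apply, LinearMap.smul_apply]
    simp only [tri_apply, smul_eq_mul, e1, e2, e3]
    rw [metric_symm φ b v, form3_rotate φ a b v, form3_rotate φ v a b,
      form3_swap_left φ v a c, form3_swap_right φ v a c]
    field_simp
    ring

/-- The product of `σ_V(φ)` is `A ∘ B = (A(BV))V⁻¹`. -/
theorem IsPositive.octMul_sigma (h : IsPositive φ) {V : Oct W} (hV : V ≠ 0) (A B : Oct W) :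
    octMul (G2.sigma φ V) A B = octMul φ (octMul φ A (octMul φ B V)) (octInv φ V) := by
  obtain ⟨a0, a⟩ := A
  obtain ⟨b0, b⟩ := B
  -- If one factor is real, the formula collapses to $(XV)V^{-1}=X$, so only the imaginary case
  -- carries content.
  rw [show ((a0, a) : Oct W) = (a0, 0) + (0, a) by simp,
    show ((b0, b) : Oct W) = (b0, 0) + (0, b) by simp]
  simp only [octMul_add_left, octMul_add_right, octMul_real_left, octMul_real_right,
    octMul_smul_right, octMul_smul_left, h.octMul_octMul_octInv _ hV, h.octMul_sigma_im hV,
    h.octMul_octInv_self hV]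
  simp

end sigmaPointwise
end G2
end

/-! ### Which 3-forms are contractions of $\psi$, and uniqueness of the contracted vector. -/

noncomputable section
namespace G2

/-- The index `k` with `eᵢ × eⱼ = ± eₖ`, for `i ≠ j`. -/
def crossIdx (i j : Fin 7) : Fin 7 :=
  (![![0, 2, 1, 4, 3, 6, 5], ![2, 0, 0, 5, 6, 3, 4], ![1, 0, 0, 6, 5, 4, 3], ![4, 5, 6, 0, 0, 1, 2], ![3, 6, 5, 0, 0, 2, 1], ![6, 3, 4, 1, 2, 0, 0], ![5, 4, 3, 2, 1, 0, 0]] : Fin 7 → Fin 7 → Fin 7) i j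

/-- The sign in `eᵢ × eⱼ = ± eₖ`. -/
def crossSign (i j : Fin 7) : ℝ :=
  (![![0, 1, -1, 1, -1, 1, -1], ![-1, 0, 1, 1, -1, -1, 1], ![1, -1, 0, -1, -1, 1, 1], ![-1, -1, 1, 0, 1, 1, -1], ![1, 1, 1, -1, 0, -1, -1], ![-1, 1, -1, -1, 1, 0, 1], ![1, -1, -1, 1, 1, -1, 0]] : Fin 7 → Fin 7 → ℝ) i j

set_option maxHeartbeats 1600000 in
theorem cross0_stdVec (i j : Fin 7) :
    cross0 (stdVec i) (stdVec j) = crossSign i j • stdVec (crossIdx i j) := by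
  rw [cross0_apply]
  ext k
  fin_cases i <;> fin_cases j <;> fin_cases k <;> simp [stdVec_apply, crossSign, crossIdx]

set_option maxHeartbeats 1600000 in
-- `R` is the polarization of $\beta(a,b,a\times b)=0$ on basis vectors. Of the 35 coefficients, the
-- seven on triples $(i,j,k)$ with $e_k=\pm e_i\times e_j$ vanish. The other 28 split into seven
-- groups of four, one for each coordinate of `t`, and within a group all agree up to sign.
theorem exists_torsion_coeff (β : Fin 7 → Fin 7 → Fin 7 → ℝ)
    (h1 : ∀ i j k, β j i k = -β i j k) (h2 : ∀ i j k, β i k j = -β i j k)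
    (R : ∀ i j k, crossSign i k * β i j (crossIdx i k) + crossSign i j * β i k (crossIdx i j) = 0) :
    ∃ t : Fin 7 → ℝ, ∀ i j k, i < j → j < k → β i j k =
      -2 * crossSign i j * crossSign (crossIdx i j) k * t (crossIdx (crossIdx i j) k) := by
  -- Each coordinate of `t` is solved from one representative of its group.
  refine ⟨![-β 1 3 6 / 2, β 0 3 6 / 2, β 0 3 5 / 2, -β 0 1 6 / 2, -β 0 1 5 / 2, β 0 1 4 / 2, β 0 1 3 / 2], ?_⟩
  have h1' : ∀ i j k, i < j → β j i k = -β i j k := fun i j k _ => h1 i j k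
  have h2' : ∀ i j k, j < k → β i k j = -β i j k := fun i j k _ => h2 i j k
  -- The relations `r0` to `r20` come in threes, each three tying one group to its representative.
  have r0 := R 1 3 4
  have r1 := R 3 1 2
  have r2 := R 6 1 2
  have r3 := R 0 3 5
  have r4 := R 3 0 2
  have r5 := R 6 0 2
  have r6 := R 0 3 6
  have r7 := R 3 0 1
  have r8 := R 5 0 1
  have r9 := R 0 1 5
  have r10 := R 1 0 4
  have r11 := R 6 0 4
  have r12 := R 0 1 6
  have r13 := R 1 0 3
  have r14 := R 5 0 3
  have r15 := R 0 1 3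
  have r16 := R 1 0 6
  have r17 := R 4 0 6
  have r18 := R 0 1 4
  have r19 := R 1 0 5
  have r20 := R 3 0 5
  -- With equal last indices, `r21` to `r27` kill the seven triples closed under the cross product.
  have r21 := R 0 1 1
  have r22 := R 0 3 3
  have r23 := R 0 5 5
  have r24 := R 1 3 3
  have r25 := R 1 4 4
  have r26 := R 2 3 3
  have r27 := R 2 4 4
  clear h1 h2 R
  simp [crossSign, crossIdx, h1', h2'] at r0 r1 r2 r3 r4 r5 r6 r7 r8 r9 r10 r11 r12 r13 r14 r15 r16 r17 r18 r19 r20 r21 r22 r23 r24 r25 r26 r27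
  intro i j k hij hjk
  fin_cases i <;> fin_cases j <;> first | exact absurd hij (by decide) | skip
  all_goals fin_cases k <;> first | exact absurd hjk (by decide) | skip
  all_goals
    clear hij hjk
    simp [crossSign, crossIdx]
    try linarith

section torsion

variable {W : Type*} [AddCommGroup W] [Module ℝ W] [Nonempty (E7 ≃ₗ[ℝ] W)]
  {φ : W [⋀^Fin 3]→ₗ[ℝ] ℝ}

theorem IsPositive.cross_frameBasis (h : IsPositive φ) (i j : Fin 7) :
    cross φ (frameBasis φ i) (frameBasis φ j) =
      crossSign i j • frameBasis φ (crossIdx i j) := by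
  apply (frame φ).symm.injective
  rw [h.frame_symm_cross, map_smul]
  simp only [frameBasis_apply, LinearEquiv.symm_apply_apply, cross0_stdVec]

theorem metric_frameBasis (φ : W [⋀^Fin 3]→ₗ[ℝ] ℝ) (i j : Fin 7) :
    metric φ (frameBasis φ i) (frameBasis φ j) = if i = j then 1 else 0 := by
  rw [metric_apply, frameBasis_apply, frameBasis_apply, LinearEquiv.symm_apply_apply,
    LinearEquiv.symm_apply_apply, inner_stdVec, stdVec_apply]
  simp only [eq_comm]

theorem IsPositive.psi_eq_left (h : IsPositive φ) (t a b c : W) :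
    psi φ ![t, a, b, c] = -metric φ (cross φ (cross φ a b) c) t + metric φ c a * metric φ b t
      - metric φ c b * metric φ a t := by
  rw [form4_swap_left, form4_swap_mid, form4_swap_last, ← form4_rotate, ← form4_rotate, h.psi_eq,
    cross_anticomm φ c]
  simp only [map_neg, LinearMap.neg_apply]
  ring

theorem eq_zero_of_antisymm {ι : Type*} [LinearOrder ι] {F : ι → ι → ι → ℝ}
    (h1 : ∀ i j k, F j i k = -F i j k) (h2 : ∀ i j k, F i k j = -F i j k)
    (h : ∀ i j k, i < j → j < k → F i j k = 0) (i j k : ι) : F i j k = 0 := by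
  have d1 : ∀ i k, F i i k = 0 := fun i k => by linarith [h1 i i k]
  have d2 : ∀ i j, F i j j = 0 := fun i j => by linarith [h2 i j j]
  have h' : ∀ i j k, i < j → F i j k = 0 := by
    intro i j k hij
    rcases lt_trichotomy j k with hjk | rfl | hkj
    · exact h i j k hij hjk
    · exact d2 i j
    · rw [h2, neg_eq_zero]
      rcases lt_trichotomy i k with hik | rfl | hki
      · exact h i k j hik hkj
      · exact d1 i j
      · rw [h1, neg_eq_zero]
        exact h k i j hki hij
  rcases lt_trichotomy i j with hij | rfl | hji
  · exact h' i j k hij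
  · exact d1 i k
  · rw [h1, neg_eq_zero]
    exact h' j i k hji

/-- A 3-form which vanishes on all triples `(a, b, a × b)` is of the form `t ⌟ ψ`. -/
theorem IsPositive.exists_eq_psi (h : IsPositive φ) {B : W →ₗ[ℝ] W →ₗ[ℝ] W →ₗ[ℝ] ℝ}
    (h1 : ∀ a b c, B b a c = -B a b c) (h2 : ∀ a b c, B a c b = -B a b c)
    (hB : ∀ a b, B a b (cross φ a b) = 0) :
    ∃ t, ∀ a b c, B a b c = 2 * psi φ ![t, a, b, c] := by
  set E := frameBasis φ with hE
  have R : ∀ i j k, crossSign i k * B (E i) (E j) (E (crossIdx i k))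
      + crossSign i j * B (E i) (E k) (E (crossIdx i j)) = 0 := by
    intro i j k
    -- Polarization in the second argument; the two diagonal terms vanish by `hB`.
    have h3 := hB (E i) (E j + E k)
    simp only [cross_add_right, map_add, LinearMap.add_apply, hB] at h3
    simp only [hE, h.cross_frameBasis, map_smul, smul_eq_mul] at h3 ⊢
    linarith
  obtain ⟨t, ht⟩ := exists_torsion_coeff (fun i j k => B (E i) (E j) (E k))
    (fun i j k => h1 _ _ _) (fun i j k => h2 _ _ _) R
  refine ⟨∑ i, t i • E i, fun a b c => ?_⟩
  have hg : ∀ i, metric φ (E i) (∑ i, t i • E i) = t i := by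
    intro i
    simp [hE, map_sum, metric_frameBasis]
  set τ := ∑ i, t i • E i
  have key : ∀ i j k, B (E i) (E j) (E k) - 2 * psi φ ![τ, E i, E j, E k] = 0 := by
    refine eq_zero_of_antisymm (fun i j k => ?_) (fun i j k => ?_) (fun i j k hij hjk => ?_)
    · rw [h1, form4_swap_mid]
      ring
    · rw [h2, form4_swap_last]
      ring
    · have h3 := ht i j k hij hjk
      rw [h3, h.psi_eq_left, hE, h.cross_frameBasis, cross_smul_left, h.cross_frameBasis,
        metric_frameBasis, metric_frameBasis, if_neg (hij.trans hjk).ne', if_neg hjk.ne', ← hE]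
      simp only [map_smul, LinearMap.smul_apply, hg, smul_eq_mul]
      ring
  have h4 : B = (2 : ℝ) • tri ((psi φ).curryLeft τ) := by
    refine E.ext fun i => E.ext fun j => E.ext fun k => ?_
    simp only [LinearMap.smul_apply, tri_apply, psi_curry, smul_eq_mul]
    linarith [key i j k]
  rw [h4]
  simp only [LinearMap.smul_apply, tri_apply, psi_curry, smul_eq_mul]

/-- For distinct $i,j,k$ with $e_k\neq\pm e_i\times e_j$, $\psi(t,e_i,e_j,e_k)$ is, up to sign, one
coordinate of $t$. Seven such triples, the representatives of `exists_torsion_coeff`, reach all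
coordinates. -/
theorem IsPositive.eq_zero_of_psi (h : IsPositive φ) {t : W}
    (ht : ∀ a b c, psi φ ![t, a, b, c] = 0) : t = 0 := by
  have hE : ∀ i j k, i ≠ k → j ≠ k →
      crossSign i j * (crossSign (crossIdx i j) k *
        metric φ (frameBasis φ (crossIdx (crossIdx i j) k)) t) = 0 := by
    intro i j k hik hjk
    have h1 := ht (frameBasis φ i) (frameBasis φ j) (frameBasis φ k)
    rw [h.psi_eq_left, h.cross_frameBasis, cross_smul_left, h.cross_frameBasis,
      metric_frameBasis, metric_frameBasis, if_neg hik.symm, if_neg hjk.symm] at h1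
    simp only [map_smul, LinearMap.smul_apply, smul_eq_mul] at h1
    linarith
  refine metric_ext (φ := φ) fun c => ?_
  rw [metric_symm, metric_symm φ 0 c]
  suffices h1 : (metric φ).flip t = (metric φ).flip 0 from LinearMap.congr_fun h1 c
  refine (frameBasis φ).ext fun m => ?_
  have e0 := hE 1 3 6 (by decide) (by decide)
  have e1 := hE 0 3 6 (by decide) (by decide)
  have e2 := hE 0 3 5 (by decide) (by decide)
  have e3 := hE 0 1 6 (by decide) (by decide)
  have e4 := hE 0 1 5 (by decide) (by decide)
  have e5 := hE 0 1 4 (by decide) (by decide)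
  have e6 := hE 0 1 3 (by decide) (by decide)
  simp [crossSign, crossIdx] at e0 e1 e2 e3 e4 e5 e6
  fin_cases m <;> simpa

theorem IsPositive.psi_left_injective (h : IsPositive φ) {t t' : W}
    (ht : ∀ a b c, psi φ ![t, a, b, c] = psi φ ![t', a, b, c]) : t = t' := by
  rw [← sub_eq_zero]
  refine h.eq_zero_of_psi fun a b c => ?_
  rw [← psi_curry, map_sub, AlternatingMap.sub_apply, psi_curry, psi_curry, ht, sub_self]

end torsion

end G2
end

/-! ### Smoothness of the metric, the cross product, $\psi$ and the deformed form. -/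

noncomputable section
namespace G2

section functions

variable {M : Type*} [TopologicalSpace M] [ChartedSpace E7 M]

/-- Smoothness of a function at a point. -/
abbrev SmoothFunAt (f : M → ℝ) (x : M) : Prop := ContMDiffAt (𝓡 7) 𝓘(ℝ, ℝ) ∞ f x

/-- Differentiability of a function at a point. -/
abbrev DiffFunAt (f : M → ℝ) (x : M) : Prop := MDifferentiableAt (𝓡 7) 𝓘(ℝ, ℝ) f x

theorem SmoothFunAt.sum {ι : Type*} [Fintype ι] {f : ι → M → ℝ} {x : M}
    (hf : ∀ i, SmoothFunAt (f i) x) : SmoothFunAt (fun y => ∑ i, f i y) x :=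
  contMDiffAt_finsetSum fun i _ => hf i

theorem SmoothFunAt.mul {f g : M → ℝ} {x : M} (hf : SmoothFunAt f x) (hg : SmoothFunAt g x) :
    SmoothFunAt (fun y => f y * g y) x :=
  ContMDiffAt.smul hf hg

theorem SmoothFunAt.comp {X : Type*} [NormedAddCommGroup X] [NormedSpace ℝ X] {F : X → ℝ}
    {f : M → X} {x : M} (hF : ContDiffAt ℝ ∞ F (f x)) (hf : ContMDiffAt (𝓡 7) 𝓘(ℝ, X) ∞ f x) :
    SmoothFunAt (fun y => F (f y)) x :=
  hF.contMDiffAt.comp x hf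

theorem DiffFunAt.sum {ι : Type} [Fintype ι] {f : ι → M → ℝ} {x : M}
    (hf : ∀ i, DiffFunAt (f i) x) : DiffFunAt (fun y => ∑ i, f i y) x := by
  have h : MDifferentiableAt (𝓡 7) 𝓘(ℝ, ℝ) (∑ i, f i) x := MDifferentiableAt.sum fun i _ => hf i
  convert h using 1
  ext y
  simp

end functions

section smoothness

open Bundle Filter Topology

variable {M : Type*} [TopologicalSpace M] [ChartedSpace E7 M] [IsManifold (𝓡 7) ∞ M]

/-- Differentiability of a vector field at a point. -/
def DiffFieldAt (X : VField M) (x : M) : Prop :=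
  MDifferentiableAt (𝓡 7) ((𝓡 7).prod 𝓘(ℝ, E7))
    (fun y : M => TotalSpace.mk' E7 (E := fun z : M => TangentSpace (𝓡 7) z) y (X y)) x

theorem SmoothFieldAt.diff {X : VField M} {x : M} (hX : SmoothFieldAt X x) : DiffFieldAt X x :=
  ContMDiffAt.mdifferentiableAt hX (by simp)

theorem ext_apply {x : M} (v : TangentSpace (𝓡 7) x) : ext v x = v :=
  FiberBundle.extend_apply_self _ v

theorem smoothFieldAt_ext {x : M} (v : TangentSpace (𝓡 7) x) : SmoothFieldAt (ext v) x :=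
  FiberBundle.contMDiffAt_extend ..

theorem diffFieldAt_ext {x : M} (v : TangentSpace (𝓡 7) x) : DiffFieldAt (ext v) x :=
  (smoothFieldAt_ext v).diff

theorem DiffFieldAt.add {X Y : VField M} {x : M} (hX : DiffFieldAt X x) (hY : DiffFieldAt Y x) :
    DiffFieldAt (X + Y) x :=
  mdifferentiableAt_add_section hX hY

theorem DiffFieldAt.smul {f : M → ℝ} {X : VField M} {x : M} (hf : DiffFunAt f x)
    (hX : DiffFieldAt X x) : DiffFieldAt (f • X) x :=
  MDifferentiableAt.smul_section hf hX

/-- A local frame around `x`. -/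
def localFrame (x : M) : Fin 7 → VField M :=
  (trivializationAt E7 (fun z : M => TangentSpace (𝓡 7) z) x).localFrame
    (EuclideanSpace.basisFun (Fin 7) ℝ).toBasis

/-- The coordinates in the frame `localFrame x`. -/
def frameCoord (x : M) (i : Fin 7) (y : M) : TangentSpace (𝓡 7) y →ₗ[ℝ] ℝ :=
  (trivializationAt E7 (fun z : M => TangentSpace (𝓡 7) z) x).localFrameCoeff (𝓡 7)
    (EuclideanSpace.basisFun (Fin 7) ℝ).toBasis i y

theorem smoothFieldAt_localFrame (x : M) (i : Fin 7) : SmoothFieldAt (localFrame x i) x :=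
  contMDiffAt_localFrame_of_mem ∞ _ _ i (FiberBundle.mem_baseSet_trivializationAt ..)

theorem eventually_linearIndependent_localFrame (x : M) :
    ∀ᶠ y in 𝓝 x, LinearIndependent ℝ fun i => localFrame x i y :=
  eventually_of_mem ((trivializationAt E7 (fun z : M => TangentSpace (𝓡 7) z) x).open_baseSet.mem_nhds
    (FiberBundle.mem_baseSet_trivializationAt ..)) fun _ hy =>
      (Trivialization.isLocalFrameOn_localFrame_baseSet (𝓡 7) ∞
        (trivializationAt E7 (fun z : M => TangentSpace (𝓡 7) z) x) _).linearIndependent hy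

theorem eventually_eq_sum_frameCoord (x : M) :
    ∀ᶠ y in 𝓝 x, ∀ X : VField M, X y = ∑ i, frameCoord x i y (X y) • localFrame x i y :=
  eventually_of_mem ((trivializationAt E7 (fun z : M => TangentSpace (𝓡 7) z) x).open_baseSet.mem_nhds
    (FiberBundle.mem_baseSet_trivializationAt ..)) fun _ hy _ =>
      Trivialization.eq_sum_localFrameCoeff_smul hy

theorem smoothFieldAt_iff {X : VField M} {x : M} :
    SmoothFieldAt X x ↔ ∀ i, SmoothFunAt (fun y => frameCoord x i y (X y)) x :=
  contMDiffAt_iff_localFrameCoeff (EuclideanSpace.basisFun (Fin 7) ℝ).toBasis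
    (FiberBundle.mem_baseSet_trivializationAt ..)

theorem DiffFieldAt.frameCoord {X : VField M} {x : M} (hX : DiffFieldAt X x) (i : Fin 7) :
    DiffFunAt (fun y => frameCoord x i y (X y)) x :=
  mdifferentiableAt_localFrameCoeff (EuclideanSpace.basisFun (Fin 7) ℝ).toBasis
    (FiberBundle.mem_baseSet_trivializationAt ..) hX i


theorem metricFn_eq_sum {φ : Form3 M} {X Y : VField M} {x : M} :
    metricFn φ X Y =ᶠ[𝓝 x] fun y => ∑ j, frameCoord x j y (Y y) *
      ∑ i, frameCoord x i y (X y) * metricFn φ (localFrame x i) (localFrame x j) y := by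
  filter_upwards [eventually_eq_sum_frameCoord x] with y hy
  conv_lhs => rw [metricFn, hy X, hy Y]
  simp only [map_sum, LinearMap.sum_apply, map_smul, LinearMap.smul_apply, smul_eq_mul]
  rfl

theorem form3_eq_sum {φ : Form3 M} {X Y Z : VField M} {x : M} :
    (fun y => φ y ![X y, Y y, Z y]) =ᶠ[𝓝 x] fun y => ∑ k, frameCoord x k y (Z y) *
      ∑ j, frameCoord x j y (Y y) * ∑ i, frameCoord x i y (X y) *
        φ y ![localFrame x i y, localFrame x j y, localFrame x k y] := by
  filter_upwards [eventually_eq_sum_frameCoord x] with y hy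
  conv_lhs => rw [hy X, hy Y, hy Z]
  simp only [← tri_apply, map_sum, LinearMap.sum_apply, map_smul, LinearMap.smul_apply, smul_eq_mul]

theorem cross_eq_sum {φ : Form3 M} {X Y : VField M} {x : M} :
    ∀ᶠ y in 𝓝 x, cross (φ y) (X y) (Y y) = ∑ i, ∑ j,
      (frameCoord x i y (X y) * frameCoord x j y (Y y)) •
        cross (φ y) (localFrame x i y) (localFrame x j y) := by
  filter_upwards [eventually_eq_sum_frameCoord x] with y hy
  refine metric_ext (φ := φ y) fun c => ?_
  conv_lhs => rw [hy X, hy Y]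
  simp only [metric_cross, ← tri_apply, map_sum, LinearMap.sum_apply, map_smul,
    LinearMap.smul_apply, smul_eq_mul, mul_assoc, Finset.mul_sum]
  rw [Finset.sum_comm]
  exact Finset.sum_congr rfl fun i _ => Finset.sum_congr rfl fun j _ => mul_left_comm _ _ _

/-- Near $x$ this function is `metricCoeff` composed with the smooth coefficients of $\varphi$,
whatever adapted frames were chosen at the points. -/
theorem IsG2Structure.smoothFunAt_metricFn_localFrame {φ : Form3 M} (hφ : IsG2Structure φ) (x : M)
    (i j : Fin 7) : SmoothFunAt (metricFn φ (localFrame x i) (localFrame x j)) x := by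
  have h1 : ∀ᶠ y in 𝓝 x, metricFn φ (localFrame x i) (localFrame x j) y =
      metricCoeff (fun a b c => φ y ![localFrame x a y, localFrame x b y, localFrame x c y]) i j := by
    filter_upwards [eventually_linearIndependent_localFrame x] with y hy
    rw [metricCoeff_eq (hφ.positive y).isAdaptedFrame hy]
    rfl
  refine ContMDiffAt.congr_of_eventuallyEq ?_ h1
  refine SmoothFunAt.comp (f := fun y => fun a b c =>
    φ y ![localFrame x a y, localFrame x b y, localFrame x c y])
    (contDiffAt_metricCoeff (hφ.positive x).isAdaptedFrame
      (eventually_linearIndependent_localFrame x).self_of_nhds i j) ?_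
  rw [contMDiffAt_pi_space]
  intro a
  rw [contMDiffAt_pi_space]
  intro b
  rw [contMDiffAt_pi_space]
  intro c
  exact hφ.smooth x _ _ _ (smoothFieldAt_localFrame x a) (smoothFieldAt_localFrame x b)
    (smoothFieldAt_localFrame x c)

theorem IsG2Structure.smoothFunAt_metricFn {φ : Form3 M} (hφ : IsG2Structure φ) {X Y : VField M}
    {x : M} (hX : SmoothFieldAt X x) (hY : SmoothFieldAt Y x) :
    SmoothFunAt (metricFn φ X Y) x :=
  ContMDiffAt.congr_of_eventuallyEq (SmoothFunAt.sum fun j =>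
    .mul (smoothFieldAt_iff.1 hY j) (SmoothFunAt.sum fun i => .mul (smoothFieldAt_iff.1 hX i)
      (hφ.smoothFunAt_metricFn_localFrame x i j))) metricFn_eq_sum

/-- Tensoriality is tested on fields that are only differentiable, whereas `IsG2Structure` speaks of
smooth ones. Expansion in a smooth local frame bridges the gap, here and in the analogous lemmas for
$\varphi$ and the cross product. -/
theorem IsG2Structure.diffFunAt_metricFn {φ : Form3 M} (hφ : IsG2Structure φ) {X Y : VField M}
    {x : M} (hX : DiffFieldAt X x) (hY : DiffFieldAt Y x) :
    DiffFunAt (metricFn φ X Y) x :=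
  MDifferentiableAt.congr_of_eventuallyEq (DiffFunAt.sum fun j =>
    .mul (hY.frameCoord j) (DiffFunAt.sum fun i => .mul (hX.frameCoord i)
      ((hφ.smoothFunAt_metricFn_localFrame x i j).mdifferentiableAt (by simp)))) metricFn_eq_sum

theorem IsG2Structure.diffFunAt_form {φ : Form3 M} (hφ : IsG2Structure φ) {X Y Z : VField M}
    {x : M} (hX : DiffFieldAt X x) (hY : DiffFieldAt Y x) (hZ : DiffFieldAt Z x) :
    DiffFunAt (fun y => φ y ![X y, Y y, Z y]) x :=
  MDifferentiableAt.congr_of_eventuallyEq (DiffFunAt.sum fun k => .mul (hZ.frameCoord k)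
    (DiffFunAt.sum fun j => .mul (hY.frameCoord j) (DiffFunAt.sum fun i => .mul (hX.frameCoord i)
      ((hφ.smooth x _ _ _ (smoothFieldAt_localFrame x i) (smoothFieldAt_localFrame x j)
        (smoothFieldAt_localFrame x k)).mdifferentiableAt (by simp))))) form3_eq_sum

/-- The Gram matrix of a frame. -/
def gram (φ : Form3 M) (x y : M) : Matrix (Fin 7) (Fin 7) ℝ :=
  Matrix.of fun i j => metricFn φ (localFrame x i) (localFrame x j) y

theorem eventually_det_gram_ne_zero (φ : Form3 M) (x : M) :
    ∀ᶠ y in 𝓝 x, (gram φ x y).det ≠ 0 := by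
  filter_upwards [eventually_linearIndependent_localFrame x] with y hy h0
  obtain ⟨v, hv, hv0⟩ := Matrix.exists_mulVec_eq_zero_iff.2 h0
  have h1 : ∀ i, metric (φ y) (localFrame x i y) (∑ j, v j • localFrame x j y) = 0 := by
    intro i
    refine Eq.trans ?_ (congrFun hv0 i)
    simp [Matrix.mulVec, dotProduct, gram, metricFn, mul_comm]
  have h2 : ∑ j, v j • localFrame x j y = 0 := by
    rw [← metric_self_eq_zero (φ := φ y)]
    nth_rw 1 [map_sum (metric (φ y))]
    rw [LinearMap.sum_apply]
    simp only [map_smul (metric (φ y)), LinearMap.smul_apply, h1, smul_zero, Finset.sum_const_zero]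
  exact hv (funext fun i => Fintype.linearIndependent_iff.1 hy v h2 i)

theorem IsG2Structure.contMDiffAt_gram {φ : Form3 M} (hφ : IsG2Structure φ) (x : M) :
    ContMDiffAt (𝓡 7) 𝓘(ℝ, Fin 7 → Fin 7 → ℝ) ∞ (fun y i j => gram φ x y i j) x := by
  rw [contMDiffAt_pi_space]
  intro i
  rw [contMDiffAt_pi_space]
  intro j
  exact hφ.smoothFunAt_metricFn_localFrame x i j

/-- A vector field is smooth if its inner products with the elements of a frame are. -/
theorem IsG2Structure.smoothFieldAt_of_metricFn {φ : Form3 M} (hφ : IsG2Structure φ) {X : VField M}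
    {x : M} (hX : ∀ i, SmoothFunAt (metricFn φ X (localFrame x i)) x) : SmoothFieldAt X x := by
  rw [smoothFieldAt_iff]
  intro i
  -- Cramer's rule for the Gram matrix: the coordinates are rational in functions known to be
  -- smooth, with nonvanishing denominator.
  have h1 : ∀ᶠ y in 𝓝 x, frameCoord x i y (X y) =
      (gram φ x y).det⁻¹ * ∑ j, (gram φ x y).adjugate i j * metricFn φ X (localFrame x j) y := by
    filter_upwards [eventually_det_gram_ne_zero φ x, eventually_eq_sum_frameCoord x] with y hy h2
    have h3 : (fun j => metricFn φ X (localFrame x j) y) =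
        (gram φ x y).mulVec fun i => frameCoord x i y (X y) := by
      ext j
      conv_lhs => rw [metricFn, h2 X]
      simp [Matrix.mulVec, dotProduct, gram, metricFn, mul_comm, metric_symm]
    have h4 : (gram φ x y).adjugate.mulVec (fun j => metricFn φ X (localFrame x j) y) =
        (gram φ x y).det • fun i => frameCoord x i y (X y) := by
      rw [h3, Matrix.mulVec_mulVec, Matrix.adjugate_mul, Matrix.smul_mulVec, Matrix.one_mulVec]
    have h5 := congrFun h4 i
    rw [Matrix.mulVec, dotProduct] at h5
    rw [h5, Pi.smul_apply, smul_eq_mul, inv_mul_cancel_left₀ hy]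
  refine ContMDiffAt.congr_of_eventuallyEq ?_ h1
  have hG := hφ.contMDiffAt_gram x
  refine .mul (SmoothFunAt.comp (f := fun y i j => gram φ x y i j) (F := fun A => (Matrix.det (Matrix.of A))⁻¹)
    (ContDiffAt.inv (contDiffAt_det ?_) ?_) hG) (SmoothFunAt.sum fun j => .mul ?_ (hX j))
  · intro i j
    exact ((contDiff_apply_apply ℝ ℝ i j).contDiffAt)
  · exact (eventually_det_gram_ne_zero φ x).self_of_nhds
  · simp only [Matrix.adjugate_apply]
    refine SmoothFunAt.comp (f := fun y i j => gram φ x y i j)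
      (F := fun A => (Matrix.updateRow (Matrix.of A) j (Pi.single i 1)).det)
      (contDiffAt_det fun k l => ?_) hG
    simp only [Matrix.updateRow_apply]
    split_ifs
    · exact contDiffAt_const
    · exact ((contDiff_apply_apply ℝ ℝ k l).contDiffAt)

theorem IsG2Structure.smoothFieldAt_cross {φ : Form3 M} (hφ : IsG2Structure φ) {X Y : VField M}
    {x : M} (hX : SmoothFieldAt X x) (hY : SmoothFieldAt Y x) :
    SmoothFieldAt (fun y => cross (φ y) (X y) (Y y)) x := by
  refine hφ.smoothFieldAt_of_metricFn fun i => ?_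
  rw [show metricFn φ _ _ = fun y => φ y ![X y, Y y, localFrame x i y] from
    funext fun y => metric_cross (φ y) _ _ _]
  exact hφ.smooth x _ _ _ hX hY (smoothFieldAt_localFrame x i)

theorem DiffFieldAt.congr {X Y : VField M} {x : M} (hX : DiffFieldAt X x)
    (h : ∀ᶠ y in 𝓝 x, Y y = X y) : DiffFieldAt Y x :=
  MDifferentiableAt.congr_of_eventuallyEq hX (h.mono fun y hy => by simp only [hy])

theorem DiffFieldAt.sum {ι : Type*} [Fintype ι] {X : ι → VField M} {x : M}
    (hX : ∀ i, DiffFieldAt (X i) x) : DiffFieldAt (fun y => ∑ i, X i y) x :=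
  MDifferentiableAt.sum_section fun i _ => hX i

theorem IsG2Structure.diffFieldAt_cross {φ : Form3 M} (hφ : IsG2Structure φ) {X Y : VField M}
    {x : M} (hX : DiffFieldAt X x) (hY : DiffFieldAt Y x) :
    DiffFieldAt (fun y => cross (φ y) (X y) (Y y)) x :=
  .congr (.sum fun i => .sum fun j => MDifferentiableAt.smul_section
    (MDifferentiableAt.mul (hX.frameCoord i) (hY.frameCoord j))
    (hφ.smoothFieldAt_cross (smoothFieldAt_localFrame x i) (smoothFieldAt_localFrame x j)).diff)
    cross_eq_sum

theorem IsG2Structure.smoothFunAt_psi {φ : Form3 M} (hφ : IsG2Structure φ) {X Y Z U : VField M}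
    {x : M} (hX : SmoothFieldAt X x) (hY : SmoothFieldAt Y x) (hZ : SmoothFieldAt Z x)
    (hU : SmoothFieldAt U x) : SmoothFunAt (fun y => psi (φ y) ![X y, Y y, Z y, U y]) x := by
  simp only [fun y => (hφ.positive y).psi_eq (X y) (Y y) (Z y) (U y)]
  refine .add (.sub (.neg ?_) (.mul ?_ ?_)) (.mul ?_ ?_)
  · exact hφ.smoothFunAt_metricFn (hφ.smoothFieldAt_cross hX (hφ.smoothFieldAt_cross hY hZ)) hU
  all_goals apply hφ.smoothFunAt_metricFn <;> assumption

/-- The deformation of a G₂-structure by a nowhere vanishing octonion section. -/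
theorem IsG2Structure.sigmaField {φ : Form3 M} (hφ : IsG2Structure φ) {V : OctField M}
    (hV : IsSmoothOct V) (hV0 : ∀ x, V x ≠ 0) : IsG2Structure (sigmaField φ V) where
  positive x := (hφ.positive x).sigma (hV0 x)
  smooth x X Y Z hX hY hZ := by
    have hr : SmoothFunAt (fun y => (V y).1) x := hV.re x
    have hv := hV.im x
    have hg {X Y : VField M} (hX : SmoothFieldAt X x) (hY : SmoothFieldAt Y x) :
        SmoothFunAt (fun y => metric (φ y) (X y) (Y y)) x := hφ.smoothFunAt_metricFn hX hY
    have hn : SmoothFunAt (fun y => (octNormSq (φ y) (V y))⁻¹) x :=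
      SmoothFunAt.comp (f := fun y => octNormSq (φ y) (V y)) (F := fun t => t⁻¹)
        (contDiffAt_inv ℝ (octNormSq_pos _ (hV0 x)).ne') (.add (.pow hr 2) (hg hv hv))
    simp only [G2.sigmaField, sigma_apply]
    refine .mul hn (.add (.sub (.mul (.sub (.pow hr 2) (hg hv hv)) (hφ.smooth x _ _ _ hX hY hZ))
      (.mul (.mul contMDiffAt_const hr) (hφ.smoothFunAt_psi hv hX hY hZ)))
      (.mul contMDiffAt_const (.add (.add (.mul (hg hv hX) (hφ.smooth x _ _ _ hv hY hZ))
        (.mul (hg hv hY) (hφ.smooth x _ _ _ hv hZ hX)))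
        (.mul (hg hv hZ) (hφ.smooth x _ _ _ hv hX hY)))))

end smoothness

end G2
end

/-! ### The Levi-Civita connection from the Koszul formula. -/

noncomputable section
namespace G2

section derivatives

open VectorField Filter Topology

variable {M : Type*} [TopologicalSpace M] [ChartedSpace E7 M]

theorem dirDeriv_add {f g : M → ℝ} {x : M} (hf : DiffFunAt f x) (hg : DiffFunAt g x)
    (v : TangentSpace (𝓡 7) x) : dirDeriv (f + g) x v = dirDeriv f x v + dirDeriv g x v := by
  rw [dirDeriv, mvfderiv_add hf hg]
  rfl

theorem dirDeriv_sub {f g : M → ℝ} {x : M} (hf : DiffFunAt f x) (hg : DiffFunAt g x)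
    (v : TangentSpace (𝓡 7) x) : dirDeriv (f - g) x v = dirDeriv f x v - dirDeriv g x v := by
  rw [dirDeriv, mvfderiv_sub hf hg]
  rfl

theorem dirDeriv_neg (f : M → ℝ) (x : M) (v : TangentSpace (𝓡 7) x) :
    dirDeriv (-f) x v = -dirDeriv f x v := by
  rw [dirDeriv, mvfderiv_neg]
  rfl

theorem dirDeriv_mul {f g : M → ℝ} {x : M} (hf : DiffFunAt f x) (hg : DiffFunAt g x)
    (v : TangentSpace (𝓡 7) x) :
    dirDeriv (f * g) x v = f x * dirDeriv g x v + g x * dirDeriv f x v := by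
  rw [dirDeriv, mvfderiv_mul hf hg]
  rfl

theorem dirDeriv_const (c : ℝ) (x : M) (v : TangentSpace (𝓡 7) x) :
    dirDeriv (fun _ : M => c) x v = 0 := by
  rw [dirDeriv, mvfderiv_const]
  rfl

theorem dirDeriv_vec_add (f : M → ℝ) (x : M) (v w : TangentSpace (𝓡 7) x) :
    dirDeriv f x (v + w) = dirDeriv f x v + dirDeriv f x w :=
  map_add _ _ _

theorem dirDeriv_vec_smul (f : M → ℝ) (x : M) (c : ℝ) (v : TangentSpace (𝓡 7) x) :
    dirDeriv f x (c • v) = c * dirDeriv f x v :=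
  map_smul (mvfderiv (𝓡 7) f x) _ _

theorem metricFn_add_left (φ : Form3 M) (X X' Y : VField M) :
    metricFn φ (X + X') Y = metricFn φ X Y + metricFn φ X' Y := by
  ext y
  simp only [metricFn, Pi.add_apply, map_add, LinearMap.add_apply]

theorem metricFn_smul_left (φ : Form3 M) (f : M → ℝ) (X Y : VField M) :
    metricFn φ (f • X) Y = f * metricFn φ X Y := by
  ext y
  simp only [metricFn, Pi.mul_apply, Pi.smul_apply', map_smul, LinearMap.smul_apply, smul_eq_mul]

theorem metricFn_symm (φ : Form3 M) (X Y : VField M) : metricFn φ X Y = metricFn φ Y X :=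
  funext fun _ => metric_symm _ _ _

theorem metricFn_add_right (φ : Form3 M) (X Y Y' : VField M) :
    metricFn φ X (Y + Y') = metricFn φ X Y + metricFn φ X Y' := by
  simp only [metricFn_symm φ X, metricFn_add_left]

theorem metricFn_smul_right (φ : Form3 M) (f : M → ℝ) (X Y : VField M) :
    metricFn φ X (f • Y) = f * metricFn φ X Y := by
  simp only [metricFn_symm φ X, metricFn_smul_left]

theorem koszul_eq (φ : Form3 M) (X Y Z : VField M) (x : M) : koszul φ X Y Z x =
    (1 / 2 : ℝ) * (dirDeriv (metricFn φ Y Z) x (X x) + dirDeriv (metricFn φ Z X) x (Y x)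
      - dirDeriv (metricFn φ X Y) x (Z x)
      - metric (φ x) (Y x) (mlieBracket (𝓡 7) X Z x)
      - metric (φ x) (Z x) (mlieBracket (𝓡 7) Y X x)
      + metric (φ x) (X x) (mlieBracket (𝓡 7) Z Y x)) := rfl

/-- This is compatibility with the metric: all other terms are exchanged with opposite signs. -/
theorem koszul_add_swap (φ : Form3 M) (X Y Z : VField M) (x : M) :
    koszul φ X Y Z x + koszul φ X Z Y x = dirDeriv (metricFn φ Y Z) x (X x) := by
  simp only [koszul_eq, metricFn_symm φ Z, metricFn_symm φ Y X, mlieBracket_swap_apply (V := Z) (W := X),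
    mlieBracket_swap_apply (V := Y) (W := X), mlieBracket_swap_apply (V := Z) (W := Y), map_neg]
  ring

variable [IsManifold (𝓡 7) ∞ M]

theorem bracket_add_left {X X' : VField M} {x : M} (Y : VField M) (hX : DiffFieldAt X x)
    (hX' : DiffFieldAt X' x) : mlieBracket (𝓡 7) (X + X') Y x =
      mlieBracket (𝓡 7) X Y x + mlieBracket (𝓡 7) X' Y x :=
  mlieBracket_add_left hX hX'

theorem bracket_add_right {Y Y' : VField M} {x : M} (X : VField M) (hY : DiffFieldAt Y x)
    (hY' : DiffFieldAt Y' x) : mlieBracket (𝓡 7) X (Y + Y') x =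
      mlieBracket (𝓡 7) X Y x + mlieBracket (𝓡 7) X Y' x :=
  mlieBracket_add_right hY hY'

theorem bracket_smul_left {f : M → ℝ} {X : VField M} {x : M} (Y : VField M) (hf : DiffFunAt f x)
    (hX : DiffFieldAt X x) : mlieBracket (𝓡 7) (f • X) Y x =
      -dirDeriv f x (Y x) • X x + f x • mlieBracket (𝓡 7) X Y x :=
  mlieBracket_smul_left hf hX

theorem bracket_smul_right {f : M → ℝ} {Y : VField M} {x : M} (X : VField M) (hf : DiffFunAt f x)
    (hY : DiffFieldAt Y x) : mlieBracket (𝓡 7) X (f • Y) x =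
      dirDeriv f x (X x) • Y x + f x • mlieBracket (𝓡 7) X Y x :=
  mlieBracket_smul_right hf hY

namespace IsG2Structure

variable {φ : Form3 M} (hφ : IsG2Structure φ) {X X' Y Y' Z Z' : VField M} {f : M → ℝ} {x : M}

include hφ

theorem koszul_add_left (hX : DiffFieldAt X x) (hX' : DiffFieldAt X' x) (hY : DiffFieldAt Y x)
    (hZ : DiffFieldAt Z x) : koszul φ (X + X') Y Z x = koszul φ X Y Z x + koszul φ X' Y Z x := by
  simp only [koszul_eq, metricFn_add_left, metricFn_add_right, bracket_add_left _ hX hX',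
    bracket_add_right _ hX hX', dirDeriv_add (hφ.diffFunAt_metricFn hX hY) (hφ.diffFunAt_metricFn hX' hY),
    dirDeriv_add (hφ.diffFunAt_metricFn hZ hX) (hφ.diffFunAt_metricFn hZ hX'), Pi.add_apply,
    dirDeriv_vec_add, map_add, LinearMap.add_apply]
  ring

theorem koszul_add_right (hX : DiffFieldAt X x) (hY : DiffFieldAt Y x)
    (hZ : DiffFieldAt Z x) (hZ' : DiffFieldAt Z' x) :
    koszul φ X Y (Z + Z') x = koszul φ X Y Z x + koszul φ X Y Z' x := by
  simp only [koszul_eq, metricFn_add_left, metricFn_add_right, bracket_add_left _ hZ hZ',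
    bracket_add_right _ hZ hZ', dirDeriv_add (hφ.diffFunAt_metricFn hZ hX) (hφ.diffFunAt_metricFn hZ' hX),
    dirDeriv_add (hφ.diffFunAt_metricFn hY hZ) (hφ.diffFunAt_metricFn hY hZ'), Pi.add_apply,
    dirDeriv_vec_add, map_add, LinearMap.add_apply]
  ring

theorem koszul_add_mid (hX : DiffFieldAt X x) (hY : DiffFieldAt Y x) (hY' : DiffFieldAt Y' x)
    (hZ : DiffFieldAt Z x) : koszul φ X (Y + Y') Z x = koszul φ X Y Z x + koszul φ X Y' Z x := by
  simp only [koszul_eq, metricFn_add_left, metricFn_add_right, bracket_add_left _ hY hY',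
    bracket_add_right _ hY hY', dirDeriv_add (hφ.diffFunAt_metricFn hY hZ) (hφ.diffFunAt_metricFn hY' hZ),
    dirDeriv_add (hφ.diffFunAt_metricFn hX hY) (hφ.diffFunAt_metricFn hX hY'), Pi.add_apply,
    dirDeriv_vec_add, map_add, LinearMap.add_apply]
  ring

theorem koszul_smul_left (hf : DiffFunAt f x) (hX : DiffFieldAt X x) (hY : DiffFieldAt Y x)
    (hZ : DiffFieldAt Z x) : koszul φ (f • X) Y Z x = f x * koszul φ X Y Z x := by
  simp only [koszul_eq, metricFn_smul_left, metricFn_smul_right, bracket_smul_left _ hf hX,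
    bracket_smul_right _ hf hX, dirDeriv_mul hf (hφ.diffFunAt_metricFn hX hY),
    dirDeriv_mul hf (hφ.diffFunAt_metricFn hZ hX), Pi.smul_apply',
    dirDeriv_vec_smul, map_add, map_smul, LinearMap.smul_apply, smul_eq_mul]
  simp only [metricFn, metric_symm (φ x) (Z x), metric_symm (φ x) (Y x) (X x)]
  ring

theorem koszul_smul_right (hf : DiffFunAt f x) (hX : DiffFieldAt X x) (hY : DiffFieldAt Y x)
    (hZ : DiffFieldAt Z x) : koszul φ X Y (f • Z) x = f x * koszul φ X Y Z x := by
  simp only [koszul_eq, metricFn_smul_left, metricFn_smul_right, bracket_smul_left _ hf hZ,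
    bracket_smul_right _ hf hZ, dirDeriv_mul hf (hφ.diffFunAt_metricFn hZ hX),
    dirDeriv_mul hf (hφ.diffFunAt_metricFn hY hZ), Pi.smul_apply',
    dirDeriv_vec_smul, map_add, map_smul, LinearMap.smul_apply, smul_eq_mul]
  simp only [metricFn, metric_symm (φ x) (Z x)]
  ring

theorem koszul_smul_mid (hf : DiffFunAt f x) (hX : DiffFieldAt X x) (hY : DiffFieldAt Y x)
    (hZ : DiffFieldAt Z x) : koszul φ X (f • Y) Z x =
      f x * koszul φ X Y Z x + dirDeriv f x (X x) * metric (φ x) (Y x) (Z x) := by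
  simp only [koszul_eq, metricFn_smul_left, metricFn_smul_right, bracket_smul_left _ hf hY,
    bracket_smul_right _ hf hY, dirDeriv_mul hf (hφ.diffFunAt_metricFn hY hZ),
    dirDeriv_mul hf (hφ.diffFunAt_metricFn hX hY), Pi.smul_apply',
    dirDeriv_vec_smul, map_add, map_smul, LinearMap.smul_apply, smul_eq_mul]
  simp only [metricFn, metric_symm (φ x) (Z x)]
  ring

theorem tensorialAt_koszul_left (hY : DiffFieldAt Y x) (hZ : DiffFieldAt Z x) :
    TensorialAt (𝓡 7) E7 (V := fun z : M => TangentSpace (𝓡 7) z) (fun X => koszul φ X Y Z x) x where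
  smul hf hX := hφ.koszul_smul_left hf hX hY hZ
  add hX hX' := hφ.koszul_add_left hX hX' hY hZ

theorem tensorialAt_koszul_right (hX : DiffFieldAt X x) (hY : DiffFieldAt Y x) :
    TensorialAt (𝓡 7) E7 (V := fun z : M => TangentSpace (𝓡 7) z) (fun Z => koszul φ X Y Z x) x where
  smul hf hZ := hφ.koszul_smul_right hf hX hY hZ
  add hZ hZ' := hφ.koszul_add_right hX hY hZ hZ'

/-- Frees `nabla`, which is defined with the particular extensions `ext`, from that choice. -/
theorem koszul_congr (hX : DiffFieldAt X x) (hX' : DiffFieldAt X' x) (hY : DiffFieldAt Y x)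
    (hZ : DiffFieldAt Z x) (hZ' : DiffFieldAt Z' x) (hXX' : X x = X' x) (hZZ' : Z x = Z' x) :
    koszul φ X Y Z x = koszul φ X' Y Z' x :=
  ((hφ.tensorialAt_koszul_left hY hZ).pointwise hX hX' hXX').trans
    ((hφ.tensorialAt_koszul_right hX' hY).pointwise hZ hZ' hZZ')

theorem isLinearMap_koszul_ext (hY : DiffFieldAt Y x) (v : TangentSpace (𝓡 7) x) :
    IsLinearMap ℝ fun w : TangentSpace (𝓡 7) x => koszul φ (ext v) Y (ext w) x := by
  have hv := diffFieldAt_ext v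
  constructor
  · intro w w'
    rw [← hφ.koszul_add_right hv hY (diffFieldAt_ext w) (diffFieldAt_ext w')]
    exact hφ.koszul_congr hv hv hY (diffFieldAt_ext _)
      ((diffFieldAt_ext w).add (diffFieldAt_ext w')) rfl (by simp [ext_apply])
  · intro c w
    have hc : DiffFunAt (fun _ : M => c) x := mdifferentiableAt_const
    rw [smul_eq_mul, ← hφ.koszul_smul_right hc hv hY (diffFieldAt_ext w)]
    exact hφ.koszul_congr hv hv hY (diffFieldAt_ext _) ((diffFieldAt_ext w).smul hc) rfl
      (by simp [ext_apply])

/-- The defining property of the Levi-Civita connection. -/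
theorem metric_nabla (hX : DiffFieldAt X x) (hY : DiffFieldAt Y x) (hZ : DiffFieldAt Z x) :
    metric (φ x) (nabla φ Y x (X x)) (Z x) = koszul φ X Y Z x := by
  rw [nabla, metric_sharp _ (hφ.isLinearMap_koszul_ext hY _)]
  exact hφ.koszul_congr (diffFieldAt_ext _) hX hY (diffFieldAt_ext _) hZ (ext_apply _)
    (ext_apply _)

theorem metric_nabla_ext (hY : DiffFieldAt Y x) (v w : TangentSpace (𝓡 7) x) :
    metric (φ x) (nabla φ Y x v) w = koszul φ (ext v) Y (ext w) x := by
  have h := hφ.metric_nabla (diffFieldAt_ext v) hY (diffFieldAt_ext w)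
  rwa [ext_apply, ext_apply] at h

theorem nabla_add (hY : DiffFieldAt Y x) (hY' : DiffFieldAt Y' x) (v : TangentSpace (𝓡 7) x) :
    nabla φ (Y + Y') x v = nabla φ Y x v + nabla φ Y' x v := by
  refine metric_ext (φ := φ x) fun w => ?_
  rw [map_add, LinearMap.add_apply, hφ.metric_nabla_ext (hY.add hY'), hφ.metric_nabla_ext hY,
    hφ.metric_nabla_ext hY', hφ.koszul_add_mid (diffFieldAt_ext _) hY hY' (diffFieldAt_ext _)]

theorem nabla_smul (hf : DiffFunAt f x) (hY : DiffFieldAt Y x) (v : TangentSpace (𝓡 7) x) :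
    nabla φ (f • Y) x v = f x • nabla φ Y x v + dirDeriv f x v • Y x := by
  refine metric_ext (φ := φ x) fun w => ?_
  rw [map_add, map_smul, map_smul, LinearMap.add_apply, LinearMap.smul_apply, LinearMap.smul_apply,
    hφ.metric_nabla_ext (hY.smul hf), hφ.metric_nabla_ext hY,
    hφ.koszul_smul_mid hf (diffFieldAt_ext _) hY (diffFieldAt_ext _), ext_apply, ext_apply]
  rfl

theorem nabla_vec_add (hY : DiffFieldAt Y x) (v v' : TangentSpace (𝓡 7) x) :
    nabla φ Y x (v + v') = nabla φ Y x v + nabla φ Y x v' := by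
  refine metric_ext (φ := φ x) fun w => ?_
  have hw := diffFieldAt_ext w
  rw [map_add, LinearMap.add_apply, hφ.metric_nabla_ext hY, hφ.metric_nabla_ext hY,
    hφ.metric_nabla_ext hY, ← hφ.koszul_add_left (diffFieldAt_ext v) (diffFieldAt_ext v') hY hw]
  exact hφ.koszul_congr (diffFieldAt_ext _) ((diffFieldAt_ext v).add (diffFieldAt_ext v')) hY hw hw
    (by simp [ext_apply]) rfl

theorem nabla_vec_smul (hY : DiffFieldAt Y x) (c : ℝ) (v : TangentSpace (𝓡 7) x) :
    nabla φ Y x (c • v) = c • nabla φ Y x v := by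
  refine metric_ext (φ := φ x) fun w => ?_
  have hw := diffFieldAt_ext w
  have hc : DiffFunAt (fun _ : M => c) x := mdifferentiableAt_const
  rw [map_smul, LinearMap.smul_apply, hφ.metric_nabla_ext hY, hφ.metric_nabla_ext hY, smul_eq_mul,
    ← hφ.koszul_smul_left hc (diffFieldAt_ext v) hY hw]
  exact hφ.koszul_congr (diffFieldAt_ext _) ((diffFieldAt_ext v).smul hc) hY hw hw
    (by simp [ext_apply]) rfl

theorem dirDeriv_metricFn (hY : DiffFieldAt Y x) (hZ : DiffFieldAt Z x)
    (v : TangentSpace (𝓡 7) x) : dirDeriv (metricFn φ Y Z) x v =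
      metric (φ x) (nabla φ Y x v) (Z x) + metric (φ x) (Y x) (nabla φ Z x v) := by
  have h := koszul_add_swap φ (ext v) Y Z x
  rw [← hφ.metric_nabla (diffFieldAt_ext v) hY hZ, ← hφ.metric_nabla (diffFieldAt_ext v) hZ hY,
    ext_apply] at h
  rw [← h, metric_symm (φ x) (Y x)]

/-- The Levi-Civita connection depends only on the metric. -/
theorem nabla_congr_metric {φ' : Form3 M} (hm : ∀ y, metric (φ y) = metric (φ' y))
    (hY : DiffFieldAt Y x) (v : TangentSpace (𝓡 7) x) : nabla φ' Y x v = nabla φ Y x v := by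
  have h1 : metricFn φ' = metricFn φ := by
    ext X Z y
    rw [metricFn, metricFn, hm y]
  have h2 : koszul φ' = koszul φ := by
    ext X Y Z y
    simp only [koszul, h1]
  rw [nabla, nabla, h2]
  exact (sharp_congr (hm x) (hφ.isLinearMap_koszul_ext hY v)).symm

end IsG2Structure

end derivatives

end G2
end

/-! ### The covariant derivative of the 3-form and the existence of torsion. -/

noncomputable section
namespace G2

section pointwise

variable {W : Type*} [AddCommGroup W] [Module ℝ W] [Nonempty (E7 ≃ₗ[ℝ] W)]
  {φ : W [⋀^Fin 3]→ₗ[ℝ] ℝ}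

theorem psi_add_left (φ : W [⋀^Fin 3]→ₗ[ℝ] ℝ) (t t' a b c : W) :
    psi φ ![t + t', a, b, c] = psi φ ![t, a, b, c] + psi φ ![t', a, b, c] := by
  rw [← psi_curry, map_add (psi φ).curryLeft, AlternatingMap.add_apply, psi_curry, psi_curry]

theorem psi_smul_left (φ : W [⋀^Fin 3]→ₗ[ℝ] ℝ) (r : ℝ) (t a b c : W) :
    psi φ ![r • t, a, b, c] = r * psi φ ![t, a, b, c] := by
  rw [← psi_curry, map_smul (psi φ).curryLeft, AlternatingMap.smul_apply, psi_curry, smul_eq_mul]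

theorem IsPositive.form3_mid_cross (h : IsPositive φ) (a b c : W) :
    φ ![a, c, cross φ a b] = metric φ a a * metric φ b c - metric φ a b * metric φ a c := by
  rw [form3_swap_right, ← metric_cross, h.cross_cross, map_sub, LinearMap.sub_apply, map_smul,
    map_smul, LinearMap.smul_apply, LinearMap.smul_apply, smul_eq_mul, smul_eq_mul]
  ring

theorem IsPositive.form3_left_cross (h : IsPositive φ) (a b c : W) :
    φ ![c, b, cross φ a b] = metric φ b b * metric φ a c - metric φ a b * metric φ b c := by
  rw [form3_swap_left, cross_anticomm, ← tri_apply, map_neg, tri_apply, h.form3_mid_cross,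
    metric_symm φ b a]
  ring

end pointwise

section nablaForm

open Filter Topology

variable {M : Type*} [TopologicalSpace M] [ChartedSpace E7 M] [IsManifold (𝓡 7) ∞ M]

/-- The expression `v(φ(A, B, C)) - φ(∇_v A, B, C) - φ(A, ∇_v B, C) - φ(A, B, ∇_v C)`. -/
def covForm (φ : Form3 M) (x : M) (v : TangentSpace (𝓡 7) x) (A B C : VField M) : ℝ :=
  dirDeriv (fun y => φ y ![A y, B y, C y]) x v
    - φ x ![nabla φ A x v, B x, C x] - φ x ![A x, nabla φ B x v, C x]
    - φ x ![A x, B x, nabla φ C x v]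

theorem covForm_swap_left (φ : Form3 M) (x : M) (v : TangentSpace (𝓡 7) x) (A B C : VField M) :
    covForm φ x v B A C = -covForm φ x v A B C := by
  have h : (fun y => φ y ![B y, A y, C y]) = -fun y => φ y ![A y, B y, C y] :=
    funext fun y => form3_swap_left (φ y) _ _ _
  simp only [covForm, h, dirDeriv_neg, form3_swap_left (φ x) (B x) (nabla φ A x v),
    form3_swap_left (φ x) (nabla φ B x v), form3_swap_left (φ x) (A x) (B x)]
  ring

theorem covForm_swap_right (φ : Form3 M) (x : M) (v : TangentSpace (𝓡 7) x) (A B C : VField M) :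
    covForm φ x v A C B = -covForm φ x v A B C := by
  have h : (fun y => φ y ![A y, C y, B y]) = -fun y => φ y ![A y, B y, C y] :=
    funext fun y => form3_swap_right (φ y) _ _ _
  simp only [covForm, h, dirDeriv_neg, form3_swap_right (φ x) _ (C x) (nabla φ B x v),
    form3_swap_right (φ x) _ (nabla φ C x v), form3_swap_right (φ x) _ (B x) (C x)]
  ring

theorem nablaForm_eq_covForm (φ : Form3 M) (x : M) (v a b c : TangentSpace (𝓡 7) x) :
    nablaForm φ x v a b c = covForm φ x v (ext a) (ext b) (ext c) := by
  simp only [nablaForm, covForm, ext_apply]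

theorem nablaForm_swap_left (φ : Form3 M) (x : M) (v a b c : TangentSpace (𝓡 7) x) :
    nablaForm φ x v b a c = -nablaForm φ x v a b c := by
  simp only [nablaForm_eq_covForm, covForm_swap_left φ x v (ext a)]

theorem nablaForm_swap_right (φ : Form3 M) (x : M) (v a b c : TangentSpace (𝓡 7) x) :
    nablaForm φ x v a c b = -nablaForm φ x v a b c := by
  simp only [nablaForm_eq_covForm, covForm_swap_right φ x v _ (ext b)]

namespace IsG2Structure

variable {φ : Form3 M} (hφ : IsG2Structure φ) {A A' B B' C C' : VField M} {f : M → ℝ} {x : M}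

include hφ

/-- The derivative of $f$ produced by the Leibniz rule cancels the one in $\nabla(fA)$. The first
slot suffices, since the other two follow from antisymmetry. -/
theorem tensorialAt_covForm (hB : DiffFieldAt B x) (hC : DiffFieldAt C x)
    (v : TangentSpace (𝓡 7) x) :
    TensorialAt (𝓡 7) E7 (V := fun z : M => TangentSpace (𝓡 7) z)
      (fun A => covForm φ x v A B C) x where
  smul {f A} hf hA := by
    have h : (fun y => φ y ![(f • A) y, B y, C y]) = f * fun y => φ y ![A y, B y, C y] := by
      ext y
      simp only [Pi.mul_apply, Pi.smul_apply', ← tri_apply, map_smul, LinearMap.smul_apply,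
        smul_eq_mul]
    simp only [covForm, h]
    simp only [dirDeriv_mul hf (hφ.diffFunAt_form hA hB hC), hφ.nabla_smul hf hA,
      Pi.smul_apply']
    simp only [← tri_apply, map_add, map_smul, LinearMap.add_apply, LinearMap.smul_apply,
      smul_eq_mul]
    ring
  add {A A'} hA hA' := by
    have h : (fun y => φ y ![(A + A') y, B y, C y]) =
        (fun y => φ y ![A y, B y, C y]) + fun y => φ y ![A' y, B y, C y] := by
      ext y
      simp only [Pi.add_apply, ← tri_apply, map_add, LinearMap.add_apply]
    simp only [covForm, h]
    simp only [dirDeriv_add (hφ.diffFunAt_form hA hB hC)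
      (hφ.diffFunAt_form hA' hB hC), hφ.nabla_add hA hA', Pi.add_apply]
    simp only [← tri_apply, map_add, LinearMap.add_apply]
    ring

theorem covForm_congr_left (hA : DiffFieldAt A x) (hA' : DiffFieldAt A' x) (hB : DiffFieldAt B x)
    (hC : DiffFieldAt C x) (h : A x = A' x) (v : TangentSpace (𝓡 7) x) :
    covForm φ x v A B C = covForm φ x v A' B C :=
  (hφ.tensorialAt_covForm hB hC v).pointwise hA hA' h

theorem covForm_eq (hA : DiffFieldAt A x) (hB : DiffFieldAt B x) (hC : DiffFieldAt C x)
    (v : TangentSpace (𝓡 7) x) : covForm φ x v A B C = nablaForm φ x v (A x) (B x) (C x) := by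
  have eA := diffFieldAt_ext (A x)
  have eB := diffFieldAt_ext (B x)
  have eC := diffFieldAt_ext (C x)
  rw [nablaForm_eq_covForm, hφ.covForm_congr_left hA eA hB hC (ext_apply _).symm,
    ← neg_inj, ← covForm_swap_left, ← covForm_swap_left,
    hφ.covForm_congr_left hB eB eA hC (ext_apply _).symm, ← neg_inj, ← covForm_swap_right,
    ← covForm_swap_right, ← neg_inj, ← covForm_swap_left, ← covForm_swap_left,
    hφ.covForm_congr_left hC eC eB eA (ext_apply _).symm]

theorem dirDeriv_form (hA : DiffFieldAt A x) (hB : DiffFieldAt B x) (hC : DiffFieldAt C x)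
    (v : TangentSpace (𝓡 7) x) : dirDeriv (fun y => φ y ![A y, B y, C y]) x v =
      nablaForm φ x v (A x) (B x) (C x) + φ x ![nabla φ A x v, B x, C x]
        + φ x ![A x, nabla φ B x v, C x] + φ x ![A x, B x, nabla φ C x v] := by
  rw [← hφ.covForm_eq hA hB hC, covForm]
  ring

theorem nablaForm_add_left (v a a' b c : TangentSpace (𝓡 7) x) :
    nablaForm φ x v (a + a') b c = nablaForm φ x v a b c + nablaForm φ x v a' b c := by
  rw [nablaForm_eq_covForm, nablaForm_eq_covForm, nablaForm_eq_covForm,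
    ← (hφ.tensorialAt_covForm (diffFieldAt_ext b) (diffFieldAt_ext c) v).add (diffFieldAt_ext a)
      (diffFieldAt_ext a')]
  exact hφ.covForm_congr_left (diffFieldAt_ext _) ((diffFieldAt_ext a).add (diffFieldAt_ext a'))
    (diffFieldAt_ext b) (diffFieldAt_ext c) (by simp [ext_apply]) v

theorem nablaForm_smul_left (r : ℝ) (v a b c : TangentSpace (𝓡 7) x) :
    nablaForm φ x v (r • a) b c = r * nablaForm φ x v a b c := by
  have hr : DiffFunAt (fun _ : M => r) x := mdifferentiableAt_const
  have h := (hφ.tensorialAt_covForm (diffFieldAt_ext b) (diffFieldAt_ext c) v).smul hr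
    (diffFieldAt_ext a)
  rw [smul_eq_mul] at h
  rw [nablaForm_eq_covForm, nablaForm_eq_covForm, ← h]
  exact hφ.covForm_congr_left (diffFieldAt_ext _) ((diffFieldAt_ext a).smul hr)
    (diffFieldAt_ext b) (diffFieldAt_ext c) (by simp [ext_apply]) v

theorem nablaForm_add_vec (v v' a b c : TangentSpace (𝓡 7) x) :
    nablaForm φ x (v + v') a b c = nablaForm φ x v a b c + nablaForm φ x v' a b c := by
  simp only [nablaForm, dirDeriv_vec_add, hφ.nabla_vec_add (diffFieldAt_ext _), ← tri_apply,
    map_add, LinearMap.add_apply]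
  ring

theorem nablaForm_smul_vec (r : ℝ) (v a b c : TangentSpace (𝓡 7) x) :
    nablaForm φ x (r • v) a b c = r * nablaForm φ x v a b c := by
  simp only [nablaForm, dirDeriv_vec_smul, hφ.nabla_vec_smul (diffFieldAt_ext _), ← tri_apply,
    map_smul, LinearMap.smul_apply, smul_eq_mul]
  ring

/-- `∇_v φ`, as a trilinear map. -/
def nablaTri (v : TangentSpace (𝓡 7) x) : TangentSpace (𝓡 7) x →ₗ[ℝ] TangentSpace (𝓡 7) x →ₗ[ℝ]
    TangentSpace (𝓡 7) x →ₗ[ℝ] ℝ :=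
  LinearMap.mk₂ ℝ (fun a b =>
    { toFun := fun c => nablaForm φ x v a b c
      map_add' := fun c c' => by
        simp only [nablaForm_swap_right φ x v a _ b, nablaForm_swap_left φ x v _ a b,
          hφ.nablaForm_add_left]
        ring
      map_smul' := fun r c => by
        simp only [nablaForm_swap_right φ x v a _ b, nablaForm_swap_left φ x v _ a b,
          hφ.nablaForm_smul_left, smul_eq_mul, RingHom.id_apply]
        ring })
    (fun a a' b => LinearMap.ext fun c => hφ.nablaForm_add_left v a a' b c)
    (fun r a b => LinearMap.ext fun c => hφ.nablaForm_smul_left r v a b c)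
    (fun a b b' => LinearMap.ext fun c => by
      simp only [LinearMap.coe_mk, AddHom.coe_mk, LinearMap.add_apply,
        nablaForm_swap_left φ x v _ a c, hφ.nablaForm_add_left]
      ring)
    (fun r a b => LinearMap.ext fun c => by
      simp only [LinearMap.coe_mk, AddHom.coe_mk, LinearMap.smul_apply, smul_eq_mul,
        nablaForm_swap_left φ x v _ a c, hφ.nablaForm_smul_left]
      ring)

theorem nablaTri_apply (v a b c : TangentSpace (𝓡 7) x) :
    hφ.nablaTri v a b c = nablaForm φ x v a b c := rfl

/-- Comes from differentiating $g(A\times B,C)=\varphi(A,B,C)$ in two ways; the terms with $\nabla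
C$ cancel. -/
theorem metric_nabla_cross (hA : DiffFieldAt A x) (hB : DiffFieldAt B x)
    (v c : TangentSpace (𝓡 7) x) :
    metric (φ x) (nabla φ (fun y => cross (φ y) (A y) (B y)) x v) c =
      nablaForm φ x v (A x) (B x) c + φ x ![nabla φ A x v, B x, c]
        + φ x ![A x, nabla φ B x v, c] := by
  have hc := diffFieldAt_ext c
  have h1 := hφ.dirDeriv_metricFn (hφ.diffFieldAt_cross hA hB) hc v
  have h2 := hφ.dirDeriv_form hA hB hc v
  have h3 : metricFn φ (fun y => cross (φ y) (A y) (B y)) (ext c) =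
      fun y => φ y ![A y, B y, ext c y] := funext fun y => metric_cross (φ y) _ _ _
  rw [h3, h2, metric_cross, ext_apply] at h1
  linarith

/-- `(∇_v φ)(a, b, a × b) = 0`. -/
theorem nablaForm_cross (v a b : TangentSpace (𝓡 7) x) :
    nablaForm φ x v a b (cross (φ x) a b) = 0 := by
  have ha := diffFieldAt_ext a
  have hb := diffFieldAt_ext b
  have hc := hφ.diffFieldAt_cross ha hb
  -- The identity $|a\times b|^2=|a|^2|b|^2-\langle a,b\rangle^2$ holds at every point. Comparing
  -- the derivatives of its two sides leaves exactly $2(\nabla_v\varphi)(a,b,a\times b)=0$.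
  have h1 : metricFn φ (fun y => cross (φ y) (ext a y) (ext b y))
      (fun y => cross (φ y) (ext a y) (ext b y)) =
      metricFn φ (ext a) (ext a) * metricFn φ (ext b) (ext b)
        - metricFn φ (ext a) (ext b) * metricFn φ (ext a) (ext b) := by
    ext y
    simp only [metricFn, Pi.sub_apply, Pi.mul_apply]
    rw [metric_cross, (hφ.positive y).form3_mid_cross]
  have h2 := hφ.dirDeriv_metricFn hc hc v
  rw [h1, dirDeriv_sub ((hφ.diffFunAt_metricFn ha ha).mul (hφ.diffFunAt_metricFn hb hb))
    ((hφ.diffFunAt_metricFn ha hb).mul (hφ.diffFunAt_metricFn ha hb)),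
    dirDeriv_mul (hφ.diffFunAt_metricFn ha ha) (hφ.diffFunAt_metricFn hb hb),
    dirDeriv_mul (hφ.diffFunAt_metricFn ha hb) (hφ.diffFunAt_metricFn ha hb),
    hφ.dirDeriv_metricFn ha ha, hφ.dirDeriv_metricFn ha hb, hφ.dirDeriv_metricFn hb hb] at h2
  have h3 := hφ.metric_nabla_cross ha hb v (cross (φ x) a b)
  simp only [metricFn, ext_apply] at h2 h3
  rw [(hφ.positive x).form3_mid_cross, (hφ.positive x).form3_left_cross] at h3
  rw [metric_symm (φ x) (cross (φ x) a b), h3, metric_symm (φ x) (nabla φ (ext a) x v) a,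
    metric_symm (φ x) (nabla φ (ext a) x v) b, metric_symm (φ x) (nabla φ (ext b) x v) b] at h2
  linarith

/-- Existence of the torsion. -/
theorem isTorsion_torsion : IsTorsion φ (torsion φ) := by
  have h (x : M) (v : TangentSpace (𝓡 7) x) := (hφ.positive x).exists_eq_psi
    (B := hφ.nablaTri v) (fun a b c => nablaForm_swap_left φ x v a b c)
    (fun a b c => nablaForm_swap_right φ x v a b c) fun a b => hφ.nablaForm_cross v a b
  choose t ht using h
  simp only [nablaTri_apply] at ht
  -- The vectors $t$ were chosen separately for each direction; their linear dependence on the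
  -- direction is forced by uniqueness.
  refine Classical.epsilon_spec (p := fun T => IsTorsion φ T) ⟨fun x =>
    { toFun := t x
      map_add' := fun v v' => (hφ.positive x).psi_left_injective fun a b c => ?_
      map_smul' := fun r v => (hφ.positive x).psi_left_injective fun a b c => ?_ }, ht⟩
  · have h1 := hφ.nablaForm_add_vec v v' a b c
    rw [ht, ht, ht] at h1
    rw [psi_add_left]
    linarith
  · have h1 := hφ.nablaForm_smul_vec r v a b c
    rw [ht, ht] at h1
    rw [RingHom.id_apply, psi_smul_left]
    linarith

end IsG2Structure

end nablaForm

end G2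
end

/-! ### Product rules on the octonion bundle. -/

noncomputable section
namespace G2

section octonionCalculus

open Filter Topology

variable {M : Type*} [TopologicalSpace M] [ChartedSpace E7 M] [IsManifold (𝓡 7) ∞ M]

/-- Differentiability of a section of the octonion bundle at a point. -/
structure DiffOctAt (A : OctField M) (x : M) : Prop where
  re : DiffFunAt (fun y => (A y).1) x
  im : DiffFieldAt (fun y => (A y).2) x

theorem IsSmoothOct.diff {A : OctField M} (hA : IsSmoothOct A) (x : M) : DiffOctAt A x :=
  ⟨(hA.re x).mdifferentiableAt (by simp), (hA.im x).diff⟩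

theorem diffFieldAt_zero (x : M) : DiffFieldAt (0 : VField M) x := by
  have h := (diffFieldAt_ext (0 : TangentSpace (𝓡 7) x)).smul
    (f := fun _ => 0) mdifferentiableAt_const
  convert h using 1
  ext y
  simp

theorem diffOctAt_ext {x : M} (a : TangentSpace (𝓡 7) x) :
    DiffOctAt (fun y => ((0, ext a y) : Oct (TangentSpace (𝓡 7) y))) x :=
  ⟨mdifferentiableAt_const, diffFieldAt_ext a⟩

namespace IsG2Structure

variable {φ : Form3 M} (hφ : IsG2Structure φ) {A B V : OctField M} {x : M}

include hφ

theorem diffOctAt_octMul (hA : DiffOctAt A x) (hB : DiffOctAt B x) :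
    DiffOctAt (fun y => octMul (φ y) (A y) (B y)) x :=
  ⟨(hA.re.mul hB.re).sub (hφ.diffFunAt_metricFn hA.im hB.im),
    ((hB.im.smul hA.re).add (hA.im.smul hB.re)).add (hφ.diffFieldAt_cross hA.im hB.im)⟩

theorem diffOctAt_octInv (hA : DiffOctAt A x) (hA0 : A x ≠ 0) :
    DiffOctAt (fun y => octInv (φ y) (A y)) x := by
  have hn : DiffFunAt (fun y => octNormSq (φ y) (A y)) x := by
    have h := (hA.re.mul hA.re).add (hφ.diffFunAt_metricFn hA.im hA.im)
    convert h using 1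
    ext y
    simp [octNormSq, metricFn, sq]
  have hi : DiffFunAt (fun y => (octNormSq (φ y) (A y))⁻¹) x :=
    MDifferentiableAt.comp x (g := fun t : ℝ => t⁻¹) (I' := 𝓘(ℝ, ℝ))
      (differentiableAt_inv (octNormSq_pos _ hA0).ne').mdifferentiableAt hn
  refine ⟨hi.mul hA.re, ?_⟩
  have h := (hA.im.smul (f := fun _ => -1) mdifferentiableAt_const).smul hi
  convert h using 1
  ext y
  simp [octInv]

/-- Only the cross product is not parallel. Its derivative contributes
$\nabla_v\varphi=2T(v)\lrcorner\psi$, which is the associator with $T(v)$. -/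
theorem nablaOct_octMul (hA : DiffOctAt A x) (hB : DiffOctAt B x) (v : TangentSpace (𝓡 7) x) :
    nablaOct φ (fun y => octMul (φ y) (A y) (B y)) x v =
      octMul (φ x) (nablaOct φ A x v) (B x) + octMul (φ x) (A x) (nablaOct φ B x v)
        + octAssoc (φ x) (0, torsion φ x v) (A x) (B x) := by
  have hc := hφ.diffFieldAt_cross hA.im hB.im
  have h1 : (fun y => (octMul (φ y) (A y) (B y)).1) =
      (fun y => (A y).1) * (fun y => (B y).1) - metricFn φ (fun y => (A y).2) (fun y => (B y).2) :=
    rfl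
  have h2 : (fun y => (octMul (φ y) (A y) (B y)).2) =
      (fun y => (A y).1) • (fun y => (B y).2) + (fun y => (B y).1) • (fun y => (A y).2)
        + fun y => cross (φ y) (A y).2 (B y).2 := rfl
  refine Prod.ext ?_ (metric_ext (φ := φ x) fun d => ?_)
  · simp only [nablaOct, h1, Prod.fst_add, octAssoc_fst]
    rw [dirDeriv_sub (hA.re.mul hB.re) (hφ.diffFunAt_metricFn hA.im hB.im),
      dirDeriv_mul hA.re hB.re, hφ.dirDeriv_metricFn hA.im hB.im]
    simp only [octMul]
    ring
  · simp only [nablaOct, h2, Prod.snd_add]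
    rw [hφ.nabla_add ((hB.im.smul hA.re).add (hA.im.smul hB.re)) hc,
      hφ.nabla_add (hB.im.smul hA.re) (hA.im.smul hB.re), hφ.nabla_smul hA.re hB.im,
      hφ.nabla_smul hB.re hA.im]
    simp only [map_add, map_smul, LinearMap.add_apply, LinearMap.smul_apply, smul_eq_mul,
      hφ.metric_nabla_cross hA.im hB.im, (hφ.positive x).metric_octAssoc_snd,
      hφ.isTorsion_torsion x v, octMul, metric_cross]
    ring

/-- Since $[T,A,B]=[A,B,T]=(AB)T-A(BT)$, subtracting $(AB)T$ leaves $-A(BT)$, which completes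
$A(\nabla B)$ to $A(DB)$. -/
theorem octD_octMul (hA : DiffOctAt A x) (hB : DiffOctAt B x) (v : TangentSpace (𝓡 7) x) :
    octD φ (fun y => octMul (φ y) (A y) (B y)) x v =
      octMul (φ x) (nablaOct φ A x v) (B x) + octMul (φ x) (A x) (octD φ B x v) := by
  rw [octD, octD, hφ.nablaOct_octMul hA hB, (hφ.positive x).octAssoc_rotate, octAssoc,
    octMul_sub_right]
  abel

/-- Derivative of the product `(A, B) ↦ (A(BV))V⁻¹`, i.e. of the product of `σ_V(φ)`. -/
theorem nablaOct_octMul_sigma (hV : IsSmoothOct V) (hV0 : ∀ x, V x ≠ 0) (hA : DiffOctAt A x)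
    (hB : DiffOctAt B x) (v : TangentSpace (𝓡 7) x) :
    nablaOct φ (fun y => octMul (G2.sigmaField φ V y) (A y) (B y)) x v =
      octMul (G2.sigmaField φ V x) (nablaOct φ A x v) (B x)
        + octMul (G2.sigmaField φ V x) (A x) (nablaOct φ B x v)
        - octAssoc (G2.sigmaField φ V x) (A x) (B x)
          (octMul (φ x) (octD φ V x v) (octInv (φ x) (V x))) := by
  have hs (y : M) := (hφ.positive y).octMul_sigma (hV0 y)
  have hp := hφ.positive x
  have hVx := hV.diff x
  set U := octMul (φ x) (octD φ V x v) (octInv (φ x) (V x)) with hU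
  have hUV : octMul (φ x) U (V x) = octD φ V x v := hp.octMul_octInv_octMul _ (hV0 x)
  set C : OctField M := fun y => octMul (G2.sigmaField φ V y) (A y) (B y) with hC
  have hCd : DiffOctAt C x := by
    have h : C = fun y => octMul (φ y) (octMul (φ y) (A y) (octMul (φ y) (B y) (V y)))
        (octInv (φ y) (V y)) := funext fun y => hs y _ _
    rw [h]
    exact hφ.diffOctAt_octMul (hφ.diffOctAt_octMul hA (hφ.diffOctAt_octMul hB hVx))
      (hφ.diffOctAt_octInv hVx (hV0 x))
  -- Multiplying by $V$ clears the inverse, so `octD_octMul` applies to both sides.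
  have hCV : (fun y => octMul (φ y) (C y) (V y)) =
      fun y => octMul (φ y) (A y) (octMul (φ y) (B y) (V y)) := by
    funext y
    simp only [hC, G2.sigmaField, hs]
    exact (hφ.positive y).octMul_octInv_octMul _ (hV0 y)
  have h1 := hφ.octD_octMul hCd hVx v
  rw [hCV, hφ.octD_octMul hA (hφ.diffOctAt_octMul hB hVx), hφ.octD_octMul hB hVx] at h1
  -- After substituting $D_vV=UV$, right multiplication by $V^{-1}$ turns every term into products
  -- of $\sigma_V(\varphi)$: $\nabla C+C\circ U=\nabla A\circ B+A\circ\nabla B+A\circ(B\circ U)$.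
  have h2 := congrArg (fun X => octMul (φ x) X (octInv (φ x) (V x))) h1
  simp only [octMul_add_left, octMul_add_right] at h2
  have hsV (X Y : Oct (TangentSpace (𝓡 7) x)) : octMul (φ x) (octMul (φ x) X
      (octMul (φ x) Y (V x))) (octInv (φ x) (V x)) = octMul (G2.sigmaField φ V x) X Y :=
    (hs x X Y).symm
  have hsV' (Y : Oct (TangentSpace (𝓡 7) x)) :
      octMul (φ x) (octMul (G2.sigmaField φ V x) (B x) Y) (V x) =
        octMul (φ x) (B x) (octMul (φ x) Y (V x)) := by
    rw [← hsV, hp.octMul_octInv_octMul _ (hV0 x)]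
  rw [← hUV, hsV, hsV, hsV, ← hsV', hsV, hp.octMul_octMul_octInv _ (hV0 x)] at h2
  rw [octAssoc, eq_sub_of_add_eq h2.symm, show C x = octMul (G2.sigmaField φ V x) (A x) (B x) from rfl]
  abel

end IsG2Structure

end octonionCalculus

end G2
end

/-! ### The torsion of the deformed structure. -/

noncomputable section
namespace G2

section torsionSigma

variable {M : Type*} [TopologicalSpace M] [ChartedSpace E7 M] [IsManifold (𝓡 7) ∞ M]

namespace IsG2Structure

variable {φ : Form3 M} (hφ : IsG2Structure φ) {V : OctField M}

include hφ

theorem nablaOct_sigmaField (hV0 : ∀ x, V x ≠ 0) {A : OctField M} {x : M} (hA : DiffOctAt A x)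
    (v : TangentSpace (𝓡 7) x) : nablaOct (G2.sigmaField φ V) A x v = nablaOct φ A x v :=
  Prod.ext rfl (hφ.nabla_congr_metric (fun y => ((hφ.positive y).metric_sigma (hV0 y)).symm) hA.im v)

/-- The two product rules for $\nabla(A\circ_VB)$ give $[T_V,A,B]_V=-[A,B,U]_V$. It is enough to
test on imaginary sections extending $a$ and $b$, as the 4-form of $\sigma_V(\varphi)$ is
nondegenerate in its first slot. -/
theorem torsion_sigmaField (hV : IsSmoothOct V) (hV0 : ∀ x, V x ≠ 0) (x : M)
    (v : TangentSpace (𝓡 7) x) : torsion (G2.sigmaField φ V) x v =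
      (-octMul (φ x) (octD φ V x v) (octInv (φ x) (V x))).2 := by
  have hσ := hφ.sigmaField hV hV0
  set U := octMul (φ x) (octD φ V x v) (octInv (φ x) (V x))
  refine (hσ.positive x).psi_left_injective fun a b d => ?_
  have ha := diffOctAt_ext a
  have hb := diffOctAt_ext b
  have h1 := hφ.nablaOct_octMul_sigma hV hV0 ha hb v
  rw [← hφ.nablaOct_sigmaField hV0 (hσ.diffOctAt_octMul ha hb), hσ.nablaOct_octMul ha hb,
    hφ.nablaOct_sigmaField hV0 ha, hφ.nablaOct_sigmaField hV0 hb, sub_eq_add_neg,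
    add_right_inj] at h1
  have h2 := congrArg (fun X => metric (G2.sigmaField φ V x) X.2 d) h1
  simp only [Prod.snd_neg, map_neg, LinearMap.neg_apply, (hσ.positive x).metric_octAssoc_snd,
    ext_apply] at h2
  have h3 := form4_rotate (psi (G2.sigmaField φ V x)) U.2 a b d
  rw [Prod.snd_neg, ← neg_one_smul ℝ U.2, psi_smul_left]
  linarith

/-- Differentiating $VV^{-1}=1$ gives $V(\nabla V^{-1})=-(\nabla V)V^{-1}$, because
$[T,V,V^{-1}]=0$: the imaginary part of $V^{-1}$ is a multiple of that of $V$. -/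
theorem octAd_torsion_add (hV : IsSmoothOct V) (hV0 : ∀ x, V x ≠ 0) (x : M)
    (v : TangentSpace (𝓡 7) x) :
    octAd (φ x) (V x) (0, torsion φ x v) +
      octMul (φ x) (V x) (nablaOct φ (fun y => octInv (φ y) (V y)) x v) =
      -octMul (φ x) (octD φ V x v) (octInv (φ x) (V x)) := by
  have hVx := hV.diff x
  have h1 := hφ.nablaOct_octMul hVx (hφ.diffOctAt_octInv hVx (hV0 x)) v
  have h2 : (fun y => octMul (φ y) (V y) (octInv (φ y) (V y))) =
      fun y => ((1, 0) : Oct (TangentSpace (𝓡 7) y)) :=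
    funext fun y => (hφ.positive y).octMul_octInv_self (hV0 y)
  have h3 : nablaOct φ (fun y => ((1, 0) : Oct (TangentSpace (𝓡 7) y))) x v = 0 := by
    have h4 := hφ.nabla_add (diffFieldAt_zero x) (diffFieldAt_zero x) v
    rw [add_zero, left_eq_add] at h4
    exact Prod.ext (dirDeriv_const 1 x v) h4
  rw [h2, h3, (hφ.positive x).octAssoc_octInv, add_zero] at h1
  rw [octAd, octD, octMul_sub_left, eq_neg_of_add_eq_zero_right h1.symm]
  abel

/-- The real part is $\|V\|^{-2}\langle D_vV,V\rangle$. Here $\langle\nabla_vV,V\rangle$ is half the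
derivative of the constant $\|V\|^2$, and $\langle VT,V\rangle=0$ because $T$ is imaginary. -/
theorem octMul_octD_octInv_fst (hV : IsSmoothOct V) {c : ℝ}
    (hc : ∀ x, octNorm (φ x) (V x) = c) (x : M) (v : TangentSpace (𝓡 7) x) :
    (octMul (φ x) (octD φ V x v) (octInv (φ x) (V x))).1 = 0 := by
  have hVx := hV.diff x
  have h1 : (fun y => (V y).1) * (fun y => (V y).1) + metricFn φ (fun y => (V y).2) (fun y => (V y).2)
      = fun _ => c ^ 2 := by
    funext y
    rw [← hc y, octNorm, Real.sq_sqrt]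
    · simp [octNormSq, metricFn, sq]
    · exact add_nonneg (sq_nonneg _) (metric_self_nonneg _ _)
  have h2 := dirDeriv_const (c ^ 2) x v
  rw [← h1, dirDeriv_add (hVx.re.mul hVx.re) (hφ.diffFunAt_metricFn hVx.im hVx.im),
    dirDeriv_mul hVx.re hVx.re, hφ.dirDeriv_metricFn hVx.im hVx.im] at h2
  rw [metric_symm (φ x) (V x).2] at h2
  simp only [octD, nablaOct, octMul, octInv, Prod.fst_sub, Prod.snd_sub, Prod.smul_fst,
    Prod.smul_snd, smul_neg, map_neg, map_smul, map_sub, map_add, LinearMap.sub_apply,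
    LinearMap.add_apply, LinearMap.smul_apply, smul_eq_mul, metric_cross, form3_self_outer]
  rw [metric_symm (φ x) (V x).2 (torsion φ x v)]
  linear_combination (octNormSq (φ x) (V x))⁻¹ / 2 * h2

end IsG2Structure

end torsionSigma

end G2
end

theorem theorem6p49 {M : Type*} [TopologicalSpace M] [ChartedSpace G2.E7 M]
    [IsManifold (𝓡 7) ∞ M] (φ : G2.Form3 M) (hφ : G2.IsG2Structure φ)
    (V : G2.OctField M) (hV : G2.IsSmoothOct V) (hV0 : ∀ x, V x ≠ 0) :
    G2.IsG2Structure (G2.sigmaField φ V) ∧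
    G2.IsTorsion φ (G2.torsion φ) ∧
    G2.IsTorsion (G2.sigmaField φ V) (G2.torsion (G2.sigmaField φ V)) ∧
    (∀ (x : M) (v : TangentSpace (𝓡 7) x),
      G2.torsion (G2.sigmaField φ V) x v =
        (G2.octAd (φ x) (V x) (0, G2.torsion φ x v) +
          G2.octMul (φ x) (V x)
            (G2.nablaOct φ (fun y => G2.octInv (φ y) (V y)) x v)).2) ∧
    ((∃ c : ℝ, ∀ x, G2.octNorm (φ x) (V x) = c) →
      ∀ (x : M) (v : TangentSpace (𝓡 7) x),
        ((0, G2.torsion (G2.sigmaField φ V) x v) : G2.Oct (TangentSpace (𝓡 7) x)) =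
          -G2.octMul (φ x) (G2.octD φ V x v) (G2.octInv (φ x) (V x))) := by
  refine ⟨hφ.sigmaField hV hV0, hφ.isTorsion_torsion, (hφ.sigmaField hV hV0).isTorsion_torsion,
    fun x v => ?_, ?_⟩
  · rw [hφ.octAd_torsion_add hV hV0, hφ.torsion_sigmaField hV hV0]
  · rintro ⟨c, hc⟩ x v
    refine Prod.ext ?_ (hφ.torsion_sigmaField hV hV0 x v)
    rw [Prod.fst_neg, hφ.octMul_octD_octInv_fst hV hc, neg_zero]
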